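/- Let $\Omega\subset\mathbb R^n$ be open, $1\le p<\infty$, and write $B(x,r)$ for the open ball, $\Omega(x,r)=\Omega\cap B(x,r)$, and $w(S)=\int_S w$. Let $w\in A_p(\mathbb R^n)$, i.e. $w$ is locally integrable, positive a.e., and $$\Big(\frac1{|B|}\int_B w\Big)\Big(\frac1{|B|}\int_B w^{-\frac1{p-1}}\Big)^{p-1}\le C\quad\text{for all balls } B\subset\mathbb R^n,$$ where for $p=1$ the second factor means $\operatorname{ess\,sup}_B w^{-1}$. Let $\varphi_1,\varphi_2$ be positive measurable functions on $\mathbb R^n\times(0,\infty)$ for which there is a constant $C$ such that for all $x\in\mathbb R^n$, $r>0$ $$\int_r^\infty \frac{\operatorname{ess\,inf}_{t<s<\infty}\varphi_1(x,s)\,w(B(x,s))^{1/p}}{w(B(x,t))^{1/p}}\,\frac{dt}{t}\le C\,\varphi_2(x,r).$$ Let $M_{p,\varphi}(\Omega,w)$ be the space of measurable $f$ on $\Omega$ with $$\|f\|_{M_{p,\varphi}(\Omega,w)}=\sup_{x\in\mathbb R^n,\,r>0}\varphi(x,r)^{-1}\,w(\Omega(x,r))^{-1/p}\Big(\int_{\Omega(x,r)}|f|^p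 w\Big)^{1/p}<\infty$$ (terms with $w(\Omega(x,r))=0$ count as $0$), and $M_{p,\varphi}(w)=M_{p,\varphi}(\mathbb R^n,w)$. Let $WM_{p,\varphi}(w)$ be the weak space with quasinorm $$\|g\|_{WM_{p,\varphi}(w)}=\sup_{x\in\mathbb R^n,\,r>0}\varphi(x,r)^{-1}\,w(B(x,r))^{-1/p}\,\sup_{t>0}\,t\,w(\{y\in B(x,r):|g(y)|>t\})^{1/p}.$$ Let $K(x,y)$ be the kernel of a Calderón–Zygmund operator: $K$ is continuous for $x\ne y$; there are $A$ and $\delta\in(0,1]$ with $|K(x,y)|\le A|x-y|^{-n}$ for $x\neq y$, $|K(x,y)-K(x',y)|\le A|x-x'|^\delta|x-y|^{-n-\delta}$ whenever $x\ne y$ and $|x-x'|\le\frac12|x-y|$, and the same estimate in the second variable; and there is a bounded linear operator $T$ on $L_2(\mathbb R^n)$ such that for all $f\in C_c^\infty(\mathbb R^n)$, $Tf(x)=\int K(x,y)f(y)\,dy$ for a.e. $x\notin\operatorname{supp}f$. Put $$K_\varepsilon f(x)=\int_{\mathbb R^n\setminus B(x,\varepsilon)}K(x,y)f(y)\,dy,\qquad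 K^*f(x)=\sup_{\varepsilon>0}|K_\varepsilon f(x)|,$$ functions on $\Omega$ being extended by zero. Then for every $f$ in $M_{p,\varphi_1}(\Omega,w)$ or in $M_{p,\varphi_1}(w)$ the integrals $K_\varepsilon f(x)$ converge absolutely for all $x\in\mathbb R^n$, $\varepsilon>0$, and $K^*f$ is measurable. If $p>1$, then $K^*$ is bounded from $M_{p,\varphi_1}(\Omega,w)$, and from $M_{p,\varphi_1}(w)$, to $M_{p,\varphi_2}(w)$. If $p=1$, then $K^*$ is bounded from $M_{1,\varphi_1}(\Omega,w)$, and from $M_{1,\varphi_1}(w)$, to $WM_{1,\varphi_2}(w)$. Here bounded means that the (quasi)norm of $K^*f$ is at most $C$ times the norm of $f$, with $C$ independent of $f$. -/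

import Mathlib

open MeasureTheory Metric Set
open scoped ENNReal NNReal

namespace WeightedMorrey

/-- Euclidean space of dimension `n`, with Lebesgue measure `volume`. -/
abbrev E (n : ℕ) : Type := EuclideanSpace ℝ (Fin n)

noncomputable section

/-! Weights -/

/-- The weighted measure `w(S)`, the integral of `w` over `S`. -/
def wMass {n : ℕ} (w : E n → ℝ) (S : Set (E n)) : ℝ≥0∞ :=
  ∫⁻ y in S, ENNReal.ofReal (w y)

/-- The second factor in the Muckenhoupt condition on the set `B`: the `(p-1)`-th power of the
mean over `B` of `w ^ (-1/(p-1))` if `p ≠ 1`, and the essential supremum of `1/w` over `B`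
(the usual meaning of that expression) if `p = 1`. -/
def dualMean {n : ℕ} (p : ℝ) (w : E n → ℝ) (B : Set (E n)) : ℝ≥0∞ :=
  if p = 1 then essSup (fun y => (ENNReal.ofReal (w y))⁻¹) (volume.restrict B)
  else ((volume B)⁻¹ * ∫⁻ y in B, ENNReal.ofReal (w y) ^ (-1 / (p - 1))) ^ (p - 1)

/-- The Muckenhoupt class `A_p` on the whole space: locally integrable weights, positive almost
everywhere, with the `A_p` condition over all balls. -/
structure IsMuckenhoupt {n : ℕ} (p : ℝ) (w : E n → ℝ) : Prop where
  locallyIntegrable : LocallyIntegrable w volume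
  pos : ∀ᵐ x, 0 < w x
  bound : ∃ C : ℝ≥0, ∀ (x : E n) (r : ℝ), 0 < r →
    ((volume (ball x r))⁻¹ * wMass w (ball x r)) * dualMean p w (ball x r) ≤ C

/-! Generalized weighted Morrey spaces. Functions enter the norms through their absolute value,
a function `g` with values in `[0, ∞]`. -/

/-- The norm of `L_{p,w}(S)`. -/
def wLpNorm {n : ℕ} (p : ℝ) (w : E n → ℝ) (g : E n → ℝ≥0∞) (S : Set (E n)) : ℝ≥0∞ :=
  (∫⁻ y in S, g y ^ p * ENNReal.ofReal (w y)) ^ (1 / p)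

/-- The quasinorm of weak `L_{p,w}(S)`: the supremum over `t > 0` of
`t * w({y ∈ S : g y > t}) ^ (1/p)`. -/
def wWeakLpNorm {n : ℕ} (p : ℝ) (w : E n → ℝ) (g : E n → ℝ≥0∞) (S : Set (E n)) : ℝ≥0∞ :=
  ⨆ (t : ℝ) (_ : 0 < t),
    ENNReal.ofReal t * wMass w {y | y ∈ S ∧ ENNReal.ofReal t < g y} ^ (1 / p)

/-- The norm of `M_{p,φ}(Ω,w)`: the supremum over all centres `x` and radii `r > 0` of
`φ(x,r)⁻¹ w(Ω(x,r))^(-1/p) ‖g‖_{L_{p,w}(Ω(x,r))}`, where `Ω(x,r) = Ω ∩ B(x,r)`. A term with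
`w(Ω(x,r)) = 0` counts as `0`. For `Ω = univ` this is the norm of `M_{p,φ}(w)`. -/
def morreyNorm {n : ℕ} (p : ℝ) (φ : E n → ℝ → ℝ) (w : E n → ℝ) (Ω : Set (E n))
    (g : E n → ℝ≥0∞) : ℝ≥0∞ :=
  ⨆ (x : E n) (r : ℝ) (_ : 0 < r),
    (ENNReal.ofReal (φ x r))⁻¹ * wMass w (Ω ∩ ball x r) ^ (-1 / p) *
      wLpNorm p w g (Ω ∩ ball x r)

/-- The quasinorm of the weak space `WM_{p,φ}(Ω,w)`. -/
def weakMorreyNorm {n : ℕ} (p : ℝ) (φ : E n → ℝ → ℝ) (w : E n → ℝ) (Ω : Set (E n))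
    (g : E n → ℝ≥0∞) : ℝ≥0∞ :=
  ⨆ (x : E n) (r : ℝ) (_ : 0 < r),
    (ENNReal.ofReal (φ x r))⁻¹ * wMass w (Ω ∩ ball x r) ^ (-1 / p) *
      wWeakLpNorm p w g (Ω ∩ ball x r)

/-- Membership in `M_{p,φ}(Ω,w)`. Finiteness of the norm makes `f` locally in `L_{p,w}`, and
in `L_{p,w}(Ω)` if `Ω` is bounded. -/
structure MemMorrey {n : ℕ} (p : ℝ) (φ : E n → ℝ → ℝ) (w : E n → ℝ) (Ω : Set (E n))
    (f : E n → ℂ) : Prop where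
  aestronglyMeasurable : AEStronglyMeasurable f (volume.restrict Ω)
  norm_lt_top : morreyNorm p φ w Ω (fun y => ‖f y‖ₑ) < ∞

/-- The condition on the pair `(φ₁, φ₂)`: for some constant `C` and all `x` and `r > 0`,
`∫_r^∞ (essinf_{t<s<∞} φ₁(x,s) w(B(x,s))^(1/p)) / w(B(x,t))^(1/p) dt/t ≤ C φ₂(x,r)`. -/
def PairCondition {n : ℕ} (p : ℝ) (φ₁ φ₂ : E n → ℝ → ℝ) (w : E n → ℝ) : Prop :=
  ∃ C : ℝ≥0, ∀ (x : E n) (r : ℝ), 0 < r →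
    (∫⁻ t in Ioi r,
      essInf (fun s => ENNReal.ofReal (φ₁ x s) * wMass w (ball x s) ^ (1 / p))
          (volume.restrict (Ioi t)) /
        wMass w (ball x t) ^ (1 / p) * ENNReal.ofReal (1 / t))
      ≤ C * ENNReal.ofReal (φ₂ x r)

/-! Calderon-Zygmund operators and their maximal truncations -/

/-- `K` is the kernel of a Calderon-Zygmund operator: it is continuous off the diagonal, it
satisfies the standard size and regularity estimates, and there is a bounded linear operator `T`
on `L_2` that is given by integration against `K`, for smooth compactly supported functions
and outside their support. -/
structure IsCalderonZygmund {n : ℕ} (K : E n → E n → ℂ) : Prop where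
  continuousOn : ContinuousOn (fun z : E n × E n => K z.1 z.2) {z | z.1 ≠ z.2}
  standard : ∃ (A δ : ℝ), 0 < δ ∧ δ ≤ 1 ∧
    (∀ x y : E n, x ≠ y → ‖K x y‖ ≤ A / ‖x - y‖ ^ n) ∧
    (∀ x x' y : E n, x ≠ y → ‖x - x'‖ ≤ ‖x - y‖ / 2 →
      ‖K x y - K x' y‖ ≤ A * ‖x - x'‖ ^ δ / ‖x - y‖ ^ ((n : ℝ) + δ)) ∧
    (∀ x y y' : E n, x ≠ y → ‖y - y'‖ ≤ ‖x - y‖ / 2 →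
      ‖K x y - K x y'‖ ≤ A * ‖y - y'‖ ^ δ / ‖x - y‖ ^ ((n : ℝ) + δ))
  operator : ∃ T : Lp ℂ 2 (volume : Measure (E n)) →L[ℂ] Lp ℂ 2 (volume : Measure (E n)),
    ∀ (f : E n → ℂ) (hf : MemLp f 2 volume),
      ContDiff ℝ ((⊤ : ℕ∞) : WithTop ℕ∞) f → HasCompactSupport f →
        ∀ᵐ x, x ∉ tsupport f → T (hf.toLp f) x = ∫ y, K x y * f y

/-- The truncated operator `K_ε f(x)`, integration over the complement of `B(x,ε)`. -/
def truncated {n : ℕ} (K : E n → E n → ℂ) (ε : ℝ) (f : E n → ℂ) (x : E n) : ℂ :=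
  ∫ y in (ball x ε)ᶜ, K x y * f y

/-- The maximal singular operator `K^* f(x) = sup_{ε > 0} |K_ε f(x)|`. -/
def maximalTruncated {n : ℕ} (K : E n → E n → ℂ) (f : E n → ℂ) (x : E n) : ℝ≥0∞ :=
  ⨆ (ε : ℝ) (_ : 0 < ε), ‖truncated K ε f x‖ₑ

/-- `K^*` is well defined and bounded from `M_{p,φ₁}(Ω,w)` to the (quasi)normed space of
functions on the whole space with (quasi)norm `N`. Functions on `Ω` are extended by zero. All the
truncated integrals converge absolutely, and `K^* f` is measurable with `N (K^* f) ≤ C ‖f‖`. -/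
def MaximalBounded {n : ℕ} (p : ℝ) (φ₁ : E n → ℝ → ℝ) (w : E n → ℝ) (Ω : Set (E n))
    (N : (E n → ℝ≥0∞) → ℝ≥0∞) (K : E n → E n → ℂ) : Prop :=
  ∃ C : ℝ≥0, ∀ f : E n → ℂ, MemMorrey p φ₁ w Ω f →
    (∀ (x : E n) (ε : ℝ), 0 < ε →
      IntegrableOn (fun y => K x y * Ω.indicator f y) (ball x ε)ᶜ volume) ∧
    AEMeasurable (maximalTruncated K (Ω.indicator f)) volume ∧
    N (maximalTruncated K (Ω.indicator f)) ≤ C * morreyNorm p φ₁ w Ω (fun y => ‖f y‖ₑ)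

end

end WeightedMorrey

/-!
# The maximal singular operator on generalized weighted Morrey spaces

Fix a ball `B = B(x,r)` and split `f` into its restriction `f₁` to `2B` and the rest `f₂`. On `B`,
the size of the kernel bounds `K^* f₂` by the integral of `|f(y)| |x - y|^{-n}` off `2B`. Fubini's
theorem turns this into an integral over `t > 2r` of the means of `|f|` over `B(x,t)` with respect
to `dt / t`, and the `A_p` condition bounds these means by
`w(B(x,t))^{-1/p} ‖f‖_{L_{p,w}(B(x,t))}`. For `f₁` the weighted bound of `K^*` is used; as `w` is
doubling, the result `w(B)^{-1/p} ‖f‖_{L_{p,w}(2B)}` is bounded by the same integral over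
`2r < t < 4r`. So everything is controlled by `morreyTail`. The local norms of `f` increase with
the radius, hence for `f` in the Morrey space they are at most `‖f‖` times the essential infimum in
the condition on `φ₁, φ₂`, and this condition gives the theorem (`morreyTail_le`,
`maximalBounded_of_local`). Functions on `Ω` are extended by zero (`wLpNorm_indicator_le`).

The weighted theory of `K^*` is built from the existence of `T` on `L_2`:

* The Hardy–Littlewood maximal function of a doubling measure is bounded on `L_q` by the Vitali
  covering theorem (`lintegral_maximalFn_rpow_le`). Muckenhoupt's theorem follows by composing the
  maximal functions for the measures `w dx` and `w^{-1/(p-1)} dx`, which are both doubling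
  (`IsMuckenhoupt.maximalFn_strong_type`).
* The mean over `z` near `x` of a comparison of `K_ε f(x)` with `T f(z)` gives an inequality of
  Cotlar type, `(K^* f)² ≤ C (M(|f|²) + M(|T f|²))`, and hence weak type `(2,2)`
  (`StandardKernel.exists_cotlar`, `StandardKernel.exists_weak_type_two`). It needs the
  representation of `T f` by the kernel for square integrable `f`, obtained by density
  (`StandardKernel.ae_apply_eq_integral`).
* A Calderón–Zygmund decomposition on Whitney balls of the set `{M f > t}` gives weak type `(1,1)`
  (`exists_isCZDecomposition`, `StandardKernel.exists_weak_type_one`).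
* A good-λ inequality compares `K^*` with the maximal function for the measure `w dx`
  (`exists_goodLambda`). The `A_∞` property with small constants is not needed: it suffices that
  the bad set has relative measure `C / (C + 1)`, if the ratio of the two heights is close enough
  to `1`. Integration gives the weighted bounds for functions with bounded support
  (`exists_weighted_strong_type`, `exists_weighted_weak_type`).
-/

namespace WeightedMorrey

noncomputable section

/-! ### Layer-cake formula -/

lemma setLIntegral_Ioo_rpow {q : ℝ} (hq : 0 < q) (a : ℝ≥0) :
    ENNReal.ofReal q * ∫⁻ t in Ioo 0 (a : ℝ), ENNReal.ofReal (t ^ (q - 1)) = (a : ℝ≥0∞) ^ q := by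
  have ha : (0 : ℝ) ≤ a := a.2
  rw [← ENNReal.ofReal_coe_nnreal, ENNReal.ofReal_rpow_of_nonneg ha hq.le]
  have hint : IntervalIntegrable (fun t : ℝ => t ^ (q - 1)) volume 0 a :=
    intervalIntegral.intervalIntegrable_rpow' (by linarith)
  have hI : IntegrableOn (fun t : ℝ => t ^ (q - 1)) (Ioc 0 a) volume :=
    (intervalIntegrable_iff_integrableOn_Ioc_of_le ha).1 hint
  rw [setLIntegral_congr Ioo_ae_eq_Ioc, ← ofReal_integral_eq_lintegral_ofReal hI
    ((ae_restrict_iff' measurableSet_Ioc).2 (.of_forall fun t ht => Real.rpow_nonneg ht.1.le _)),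
    ← intervalIntegral.integral_of_le ha, integral_rpow (.inl (by linarith)),
    ← ENNReal.ofReal_mul hq.le]
  congr 1
  rw [sub_add_cancel, Real.zero_rpow hq.ne']
  field_simp
  ring

/-- A power `a ^ q` as an integral over the heights `t` below `a`, also for `a = ∞`. -/
lemma rpow_eq_setLIntegral {q : ℝ} (hq : 0 < q) (a : ℝ≥0∞) :
    a ^ q = ENNReal.ofReal q *
      ∫⁻ t in Ioi 0, {t : ℝ | ENNReal.ofReal t < a}.indicator
        (fun t => ENNReal.ofReal (t ^ (q - 1))) t := by
  have key : ∀ b : ℝ≥0, (b : ℝ≥0∞) ≤ a → (b : ℝ≥0∞) ^ q ≤ ENNReal.ofReal q *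
      ∫⁻ t in Ioi 0, {t : ℝ | ENNReal.ofReal t < a}.indicator
        (fun t => ENNReal.ofReal (t ^ (q - 1))) t := by
    intro b hb
    rw [← setLIntegral_Ioo_rpow hq b]
    gcongr ENNReal.ofReal q * ?_
    rw [← lintegral_indicator measurableSet_Ioo, ← lintegral_indicator measurableSet_Ioi]
    refine lintegral_mono fun t => ?_
    by_cases ht : t ∈ Ioo (0 : ℝ) b
    · have h1 : ENNReal.ofReal t < a := by
        refine lt_of_lt_of_le ?_ hb
        rw [← ENNReal.ofReal_coe_nnreal, ENNReal.ofReal_lt_ofReal_iff (ht.1.trans ht.2)]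
        exact ht.2
      simp [indicator, ht.1, ht.2, h1]
    · simp [indicator_of_notMem, ht]
  refine le_antisymm ?_ ?_
  · by_cases ha : a = ∞
    · subst ha
      rw [ENNReal.top_rpow_of_pos hq, top_le_iff]
      refine ENNReal.eq_top_of_forall_nnreal_le fun r => ?_
      have := key (r ^ (1 / q)) le_top
      rwa [ENNReal.coe_rpow_of_nonneg _ (by positivity), ← ENNReal.rpow_mul,
        one_div_mul_cancel hq.ne', ENNReal.rpow_one] at this
    · lift a to ℝ≥0 using ha
      exact key a le_rfl
  · by_cases ha : a = ∞
    · simp [ha, hq]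
    lift a to ℝ≥0 using ha
    rw [← setLIntegral_Ioo_rpow hq a]
    gcongr ENNReal.ofReal q * ?_
    rw [← lintegral_indicator measurableSet_Ioo, ← lintegral_indicator measurableSet_Ioi]
    refine lintegral_mono fun t => ?_
    by_cases ht : t ∈ Ioi (0 : ℝ)
    · by_cases h1 : ENNReal.ofReal t < a
      · have : t < a := by
          rwa [← ENNReal.ofReal_coe_nnreal, ENNReal.ofReal_lt_ofReal_iff_of_nonneg (le_of_lt ht)]
            at h1
        have h3 : t ∈ Ioo (0 : ℝ) a := ⟨ht, this⟩
        rw [indicator_of_mem ht, indicator_of_mem (by exact h1), indicator_of_mem h3]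
      · rw [indicator_of_mem ht, indicator_of_notMem (by exact h1)]
        exact zero_le
    · rw [indicator_of_notMem ht]
      exact zero_le

/-- Layer-cake formula for a function with values in `[0, ∞]`. -/
lemma lintegral_rpow_eq_layercake {α : Type*} [MeasurableSpace α] (μ : Measure α) [SFinite μ]
    {q : ℝ} (hq : 0 < q) {F : α → ℝ≥0∞} (hF : Measurable F) :
    ∫⁻ x, F x ^ q ∂μ = ENNReal.ofReal q *
      ∫⁻ t in Ioi (0 : ℝ), ENNReal.ofReal (t ^ (q - 1)) * μ {x | ENNReal.ofReal t < F x} := by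
  have hms : MeasurableSet {z : α × ℝ | ENNReal.ofReal z.2 < F z.1} :=
    measurableSet_lt (ENNReal.measurable_ofReal.comp measurable_snd) (hF.comp measurable_fst)
  have hmi : Measurable fun z : α × ℝ => {z : α × ℝ | ENNReal.ofReal z.2 < F z.1}.indicator
      (fun z => ENNReal.ofReal (z.2 ^ (q - 1))) z :=
    Measurable.indicator (by fun_prop) hms
  simp_rw [rpow_eq_setLIntegral hq (F _)]
  rw [lintegral_const_mul' _ _ ENNReal.ofReal_ne_top]
  congr 1
  refine (lintegral_lintegral_swap (f := fun x t => {z : α × ℝ | ENNReal.ofReal z.2 <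
      F z.1}.indicator (fun z => ENNReal.ofReal (z.2 ^ (q - 1))) (x, t)) hmi.aemeasurable).trans ?_
  refine lintegral_congr fun t => ?_
  have hm : MeasurableSet {x | ENNReal.ofReal t < F x} := measurableSet_lt measurable_const hF
  rw [← lintegral_indicator_const hm]
  exact lintegral_congr fun x => by simp [indicator]

/-! ### The uncentred maximal function of a doubling measure -/

section Maximal

variable {α : Type*} [MetricSpace α] [MeasurableSpace α]

/-- The uncentred Hardy–Littlewood maximal function of `g` with respect to the measure `μ`: the
supremum of the `μ`-means of `g` over all open balls that contain the point. -/
def maximalFn (μ : Measure α) (g : α → ℝ≥0∞) (x : α) : ℝ≥0∞ :=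
  ⨆ (c : α) (r : ℝ) (_ : x ∈ ball c r), (∫⁻ y in ball c r, g y ∂μ) / μ (ball c r)

/-- The doubling condition for open balls with the dilation factor `5` of the Vitali covering
theorem. -/
def BallDoubling (μ : Measure α) (D : ℝ≥0) : Prop :=
  ∀ (x : α) (r : ℝ), 0 < r → μ (ball x (5 * r)) ≤ D * μ (ball x r)

variable {μ : Measure α} {g h : α → ℝ≥0∞}

lemma lt_maximalFn_iff {x : α} {t : ℝ≥0∞} : t < maximalFn μ g x ↔
    ∃ (c : α) (r : ℝ), x ∈ ball c r ∧ t < (∫⁻ y in ball c r, g y ∂μ) / μ (ball c r) := by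
  simp only [maximalFn, lt_iSup_iff, exists_prop]

lemma isOpen_lt_maximalFn (t : ℝ≥0∞) : IsOpen {x | t < maximalFn μ g x} := by
  rw [isOpen_iff_forall_mem_open]
  intro x hx
  obtain ⟨c, r, hxc, ht⟩ := lt_maximalFn_iff.1 hx
  exact ⟨ball c r, fun y hy => lt_maximalFn_iff.2 ⟨c, r, hy, ht⟩, isOpen_ball, hxc⟩

lemma measurable_maximalFn [BorelSpace α] : Measurable (maximalFn μ g) :=
  measurable_of_Ioi fun t => (isOpen_lt_maximalFn t).measurableSet

lemma setLIntegral_ball_le_maximalFn {x c : α} {r : ℝ} (hx : x ∈ ball c r)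
    (hfin : μ (ball c r) ≠ ∞) :
    ∫⁻ y in ball c r, g y ∂μ ≤ maximalFn μ g x * μ (ball c r) := by
  by_cases h0 : μ (ball c r) = 0
  · rw [setLIntegral_measure_zero _ _ h0]; exact zero_le
  · rw [← ENNReal.div_le_iff h0 hfin]
    exact le_iSup_of_le c (le_iSup_of_le r (le_iSup_of_le hx le_rfl))

lemma maximalFn_mono (hgh : ∀ x, g x ≤ h x) (x : α) : maximalFn μ g x ≤ maximalFn μ h x := by
  refine iSup_mono fun c => iSup_mono fun r => iSup_mono fun _ => ?_
  gcongr
  exact hgh _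

lemma maximalFn_add_const_le (t : ℝ≥0∞) (x : α) :
    maximalFn μ (fun y => g y + t) x ≤ maximalFn μ g x + t := by
  refine iSup_le fun c => iSup_le fun r => iSup_le fun hx => ?_
  rw [lintegral_add_right _ measurable_const, setLIntegral_const, ENNReal.add_div]
  gcongr
  · exact le_iSup_of_le c (le_iSup_of_le r (le_iSup_of_le hx le_rfl))
  · rw [mul_div_assoc]
    exact mul_le_of_le_one_right' ENNReal.div_self_le_one

variable [BorelSpace α] [SecondCountableTopology α]

/-- Weak type `(1,1)` of the maximal function of a doubling measure. -/
theorem mul_measure_lt_maximalFn_le {D : ℝ≥0} (hμ : BallDoubling μ D) (g : α → ℝ≥0∞)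
    (t : ℝ≥0∞) : t * μ {x | t < maximalFn μ g x} ≤ D * ∫⁻ y, g y ∂μ := by
  -- The radii are bounded by `N` in order to apply the Vitali covering theorem; then `N → ∞`.
  let S : ℕ → Set α := fun N => {x | ∃ (c : α) (r : ℝ), r ≤ N ∧ x ∈ ball c r ∧
    t < (∫⁻ y in ball c r, g y ∂μ) / μ (ball c r)}
  have hS : {x | t < maximalFn μ g x} = ⋃ N, S N := by
    ext x
    simp only [mem_ofPred_eq, lt_maximalFn_iff, mem_iUnion, S]
    constructor
    · rintro ⟨c, r, hx, ht⟩
      obtain ⟨N, hN⟩ := exists_nat_ge r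
      exact ⟨N, c, r, hN, hx, ht⟩
    · rintro ⟨N, c, r, -, hx, ht⟩
      exact ⟨c, r, hx, ht⟩
  have hmono : Monotone S := by
    rintro N N' hN x ⟨c, r, hr, h⟩
    exact ⟨c, r, hr.trans (by exact_mod_cast hN), h⟩
  rw [hS, hmono.measure_iUnion, ENNReal.mul_iSup]
  refine iSup_le fun N => ?_
  let T : Set (α × ℝ) := {z | 0 < z.2 ∧ z.2 ≤ N ∧
    t < (∫⁻ y in ball z.1 z.2, g y ∂μ) / μ (ball z.1 z.2)}
  obtain ⟨u, huT, hdisj, hcov⟩ := Vitali.exists_disjoint_subfamily_covering_enlargement_ball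
    T Prod.fst Prod.snd N (fun a ha => ha.2.1) 5 (by norm_num)
  have hcount : u.Countable := hdisj.countable_of_isOpen (fun _ _ => isOpen_ball)
    fun a ha => nonempty_ball.2 (huT ha).1
  have hsub : S N ⊆ ⋃ a ∈ u, ball a.1 (5 * a.2) := by
    rintro x ⟨c, r, hr, hx, ht⟩
    obtain ⟨b, hb, hsub⟩ := hcov (c, r) ⟨pos_of_mem_ball hx, hr, ht⟩
    exact mem_biUnion hb (hsub hx)
  calc t * μ (S N) ≤ t * μ (⋃ a ∈ u, ball a.1 (5 * a.2)) := by gcongr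
    _ ≤ t * ∑' a : u, μ (ball a.1.1 (5 * a.1.2)) := by
        gcongr
        exact measure_biUnion_le μ hcount _
    _ = ∑' a : u, t * μ (ball a.1.1 (5 * a.1.2)) := ENNReal.tsum_mul_left.symm
    _ ≤ ∑' a : u, D * ∫⁻ y in ball a.1.1 a.1.2, g y ∂μ := by
        refine ENNReal.tsum_le_tsum fun a => ?_
        obtain ⟨h0, -, ht⟩ := huT a.2
        calc t * μ (ball a.1.1 (5 * a.1.2)) ≤ t * (D * μ (ball a.1.1 a.1.2)) := by
              gcongr
              exact hμ _ _ h0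
          _ = D * (t * μ (ball a.1.1 a.1.2)) := by ring
          _ ≤ _ := by
              gcongr
              exact ENNReal.mul_le_of_le_div ht.le
    _ = D * ∫⁻ y in ⋃ a ∈ u, ball a.1 a.2, g y ∂μ := by
        rw [ENNReal.tsum_mul_left, lintegral_biUnion hcount (fun _ _ => measurableSet_ball) hdisj]
    _ ≤ _ := by exact mul_le_mul_right (setLIntegral_le_lintegral _ _) _

/-- The maximal function of a doubling measure is bounded on `L_q` for `q > 1`. -/
theorem lintegral_maximalFn_rpow_le {D : ℝ≥0} (hμ : BallDoubling μ D) [SFinite μ] {q : ℝ}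
    (hq : 1 < q) : ∃ C : ℝ≥0, ∀ g : α → ℝ≥0∞, AEMeasurable g μ →
      ∫⁻ x, maximalFn μ g x ^ q ∂μ ≤ C * ∫⁻ x, g x ^ q ∂μ := by
  have hq0 : 0 < q := by linarith
  have hq1 : 0 < q - 1 := by linarith
  refine ⟨(q * (2 * D) / (q - 1) * 2 ^ (q - 1)).toNNReal, fun g hg => ?_⟩
  wlog hgm : Measurable g generalizing g
  · have h := this (hg.mk g) hg.measurable_mk.aemeasurable hg.measurable_mk
    have h1 : maximalFn μ (hg.mk g) = maximalFn μ g := by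
      funext x
      refine iSup_congr fun c => iSup_congr fun r => iSup_congr fun _ => ?_
      rw [setLIntegral_congr_fun_ae measurableSet_ball (hg.ae_eq_mk.mono fun y hy _ => hy.symm)]
    rw [h1, lintegral_congr_ae (hg.ae_eq_mk.mono fun y hy => by
      simp only [hy] : (fun x => hg.mk g x ^ q) =ᵐ[μ] fun x => g x ^ q)] at h
    exact h
  -- Cutting `g` at half the height improves the weak type estimate.
  have hweak : ∀ t : ℝ, 0 < t → μ {x | ENNReal.ofReal t < maximalFn μ g x} ≤
      ENNReal.ofReal (2 * D / t) *
        ∫⁻ y, {y | ENNReal.ofReal (t / 2) < g y}.indicator g y ∂μ := by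
    intro t ht
    set gt := {y | ENNReal.ofReal (t / 2) < g y}.indicator g
    have hsub : {x | ENNReal.ofReal t < maximalFn μ g x} ⊆
        {x | ENNReal.ofReal (t / 2) < maximalFn μ gt x} := by
      intro x hx
      by_contra hcon
      simp only [mem_ofPred_eq, not_lt] at hx hcon
      have h1 : maximalFn μ g x ≤ maximalFn μ gt x + ENNReal.ofReal (t / 2) := by
        refine (maximalFn_mono (h := fun y => gt y + ENNReal.ofReal (t / 2)) (fun y => ?_) x).trans
          (maximalFn_add_const_le _ x)
        by_cases hy : ENNReal.ofReal (t / 2) < g y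
        · simp [gt, hy]
        · simp only [gt, indicator, mem_ofPred_eq, hy, if_false, zero_add]
          exact not_lt.1 hy
      have h2 : maximalFn μ g x ≤ ENNReal.ofReal t := by
        refine h1.trans ((add_le_add_left hcon _).trans ?_)
        rw [← ENNReal.ofReal_add (by positivity) (by positivity), add_halves]
      exact absurd hx (not_lt.2 h2)
    have hw := mul_measure_lt_maximalFn_le hμ gt (ENNReal.ofReal (t / 2))
    have ht2 : ENNReal.ofReal (t / 2) ≠ 0 := by simpa using ht
    calc _ ≤ μ {x | ENNReal.ofReal (t / 2) < maximalFn μ gt x} := measure_mono hsub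
      _ ≤ (D * ∫⁻ y, gt y ∂μ) / ENNReal.ofReal (t / 2) := by
          rw [ENNReal.le_div_iff_mul_le (.inl ht2) (.inl ENNReal.ofReal_ne_top), mul_comm]
          exact hw
      _ = _ := by
          rw [ENNReal.mul_div_right_comm]
          congr 1
          rw [← ENNReal.ofReal_coe_nnreal, ← ENNReal.ofReal_div_of_pos (by positivity)]
          congr 1
          field_simp
  rw [lintegral_rpow_eq_layercake μ hq0 measurable_maximalFn]
  have hms : MeasurableSet {z : ℝ × α | ENNReal.ofReal (z.1 / 2) < g z.2} :=
    measurableSet_lt (by fun_prop) (hgm.comp measurable_snd)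
  calc _ ≤ ENNReal.ofReal q * ∫⁻ t in Ioi (0 : ℝ), ENNReal.ofReal (2 * D * t ^ (q - 2)) *
        ∫⁻ y, {y | ENNReal.ofReal (t / 2) < g y}.indicator g y ∂μ := by
        gcongr ENNReal.ofReal q * ?_
        refine setLIntegral_mono' measurableSet_Ioi fun t ht => ?_
        have ht : 0 < t := ht
        refine (mul_le_mul_right (hweak t ht) _).trans ?_
        rw [← mul_assoc, ← ENNReal.ofReal_mul (by positivity)]
        refine mul_le_mul_left (ENNReal.ofReal_le_ofReal (le_of_eq ?_)) _
        rw [show q - 1 = (q - 2) + 1 by ring, Real.rpow_add ht, Real.rpow_one]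
        field_simp
    _ = ENNReal.ofReal q * ∫⁻ t in Ioi (0 : ℝ), ∫⁻ y,
          {z : ℝ × α | ENNReal.ofReal (z.1 / 2) < g z.2}.indicator
            (fun z => ENNReal.ofReal (2 * D * z.1 ^ (q - 2)) * g z.2) (t, y) ∂μ := by
        congr 1
        refine lintegral_congr fun t => ?_
        rw [← lintegral_const_mul' _ _ ENNReal.ofReal_ne_top]
        refine lintegral_congr fun y => ?_
        by_cases hy : ENNReal.ofReal (t / 2) < g y <;> simp [indicator, hy]
    _ = ENNReal.ofReal q * ∫⁻ y, (∫⁻ t in Ioi (0 : ℝ),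
          {z : ℝ × α | ENNReal.ofReal (z.1 / 2) < g z.2}.indicator
            (fun z => ENNReal.ofReal (2 * D * z.1 ^ (q - 2)) * g z.2) (t, y)) ∂μ := by
        congr 1
        refine lintegral_lintegral_swap (Measurable.aemeasurable ?_)
        exact Measurable.indicator (by fun_prop) hms
    _ ≤ ENNReal.ofReal q * ∫⁻ y, ENNReal.ofReal (2 * D / (q - 1) * 2 ^ (q - 1)) * g y ^ q ∂μ := by
        refine mul_le_mul_right (lintegral_mono fun y => ?_) _
        have h1 := rpow_eq_setLIntegral hq1 (2 * g y)
        have h2 : ∀ t : ℝ, {z : ℝ × α | ENNReal.ofReal (z.1 / 2) < g z.2}.indicator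
          (fun z => ENNReal.ofReal (2 * D * z.1 ^ (q - 2)) * g z.2) (t, y) =
          (ENNReal.ofReal (2 * D) * g y) * {t : ℝ | ENNReal.ofReal t < 2 * g y}.indicator
            (fun t => ENNReal.ofReal (t ^ (q - 1 - 1))) t := by
          intro t
          have h3 : ENNReal.ofReal (t / 2) < g y ↔ ENNReal.ofReal t < 2 * g y := by
            rw [ENNReal.ofReal_div_of_pos (by norm_num), ENNReal.div_lt_iff (by simp) (by simp),
              mul_comm]
            simp
          by_cases hy : ENNReal.ofReal (t / 2) < g y
          · have hy' := h3.1 hy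
            simp only [indicator, mem_ofPred_eq, hy, hy', if_true]
            rw [ENNReal.ofReal_mul (by positivity), show q - 1 - 1 = q - 2 by ring]
            ring
          · have hy' : ¬ ENNReal.ofReal t < 2 * g y := fun h => hy (h3.2 h)
            simp only [indicator, mem_ofPred_eq, hy, hy', if_false, mul_zero]
        simp_rw [h2]
        have hmi : Measurable fun t : ℝ => {t : ℝ | ENNReal.ofReal t < 2 * g y}.indicator
            (fun t => ENNReal.ofReal (t ^ (q - 1 - 1))) t :=
          Measurable.indicator (by fun_prop)
            (measurableSet_lt ENNReal.measurable_ofReal measurable_const)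
        rw [lintegral_const_mul _ hmi]
        have h4 : (∫⁻ t in Ioi (0 : ℝ), {t : ℝ | ENNReal.ofReal t < 2 * g y}.indicator
            (fun t => ENNReal.ofReal (t ^ (q - 1 - 1))) t) =
            ENNReal.ofReal (1 / (q - 1)) * (2 * g y) ^ (q - 1) := by
          rw [h1, ← mul_assoc, ← ENNReal.ofReal_mul (by positivity), one_div_mul_cancel hq1.ne',
            ENNReal.ofReal_one, one_mul]
        rw [h4, ENNReal.mul_rpow_of_nonneg _ _ hq1.le]
        apply le_of_eq
        have h5 : g y ^ q = g y * g y ^ (q - 1) := by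
          conv_rhs => rw [← ENNReal.rpow_one (g y)]
          rw [← ENNReal.rpow_mul, one_mul, ← ENNReal.rpow_add_of_nonneg _ _ zero_le_one hq1.le]
          congr 1; ring
        have h6 : ENNReal.ofReal (2 * D / (q - 1) * 2 ^ (q - 1)) =
            ENNReal.ofReal (2 * D) * ENNReal.ofReal (1 / (q - 1)) * 2 ^ (q - 1) := by
          rw [← ENNReal.ofReal_mul (by positivity), div_eq_mul_one_div,
            ENNReal.ofReal_mul (by positivity), ← ENNReal.ofReal_rpow_of_pos (by norm_num)]
          simp
        rw [h5, h6]
        ring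
    _ = _ := by
        rw [lintegral_const_mul' _ _ ENNReal.ofReal_ne_top, ← mul_assoc,
          ← ENNReal.ofReal_mul hq0.le]
        congr 1
        change _ = ENNReal.ofReal _
        congr 1
        ring

end Maximal

/-! ### Whitney covering, volumes of balls and integrals over complements of balls -/

/-- Whitney-type covering of an open set with bounded inradius by balls whose radius is
comparable to the distance to the complement: the balls `ball c (ρ c)` are disjoint and their
dilations by the factor `5` cover the set. The radius `ρ c` is the distance of `c` to the
complement divided by `40`, so that the dilation by `40` stays in the set and the one by `41`
leaves it. -/
lemma exists_whitney_balls {α : Type*} [MetricSpace α] [SecondCountableTopology α] {U : Set α}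
    (hU : IsOpen U) (hne : Uᶜ.Nonempty) {R : ℝ} (hR : ∀ x ∈ U, infDist x Uᶜ ≤ R) :
    ∃ (u : Set α) (ρ : α → ℝ), u.Countable ∧ (∀ c ∈ u, 0 < ρ c) ∧
      (∀ c ∈ u, ball c (40 * ρ c) ⊆ U) ∧ (∀ c ∈ u, ∃ z ∉ U, dist z c < 41 * ρ c) ∧
      u.PairwiseDisjoint (fun c => ball c (ρ c)) ∧ U ⊆ ⋃ c ∈ u, ball c (5 * ρ c) := by
  let ρ : α → ℝ := fun c => infDist c Uᶜ / 40
  have hpos : ∀ c ∈ U, 0 < ρ c := fun c hc => by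
    have := (hU.isClosed_compl.notMem_iff_infDist_pos hne).1 (fun h : c ∈ Uᶜ => h hc)
    positivity
  obtain ⟨u, huU, hdisj, hcov⟩ := Vitali.exists_disjoint_subfamily_covering_enlargement_ball
    U id ρ (R / 40) (fun a ha => div_le_div_of_nonneg_right (hR a ha) (by norm_num)) 5
    (by norm_num)
  refine ⟨u, ρ, hdisj.countable_of_isOpen (fun _ _ => isOpen_ball)
    fun a ha => nonempty_ball.2 (hpos a (huU ha)), fun c hc => hpos c (huU hc), ?_, ?_, hdisj, ?_⟩
  · intro c _ y hy
    by_contra hyU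
    have := infDist_le_dist_of_mem (x := c) (s := Uᶜ) hyU
    rw [mem_ball, dist_comm] at hy
    simp only [ρ] at hy
    linarith
  · intro c hc
    have h := hpos c (huU hc)
    obtain ⟨z, hz, hd⟩ := (infDist_lt_iff hne (x := c) (r := 41 * ρ c)).1 (by
      simp only [ρ] at h ⊢; linarith)
    exact ⟨z, hz, by rwa [dist_comm]⟩
  · intro x hx
    obtain ⟨b, hb, hsub⟩ := hcov x hx
    exact mem_biUnion hb (hsub (mem_ball_self (hpos x hx)))

section Volume

variable {n : ℕ}

lemma volume_ball_eq (x : E n) {r : ℝ} (hr : 0 < r) :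
    volume (ball x r) = ENNReal.ofReal (r ^ n) * volume (ball (0 : E n) 1) := by
  rw [Measure.addHaar_ball_of_pos _ x hr, finrank_euclideanSpace_fin]

lemma volume_unitBall_ne_zero : volume (ball (0 : E n) 1) ≠ 0 :=
  (measure_ball_pos _ _ one_pos).ne'

lemma volume_unitBall_ne_top : volume (ball (0 : E n) 1) ≠ ∞ := measure_ball_lt_top.ne

lemma volume_ball_mul (x y : E n) {a r : ℝ} (ha : 0 < a) (hr : 0 < r) :
    volume (ball x (a * r)) = ENNReal.ofReal (a ^ n) * volume (ball y r) := by
  rw [volume_ball_eq x (mul_pos ha hr), volume_ball_eq y hr, mul_pow,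
    ENNReal.ofReal_mul (by positivity), mul_assoc]

lemma ballDoubling_volume : BallDoubling (volume : Measure (E n)) (5 ^ n) := by
  intro x r hr
  rw [volume_ball_mul x x (by norm_num) hr]
  gcongr
  rw [ENNReal.ofReal_pow (by norm_num)]
  simp

lemma setLIntegral_Ioi_rpow {s a : ℝ} (hs : 0 < s) (ha : 0 < a) :
    ENNReal.ofReal s * ∫⁻ t in Ioi a, ENNReal.ofReal (t ^ (-s - 1)) =
      ENNReal.ofReal (a ^ (-s)) := by
  rw [← ofReal_integral_eq_lintegral_ofReal (integrableOn_Ioi_rpow_of_lt (by linarith) ha)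
    ((ae_restrict_iff' measurableSet_Ioi).2 (.of_forall fun t ht =>
      Real.rpow_nonneg (ha.trans ht).le _)), integral_Ioi_rpow_of_lt (by linarith) ha,
    ← ENNReal.ofReal_mul hs.le]
  congr 1
  rw [sub_add_cancel]
  field_simp

/-- Integrals against a power of the distance over the complement of a ball are controlled by
the integrals over larger balls. -/
lemma lintegral_compl_ball_le {g : E n → ℝ≥0∞} (hg : AEMeasurable g volume) (x : E n)
    {s a : ℝ} (hs : 0 < s) (ha : 0 < a) :
    ∫⁻ y in (ball x a)ᶜ, g y * ENNReal.ofReal (dist x y ^ (-s)) ≤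
      ENNReal.ofReal s *
        ∫⁻ t in Ioi a, ENNReal.ofReal (t ^ (-s - 1)) * ∫⁻ y in ball x t, g y := by
  have hms : MeasurableSet {z : E n × ℝ | dist x z.1 < z.2} :=
    measurableSet_lt (by fun_prop) (by fun_prop)
  have hpt : ∀ y ∈ (ball x a)ᶜ, g y * ENNReal.ofReal (dist x y ^ (-s)) = ENNReal.ofReal s *
      ∫⁻ t in Ioi a, {z : E n × ℝ | dist x z.1 < z.2}.indicator
        (fun z => g z.1 * ENNReal.ofReal (z.2 ^ (-s - 1))) (y, t) := by
    intro y hy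
    have hd : a ≤ dist x y := by simpa [dist_comm] using hy
    rw [← setLIntegral_Ioi_rpow hs (ha.trans_le hd), mul_left_comm,
      ← lintegral_const_mul _ (by fun_prop)]
    congr 1
    rw [← lintegral_indicator measurableSet_Ioi, ← lintegral_indicator measurableSet_Ioi]
    refine lintegral_congr fun t => ?_
    by_cases h : dist x y < t
    · have h2 : a < t := hd.trans_lt h
      simp [indicator, h, h2]
    · simp [indicator, h]
  rw [setLIntegral_congr_fun measurableSet_ball.compl hpt,
    lintegral_const_mul' _ _ ENNReal.ofReal_ne_top,
    lintegral_lintegral_swap (f := fun y t => {z : E n × ℝ | dist x z.1 < z.2}.indicator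
        (fun z => g z.1 * ENNReal.ofReal (z.2 ^ (-s - 1))) (y, t))]
  · gcongr ENNReal.ofReal s * ?_
    refine lintegral_mono fun t => ?_
    refine (setLIntegral_le_lintegral _ _).trans ?_
    rw [← lintegral_const_mul' _ _ ENNReal.ofReal_ne_top, ← lintegral_indicator measurableSet_ball]
    refine lintegral_mono fun y => ?_
    by_cases h : dist x y < t
    · have h2 : dist y x < t := by rwa [dist_comm]
      simp [indicator, h, h2, mul_comm]
    · simp [indicator, h]
  · exact AEMeasurable.indicator (AEMeasurable.mul hg.restrict.comp_fst (by fun_prop)) hms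

/-- If the means of `g` over the balls about `x` of radius larger than `a` are bounded, then so
is the integral of `g` against `a ^ δ * dist x y ^ (-n - δ)`. -/
lemma lintegral_compl_ball_le_of_forall {g : E n → ℝ≥0∞} (hg : AEMeasurable g volume) (x : E n)
    {δ a : ℝ} (hδ : 0 < δ) (ha : 0 < a) {m : ℝ≥0∞}
    (hm : ∀ t, a < t → ∫⁻ y in ball x t, g y ≤ m * ENNReal.ofReal (t ^ n)) :
    ∫⁻ y in (ball x a)ᶜ, g y * ENNReal.ofReal (dist x y ^ (-((n : ℝ) + δ))) ≤
      ENNReal.ofReal ((n + δ) / δ * a ^ (-δ)) * m := by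
  refine (lintegral_compl_ball_le hg x (by positivity) ha).trans ?_
  have h1 : ∀ t ∈ Ioi a, ENNReal.ofReal (t ^ (-((n : ℝ) + δ) - 1)) * ∫⁻ y in ball x t, g y ≤
      m * ENNReal.ofReal (t ^ (-δ - 1)) := by
    intro t ht
    have ht0 : 0 < t := ha.trans ht
    refine (mul_le_mul_right (hm t ht) _).trans (le_of_eq ?_)
    rw [mul_left_comm, ← ENNReal.ofReal_mul (by positivity), ← Real.rpow_natCast,
      ← Real.rpow_add ht0]
    congr 3
    ring
  refine (mul_le_mul_right (setLIntegral_mono' measurableSet_Ioi h1) _).trans (le_of_eq ?_)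
  rw [lintegral_const_mul _ (by fun_prop), ENNReal.ofReal_mul (by positivity),
    ← setLIntegral_Ioi_rpow hδ ha, div_eq_mul_inv, ENNReal.ofReal_mul (by positivity),
    ENNReal.ofReal_inv_of_pos hδ]
  have h2 : (ENNReal.ofReal δ)⁻¹ * ENNReal.ofReal δ = 1 :=
    ENNReal.inv_mul_cancel (by simpa using hδ) ENNReal.ofReal_ne_top
  calc _ = ENNReal.ofReal (n + δ) * (1 * ∫⁻ t in Ioi a, ENNReal.ofReal (t ^ (-δ - 1))) * m := by
        rw [one_mul]; ring
    _ = _ := by rw [← h2]; ring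

end Volume

/-! ### Muckenhoupt weights -/

section Weights

variable {n : ℕ} {p : ℝ} {w : E n → ℝ}

/-- The weight as a function with values in `[0, ∞]`. -/
def weightFn (w : E n → ℝ) (y : E n) : ℝ≥0∞ := ENNReal.ofReal (w y)

/-- The dual weight `w ^ (-1/(p-1))` of a weight `w` in `A_p`, `p > 1`. -/
def dualFn (p : ℝ) (w : E n → ℝ) (y : E n) : ℝ≥0∞ := weightFn w y ^ (-1 / (p - 1))

/-- The measure `w dx`. -/
def weightMeasure (w : E n → ℝ) : Measure (E n) := volume.withDensity (weightFn w)

/-- The measure `w ^ (-1/(p-1)) dx`. -/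
def dualMeasure (p : ℝ) (w : E n → ℝ) : Measure (E n) := volume.withDensity (dualFn p w)

instance : SFinite (weightMeasure w) := by unfold weightMeasure; infer_instance

instance : SFinite (dualMeasure p w) := by unfold dualMeasure; infer_instance

lemma wMass_eq (S : Set (E n)) : wMass w S = weightMeasure w S := by
  rw [weightMeasure, withDensity_apply']; rfl

lemma weightMeasure_absolutelyContinuous : weightMeasure w ≪ volume :=
  withDensity_absolutelyContinuous _ _

lemma lintegral_withDensity_mul {u g : E n → ℝ≥0∞} (hu : AEMeasurable u volume)
    (hg : AEMeasurable g volume) : ∫⁻ y, g y ∂(volume.withDensity u) = ∫⁻ y, g y * u y := by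
  rw [lintegral_withDensity_eq_lintegral_mul₀ hu hg]
  simp [mul_comm]

lemma setLIntegral_withDensity_mul {u g : E n → ℝ≥0∞} (hu : AEMeasurable u volume)
    (hg : AEMeasurable g volume) {S : Set (E n)} (hS : MeasurableSet S) :
    ∫⁻ y in S, g y ∂(volume.withDensity u) = ∫⁻ y in S, g y * u y := by
  rw [restrict_withDensity hS, lintegral_withDensity_eq_lintegral_mul₀ hu.restrict hg.restrict]
  simp [mul_comm]

namespace IsMuckenhoupt

variable (hw : IsMuckenhoupt p w)
include hw

lemma aemeasurable_weightFn : AEMeasurable (weightFn w) volume :=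
  hw.locallyIntegrable.aestronglyMeasurable.aemeasurable.ennreal_ofReal

lemma aemeasurable_dualFn : AEMeasurable (dualFn p w) volume :=
  hw.aemeasurable_weightFn.pow_const _

lemma weightFn_ne : ∀ᵐ x, weightFn w x ≠ 0 ∧ weightFn w x ≠ ∞ :=
  hw.pos.mono fun _ hx => ⟨by simpa [weightFn] using hx, ENNReal.ofReal_ne_top⟩

lemma dualFn_ne : ∀ᵐ x, dualFn p w x ≠ 0 ∧ dualFn p w x ≠ ∞ :=
  hw.weightFn_ne.mono fun _ hx => ⟨(ENNReal.rpow_pos (pos_iff_ne_zero.2 hx.1) hx.2).ne',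
    ENNReal.rpow_ne_top_of_ne_zero hx.1 hx.2⟩

lemma lintegral_weightMeasure {g : E n → ℝ≥0∞} (hg : AEMeasurable g volume) :
    ∫⁻ y, g y ∂weightMeasure w = ∫⁻ y, g y * weightFn w y :=
  lintegral_withDensity_mul hw.aemeasurable_weightFn hg

lemma setLIntegral_weightMeasure {g : E n → ℝ≥0∞} (hg : AEMeasurable g volume)
    {S : Set (E n)} (hS : MeasurableSet S) :
    ∫⁻ y in S, g y ∂weightMeasure w = ∫⁻ y in S, g y * weightFn w y :=
  setLIntegral_withDensity_mul hw.aemeasurable_weightFn hg hS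

lemma weightMeasure_ball_lt_top (x : E n) (r : ℝ) : weightMeasure w (ball x r) < ∞ := by
  rw [weightMeasure, withDensity_apply _ measurableSet_ball]
  have h : IntegrableOn w (ball x r) volume :=
    (hw.locallyIntegrable.integrableOn_isCompact (isCompact_closedBall x r)).mono_set
      ball_subset_closedBall
  exact (lintegral_mono fun y => Real.ofReal_le_enorm (w y)).trans_lt h.2

lemma weightMeasure_ball_ne_zero (x : E n) {r : ℝ} (hr : 0 < r) :
    weightMeasure w (ball x r) ≠ 0 := by
  intro h
  have h2 : volume (ball x r) = 0 := by
    rw [weightMeasure, withDensity_apply_eq_zero' hw.aemeasurable_weightFn] at h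
    refine measure_mono_null_ae ?_ h
    filter_upwards [hw.weightFn_ne] with y hy hyb
    exact ⟨hy.1, hyb⟩
  exact (measure_ball_pos volume x hr).ne' h2

/-- Hölder's inequality for a weight and its dual weight. -/
lemma rpow_setLIntegral_le (hp : 1 < p) {g : E n → ℝ≥0∞} (hg : AEMeasurable g volume)
    (S : Set (E n)) : (∫⁻ y in S, g y) ^ p ≤
      (∫⁻ y in S, g y ^ p * weightFn w y) * (∫⁻ y in S, dualFn p w y) ^ (p - 1) := by
  have hp0 : 0 < p := by linarith
  have hp1 : 0 < p - 1 := by linarith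
  have hpq : p.HolderConjugate (p / (p - 1)) := Real.HolderConjugate.conjExponent hp
  have hW := hw.aemeasurable_weightFn
  have h := ENNReal.lintegral_mul_le_Lp_mul_Lq (volume.restrict S) hpq
    (f := fun y => g y * weightFn w y ^ (1 / p)) (g := fun y => weightFn w y ^ (-(1 / p)))
    ((hg.mul (hW.pow_const _)).restrict) ((hW.pow_const _).restrict)
  have h1 : ∫⁻ y in S, ((fun y => g y * weightFn w y ^ (1 / p)) *
      fun y => weightFn w y ^ (-(1 / p))) y = ∫⁻ y in S, g y := by
    refine lintegral_congr_ae (ae_restrict_of_ae ?_)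
    filter_upwards [hw.weightFn_ne] with y hy
    simp only [Pi.mul_apply]
    rw [mul_assoc, ← ENNReal.rpow_add _ _ hy.1 hy.2, add_neg_cancel, ENNReal.rpow_zero, mul_one]
  have h2 : ∀ y, (g y * weightFn w y ^ (1 / p)) ^ p = g y ^ p * weightFn w y := by
    intro y
    rw [ENNReal.mul_rpow_of_nonneg _ _ hp0.le, ← ENNReal.rpow_mul, one_div_mul_cancel hp0.ne',
      ENNReal.rpow_one]
  have h3 : ∀ y, (weightFn w y ^ (-(1 / p))) ^ (p / (p - 1)) = dualFn p w y := by
    intro y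
    rw [← ENNReal.rpow_mul, dualFn]
    congr 1
    field_simp
  rw [h1] at h
  simp only [h2, h3] at h
  refine (ENNReal.rpow_le_rpow h hp0.le).trans (le_of_eq ?_)
  rw [ENNReal.mul_rpow_of_nonneg _ _ hp0.le, ← ENNReal.rpow_mul, ← ENNReal.rpow_mul,
    one_div_mul_cancel hp0.ne', ENNReal.rpow_one]
  congr 2
  field_simp

omit hw in
lemma rpow_sub_one_mul {a : ℝ≥0∞} (ha0 : a ≠ 0) (hat : a ≠ ∞) : a ^ (p - 1) * a = a ^ p := by
  conv_lhs => enter [2]; rw [← ENNReal.rpow_one a]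
  rw [← ENNReal.rpow_add _ _ ha0 hat, sub_add_cancel]

/-- The `A_p` condition in terms of the measures of the weight and its dual. -/
lemma exists_mul_dualMeasure_le (hp : 1 < p) : ∃ C : ℝ≥0, ∀ (x : E n) (r : ℝ), 0 < r →
    weightMeasure w (ball x r) * dualMeasure p w (ball x r) ^ (p - 1) ≤
      C * volume (ball x r) ^ p := by
  obtain ⟨C, hC⟩ := hw.bound
  refine ⟨C, fun x r hr => ?_⟩
  have h := hC x r hr
  have h0 : volume (ball x r) ≠ 0 := (measure_ball_pos _ _ hr).ne'
  have ht : volume (ball x r) ≠ ∞ := measure_ball_lt_top.ne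
  set V := volume (ball x r)
  rw [dualMean, if_neg hp.ne', wMass_eq, ENNReal.mul_rpow_of_nonneg _ _ (by linarith)] at h
  have h1 : ∫⁻ y in ball x r, ENNReal.ofReal (w y) ^ (-1 / (p - 1)) =
      dualMeasure p w (ball x r) := by
    rw [dualMeasure, withDensity_apply _ measurableSet_ball]; rfl
  rw [h1] at h
  have h2 : (V⁻¹) ^ (p - 1) * V ^ (p - 1) = 1 := by
    rw [← ENNReal.mul_rpow_of_ne_top (by simpa using h0) ht, ENNReal.inv_mul_cancel h0 ht,
      ENNReal.one_rpow]
  calc _ = (V⁻¹ * V) * ((V⁻¹) ^ (p - 1) * V ^ (p - 1)) *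
        (weightMeasure w (ball x r) * dualMeasure p w (ball x r) ^ (p - 1)) := by
        rw [h2, ENNReal.inv_mul_cancel h0 ht, one_mul, one_mul]
    _ = (V⁻¹ * weightMeasure w (ball x r) *
        ((V⁻¹) ^ (p - 1) * dualMeasure p w (ball x r) ^ (p - 1))) * (V ^ (p - 1) * V) := by ring
    _ ≤ C * (V ^ (p - 1) * V) := by gcongr
    _ = _ := by rw [rpow_sub_one_mul h0 ht]

/-- The `A_p` condition as an estimate for means: this form makes sense for all `p ≥ 1`. -/
lemma exists_rpow_mean_le (hp : 1 ≤ p) : ∃ C : ℝ≥0, ∀ (x : E n) (r : ℝ), 0 < r →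
    ∀ g : E n → ℝ≥0∞, AEMeasurable g volume →
      weightMeasure w (ball x r) * (∫⁻ y in ball x r, g y) ^ p ≤
        C * volume (ball x r) ^ p * ∫⁻ y in ball x r, g y ^ p * weightFn w y := by
  rcases hp.eq_or_lt with rfl | hp
  · obtain ⟨C, hC⟩ := hw.bound
    refine ⟨C, fun x r hr g hg => ?_⟩
    have h := hC x r hr
    have h0 : volume (ball x r) ≠ 0 := (measure_ball_pos _ _ hr).ne'
    have ht : volume (ball x r) ≠ ∞ := measure_ball_lt_top.ne
    rw [dualMean, if_pos rfl, wMass_eq] at h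
    set V := volume (ball x r)
    set s := essSup (fun y => (ENNReal.ofReal (w y))⁻¹) (volume.restrict (ball x r))
    have h1 : ∫⁻ y in ball x r, g y ≤ s * ∫⁻ y in ball x r, g y * weightFn w y := by
      rw [← lintegral_const_mul'' (f := fun y => g y * weightFn w y) _
        ((hg.mul hw.aemeasurable_weightFn).restrict)]
      refine lintegral_mono_ae ?_
      filter_upwards [ae_restrict_of_ae hw.weightFn_ne,
        ENNReal.ae_le_essSup (μ := volume.restrict (ball x r))
          (fun y => (ENNReal.ofReal (w y))⁻¹)] with y hy hys
      calc g y = (weightFn w y)⁻¹ * (g y * weightFn w y) := by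
            rw [mul_left_comm, ENNReal.inv_mul_cancel hy.1 hy.2, mul_one]
        _ ≤ _ := by gcongr; exact hys
    simp only [ENNReal.rpow_one]
    calc weightMeasure w (ball x r) * ∫⁻ y in ball x r, g y
        ≤ weightMeasure w (ball x r) * (s * ∫⁻ y in ball x r, g y * weightFn w y) := by gcongr
      _ = (V⁻¹ * V) * (weightMeasure w (ball x r) *
            (s * ∫⁻ y in ball x r, g y * weightFn w y)) := by
          rw [ENNReal.inv_mul_cancel h0 ht, one_mul]
      _ = (V⁻¹ * weightMeasure w (ball x r) * s) * V *
            ∫⁻ y in ball x r, g y * weightFn w y := by ring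
      _ ≤ _ := by gcongr
  · obtain ⟨C, hC⟩ := hw.exists_mul_dualMeasure_le hp
    refine ⟨C, fun x r hr g hg => ?_⟩
    have h := hC x r hr
    rw [dualMeasure, withDensity_apply _ measurableSet_ball] at h
    calc _ ≤ weightMeasure w (ball x r) * ((∫⁻ y in ball x r, g y ^ p * weightFn w y) *
          (∫⁻ y in ball x r, dualFn p w y) ^ (p - 1)) := by
          gcongr
          exact hw.rpow_setLIntegral_le hp hg _
      _ = (weightMeasure w (ball x r) * (∫⁻ y in ball x r, dualFn p w y) ^ (p - 1)) *
          ∫⁻ y in ball x r, g y ^ p * weightFn w y := by ring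
      _ ≤ _ := by gcongr

/-- A subset of a ball that has a fixed proportion of its Lebesgue measure also has a fixed
proportion of its weighted measure. -/
lemma exists_weightMeasure_ball_le (hp : 1 ≤ p) : ∃ C : ℝ≥0, ∀ (x : E n) (r : ℝ), 0 < r →
    ∀ S ⊆ ball x r, MeasurableSet S →
      weightMeasure w (ball x r) * volume S ^ p ≤
        C * volume (ball x r) ^ p * weightMeasure w S := by
  obtain ⟨C, hC⟩ := hw.exists_rpow_mean_le hp
  refine ⟨C, fun x r hr S hS hSm => ?_⟩
  have h := hC x r hr (S.indicator 1) (measurable_one.indicator hSm).aemeasurable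
  rw [lintegral_indicator_one hSm, Measure.restrict_apply hSm, inter_eq_left.2 hS] at h
  refine h.trans (mul_le_mul_right ?_ _)
  rw [weightMeasure, withDensity_apply _ hSm, ← lintegral_indicator hSm]
  refine (setLIntegral_le_lintegral _ _).trans (lintegral_mono fun y => ?_)
  by_cases hy : y ∈ S
  · simp [hy]
  · simp [hy, show (0 : ℝ) < p by linarith]

lemma ballDoubling_weightMeasure (hp : 1 ≤ p) : ∃ D : ℝ≥0, BallDoubling (weightMeasure w) D := by
  obtain ⟨C, hC⟩ := hw.exists_weightMeasure_ball_le hp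
  have hp0 : 0 ≤ p := by linarith
  refine ⟨C * ((5 : ℝ≥0) ^ n) ^ p, fun x r hr => ?_⟩
  have h := hC x (5 * r) (by positivity) (ball x r) (ball_subset_ball (by linarith))
    measurableSet_ball
  have h0 : volume (ball x r) ≠ 0 := (measure_ball_pos _ _ hr).ne'
  have ht : volume (ball x r) ≠ ∞ := measure_ball_lt_top.ne
  rw [volume_ball_mul x x (by norm_num) hr, ENNReal.mul_rpow_of_nonneg _ _ hp0] at h
  have h0' : volume (ball x r) ^ p ≠ 0 := (ENNReal.rpow_pos (pos_iff_ne_zero.2 h0) ht).ne'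
  have ht' : volume (ball x r) ^ p ≠ ∞ := ENNReal.rpow_ne_top_of_nonneg hp0 ht
  refine (ENNReal.mul_le_mul_iff_left h0' ht').1 (h.trans (le_of_eq ?_))
  rw [ENNReal.coe_mul, ENNReal.coe_rpow_of_nonneg _ hp0, ENNReal.ofReal_pow (by norm_num)]
  simp only [ENNReal.coe_pow, ENNReal.coe_ofNat, ENNReal.ofReal_ofNat]
  ring

lemma dualMeasure_ball_lt_top (hp : 1 < p) (x : E n) (r : ℝ) :
    dualMeasure p w (ball x r) < ∞ := by
  rcases le_or_gt r 0 with hr | hr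
  · simp [ball_eq_empty.2 hr]
  obtain ⟨C, hC⟩ := hw.exists_mul_dualMeasure_le hp
  have h := hC x r hr
  by_contra hcon
  rw [not_lt_top_iff.1 hcon, ENNReal.top_rpow_of_pos (by linarith),
    ENNReal.mul_top (hw.weightMeasure_ball_ne_zero x hr), top_le_iff] at h
  exact ENNReal.mul_ne_top ENNReal.coe_ne_top
    (ENNReal.rpow_ne_top_of_nonneg (by linarith) measure_ball_lt_top.ne) h

lemma ballDoubling_dualMeasure (hp : 1 < p) :
    ∃ D : ℝ≥0, BallDoubling (dualMeasure p w) D := by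
  obtain ⟨C, hC⟩ := hw.exists_mul_dualMeasure_le hp
  have hp0 : 0 ≤ p := by linarith
  have hp1 : 0 < p - 1 := by linarith
  refine ⟨(C * ((5 : ℝ≥0) ^ n) ^ p) ^ (1 / (p - 1)), fun x r hr => ?_⟩
  have h := hC x (5 * r) (by positivity)
  have hsub : ball x r ⊆ ball x (5 * r) := ball_subset_ball (by linarith)
  have h1 := hw.rpow_setLIntegral_le hp (g := fun _ => 1) aemeasurable_const (ball x r)
  simp only [lintegral_one, ENNReal.one_rpow, one_mul, Measure.restrict_apply_univ] at h1
  have e1 : ∫⁻ y in ball x r, weightFn w y = weightMeasure w (ball x r) := by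
    rw [weightMeasure, withDensity_apply _ measurableSet_ball]
  have e2 : ∫⁻ y in ball x r, dualFn p w y = dualMeasure p w (ball x r) := by
    rw [dualMeasure, withDensity_apply _ measurableSet_ball]
  rw [e1, e2] at h1
  set wB := weightMeasure w (ball x (5 * r))
  have hwB0 : wB ≠ 0 := hw.weightMeasure_ball_ne_zero x (by positivity)
  have hwBt : wB ≠ ∞ := (hw.weightMeasure_ball_lt_top x _).ne
  have h3 : dualMeasure p w (ball x (5 * r)) ^ (p - 1) ≤
      (C * ((5 : ℝ≥0) ^ n) ^ p : ℝ≥0) * dualMeasure p w (ball x r) ^ (p - 1) := by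
    refine (ENNReal.mul_le_mul_iff_right hwB0 hwBt).1 (h.trans ?_)
    rw [volume_ball_mul x x (by norm_num) hr, ENNReal.mul_rpow_of_nonneg _ _ hp0]
    calc _ ≤ C * (ENNReal.ofReal (5 ^ n) ^ p *
          (wB * dualMeasure p w (ball x r) ^ (p - 1))) := by
          gcongr
          exact h1.trans (by gcongr; exact measure_mono hsub)
      _ = _ := by
          rw [ENNReal.coe_mul, ENNReal.coe_rpow_of_nonneg _ hp0, ENNReal.ofReal_pow (by norm_num)]
          simp only [ENNReal.coe_pow, ENNReal.coe_ofNat, ENNReal.ofReal_ofNat]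
          ring
  have h4 := ENNReal.rpow_le_rpow h3 (show 0 ≤ 1 / (p - 1) by positivity)
  rw [ENNReal.mul_rpow_of_nonneg _ _ (by positivity), ← ENNReal.rpow_mul, ← ENNReal.rpow_mul,
    mul_one_div_cancel hp1.ne', ENNReal.rpow_one, ENNReal.rpow_one] at h4
  rwa [ENNReal.coe_rpow_of_nonneg _ (by positivity)]

/-- The maximal function maps `L_1(w)` to weak `L_1(w)` if `w` is in `A_1`. -/
theorem maximalFn_weak_type (h1 : p = 1) : ∃ C : ℝ≥0, ∀ g : E n → ℝ≥0∞,
    AEMeasurable g volume → ∀ t : ℝ≥0∞,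
      t * weightMeasure w {x | t < maximalFn volume g x} ≤ C * ∫⁻ y, g y * weightFn w y := by
  obtain ⟨C, hC⟩ := hw.exists_rpow_mean_le h1.ge
  obtain ⟨D, hD⟩ := hw.ballDoubling_weightMeasure h1.ge
  subst h1
  refine ⟨(C + 1) * D, fun g hg t => ?_⟩
  -- The constant is `C + 1` and not `C` in order to be nonzero.
  have hpt : ∀ x, maximalFn volume g x ≤ (C + 1 : ℝ≥0) * maximalFn (weightMeasure w) g x := by
    intro x
    refine iSup_le fun c => iSup_le fun r => iSup_le fun hx => ?_
    have hr := pos_of_mem_ball hx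
    have h := hC c r hr g hg
    simp only [ENNReal.rpow_one] at h
    rw [← hw.setLIntegral_weightMeasure hg measurableSet_ball] at h
    have h0 : volume (ball c r) ≠ 0 := (measure_ball_pos _ _ hr).ne'
    have ht : volume (ball c r) ≠ ∞ := measure_ball_lt_top.ne
    have hw0 := hw.weightMeasure_ball_ne_zero c hr
    have hwt := (hw.weightMeasure_ball_lt_top c r).ne
    rw [ENNReal.div_le_iff h0 ht]
    refine (ENNReal.mul_le_mul_iff_right hw0 hwt).1 (h.trans ?_)
    calc C * volume (ball c r) * ∫⁻ y in ball c r, g y ∂weightMeasure w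
        ≤ (C + 1 : ℝ≥0) * volume (ball c r) *
          (maximalFn (weightMeasure w) g x * weightMeasure w (ball c r)) := by
          gcongr
          · simp
          · exact setLIntegral_ball_le_maximalFn hx hwt
      _ = _ := by ring
  have hC0 : ((C + 1 : ℝ≥0) : ℝ≥0∞) ≠ 0 := by simp
  have hsub : {x | t < maximalFn volume g x} ⊆
      {x | t / (C + 1 : ℝ≥0) < maximalFn (weightMeasure w) g x} := by
    intro x hx
    rw [mem_ofPred_eq, ENNReal.div_lt_iff (.inl hC0) (.inl ENNReal.coe_ne_top), mul_comm]
    exact lt_of_lt_of_le hx (hpt x)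
  calc _ ≤ t * weightMeasure w {x | t / (C + 1 : ℝ≥0) < maximalFn (weightMeasure w) g x} := by
        gcongr
    _ = (C + 1 : ℝ≥0) * (t / (C + 1 : ℝ≥0) *
          weightMeasure w {x | t / (C + 1 : ℝ≥0) < maximalFn (weightMeasure w) g x}) := by
        rw [← mul_assoc, ENNReal.mul_div_cancel hC0 ENNReal.coe_ne_top]
    _ ≤ (C + 1 : ℝ≥0) * (D * ∫⁻ y, g y ∂weightMeasure w) := by
        gcongr ((C + 1 : ℝ≥0) : ℝ≥0∞) * ?_
        exact mul_measure_lt_maximalFn_le hD g _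
    _ = _ := by
        rw [hw.lintegral_weightMeasure hg, ENNReal.coe_mul]
        ring

/-- Muckenhoupt's theorem: the maximal function is bounded on `L_p(w)` for `w` in `A_p`, `p > 1`.
With `σ = w ^ (-1/(p-1))`, the `A_p` condition bounds `(M g) ^ (p - 1)` by the maximal function,
with respect to `w dx`, of `(M_σ (g / σ)) ^ (p - 1) / w`, where `M_σ` is the maximal function with
respect to `σ dx`; both of these measures are doubling. -/
theorem maximalFn_strong_type (hp : 1 < p) : ∃ C : ℝ≥0, ∀ g : E n → ℝ≥0∞,
    AEMeasurable g volume →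
      ∫⁻ y, maximalFn volume g y ^ p * weightFn w y ≤ C * ∫⁻ y, g y ^ p * weightFn w y := by
  have hp0 : 0 < p := by linarith
  have hp1 : 0 < p - 1 := by linarith
  have hq : 1 < p / (p - 1) := by rw [lt_div_iff₀ hp1]; linarith
  obtain ⟨A, hA⟩ := hw.exists_mul_dualMeasure_le hp
  obtain ⟨D₁, hD₁⟩ := hw.ballDoubling_weightMeasure hp.le
  obtain ⟨D₂, hD₂⟩ := hw.ballDoubling_dualMeasure hp
  obtain ⟨C₁, hC₁⟩ := lintegral_maximalFn_rpow_le hD₁ hq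
  obtain ⟨C₂, hC₂⟩ := lintegral_maximalFn_rpow_le hD₂ hp
  have hW := hw.aemeasurable_weightFn
  have hσ := hw.aemeasurable_dualFn
  refine ⟨A ^ (p / (p - 1)) * C₁ * C₂, fun g hg => ?_⟩
  set h : E n → ℝ≥0∞ := fun y => g y * (dualFn p w y)⁻¹
  have hh : AEMeasurable h volume := hg.mul hσ.inv
  set H := maximalFn (dualMeasure p w) h
  have hH : Measurable H := measurable_maximalFn
  set G : E n → ℝ≥0∞ := fun y => H y ^ (p - 1) * (weightFn w y)⁻¹
  have hG : AEMeasurable G volume := (hH.pow_const _).aemeasurable.mul hW.inv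
  have hpt : ∀ x, maximalFn volume g x ^ (p - 1) ≤ A * maximalFn (weightMeasure w) G x := by
    intro x
    have hinv : (p - 1) * (1 / (p - 1)) = 1 := mul_one_div_cancel hp1.ne'
    suffices hs : maximalFn volume g x ≤
        (A * maximalFn (weightMeasure w) G x) ^ (1 / (p - 1)) by
      refine (ENNReal.rpow_le_rpow hs hp1.le).trans ?_
      rw [← ENNReal.rpow_mul, mul_comm (1 / (p - 1)), hinv, ENNReal.rpow_one]
    refine iSup_le fun c => iSup_le fun r => iSup_le fun hx => ?_
    have hr := pos_of_mem_ball hx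
    set V := volume (ball c r)
    have h0 : V ≠ 0 := (measure_ball_pos _ _ hr).ne'
    have ht : V ≠ ∞ := measure_ball_lt_top.ne
    have hσt := (hw.dualMeasure_ball_lt_top hp c r).ne
    have e1 : ∫⁻ y in ball c r, g y = ∫⁻ y in ball c r, h y ∂dualMeasure p w := by
      rw [dualMeasure, setLIntegral_withDensity_mul hσ hh measurableSet_ball]
      refine lintegral_congr_ae (ae_restrict_of_ae ?_)
      filter_upwards [hw.dualFn_ne] with y hy
      simp only [h]
      rw [mul_assoc, ENNReal.inv_mul_cancel hy.1 hy.2, mul_one]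
    have e2 : ∀ y ∈ ball c r, ∫⁻ z in ball c r, g z ≤ H y * dualMeasure p w (ball c r) :=
      fun y hy => e1 ▸ setLIntegral_ball_le_maximalFn hy hσt
    have e3 : ∫⁻ y in ball c r, H y ^ (p - 1) = ∫⁻ y in ball c r, G y ∂weightMeasure w := by
      rw [hw.setLIntegral_weightMeasure hG measurableSet_ball]
      refine lintegral_congr_ae (ae_restrict_of_ae ?_)
      filter_upwards [hw.weightFn_ne] with y hy
      simp only [G]
      rw [mul_assoc, ENNReal.inv_mul_cancel hy.1 hy.2, mul_one]
    have e4 : (∫⁻ z in ball c r, g z) ^ (p - 1) * V ≤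
        V ^ (p - 1) * (A * maximalFn (weightMeasure w) G x) * V := by
      calc (∫⁻ z in ball c r, g z) ^ (p - 1) * V
          = ∫⁻ _ in ball c r, (∫⁻ z in ball c r, g z) ^ (p - 1) := (setLIntegral_const _ _).symm
        _ ≤ ∫⁻ y in ball c r, dualMeasure p w (ball c r) ^ (p - 1) * H y ^ (p - 1) := by
            refine setLIntegral_mono' measurableSet_ball fun y hy => ?_
            rw [← ENNReal.mul_rpow_of_nonneg _ _ hp1.le, mul_comm]
            exact ENNReal.rpow_le_rpow (e2 y hy) hp1.le
        _ = dualMeasure p w (ball c r) ^ (p - 1) * ∫⁻ y in ball c r, G y ∂weightMeasure w := by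
            rw [lintegral_const_mul _ (hH.pow_const _), e3]
        _ ≤ dualMeasure p w (ball c r) ^ (p - 1) *
              (maximalFn (weightMeasure w) G x * weightMeasure w (ball c r)) := by
            gcongr
            exact setLIntegral_ball_le_maximalFn hx (hw.weightMeasure_ball_lt_top c r).ne
        _ = (weightMeasure w (ball c r) * dualMeasure p w (ball c r) ^ (p - 1)) *
              maximalFn (weightMeasure w) G x := by ring
        _ ≤ A * V ^ p * maximalFn (weightMeasure w) G x := mul_le_mul_left (hA c r hr) _
        _ = _ := by rw [← rpow_sub_one_mul h0 ht]; ring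
    have e5 := (ENNReal.mul_le_mul_iff_left h0 ht).1 e4
    have e6 := ENNReal.rpow_le_rpow e5 (show 0 ≤ 1 / (p - 1) by positivity)
    rw [ENNReal.mul_rpow_of_nonneg _ _ (by positivity), ← ENNReal.rpow_mul, ← ENNReal.rpow_mul,
      hinv, ENNReal.rpow_one, ENNReal.rpow_one, mul_comm] at e6
    rwa [ENNReal.div_le_iff h0 ht]
  have hpq : (p - 1) * (p / (p - 1)) = p := by field_simp
  calc ∫⁻ y, maximalFn volume g y ^ p * weightFn w y
      = ∫⁻ y, (maximalFn volume g y ^ (p - 1)) ^ (p / (p - 1)) ∂weightMeasure w := by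
        rw [hw.lintegral_weightMeasure
          ((measurable_maximalFn.pow_const _).pow_const _).aemeasurable]
        simp_rw [← ENNReal.rpow_mul, hpq]
    _ ≤ ∫⁻ y, A ^ (p / (p - 1)) * maximalFn (weightMeasure w) G y ^ (p / (p - 1))
          ∂weightMeasure w := by
        refine lintegral_mono fun y => ?_
        rw [← ENNReal.mul_rpow_of_nonneg _ _ (by positivity)]
        exact ENNReal.rpow_le_rpow (hpt y) (by positivity)
    _ ≤ A ^ (p / (p - 1)) * (C₁ * ∫⁻ y, G y ^ (p / (p - 1)) ∂weightMeasure w) := by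
        rw [lintegral_const_mul _ (measurable_maximalFn.pow_const _)]
        gcongr
        exact hC₁ G (hG.mono_ac weightMeasure_absolutelyContinuous)
    _ = A ^ (p / (p - 1)) * (C₁ * ∫⁻ y, H y ^ p ∂dualMeasure p w) := by
        congr 2
        rw [hw.lintegral_weightMeasure (hG.pow_const _), dualMeasure,
          lintegral_withDensity_mul hσ (hH.pow_const _).aemeasurable]
        refine lintegral_congr_ae ?_
        filter_upwards [hw.weightFn_ne] with y hy
        simp only [G]
        rw [ENNReal.mul_rpow_of_nonneg _ _ (by positivity), ← ENNReal.rpow_mul, hpq, mul_assoc,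
          ← ENNReal.rpow_neg_one, ← ENNReal.rpow_mul]
        congr 1
        conv_lhs => enter [2]; rw [← ENNReal.rpow_one (weightFn w y)]
        rw [← ENNReal.rpow_add _ _ hy.1 hy.2, dualFn]
        congr 1
        field_simp
        ring
    _ ≤ A ^ (p / (p - 1)) * (C₁ * (C₂ * ∫⁻ y, h y ^ p ∂dualMeasure p w)) := by
        gcongr
        exact hC₂ h (hh.mono_ac (withDensity_absolutelyContinuous _ _))
    _ = _ := by
        rw [dualMeasure, lintegral_withDensity_mul hσ (hh.pow_const _)]
        have e : ∫⁻ y, h y ^ p * dualFn p w y = ∫⁻ y, g y ^ p * weightFn w y := by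
          refine lintegral_congr_ae ?_
          filter_upwards [hw.weightFn_ne, hw.dualFn_ne] with y hy hy'
          simp only [h]
          rw [ENNReal.mul_rpow_of_nonneg _ _ hp0.le, mul_assoc]
          congr 1
          rw [← ENNReal.rpow_neg_one, ← ENNReal.rpow_mul]
          conv_lhs => enter [2]; rw [← ENNReal.rpow_one (dualFn p w y)]
          rw [← ENNReal.rpow_add _ _ hy'.1 hy'.2, dualFn, ← ENNReal.rpow_mul]
          conv_rhs => rw [← ENNReal.rpow_one (weightFn w y)]
          congr 1
          field_simp
          ring
        rw [e]
        push_cast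
        rw [ENNReal.coe_rpow_of_nonneg _ (by positivity)]
        ring

end IsMuckenhoupt

end Weights

/-! ### Standard kernels and their truncated integrals -/

section Kernel

variable {n : ℕ} {K : E n → E n → ℂ} {A : ℝ≥0} {δ : ℝ} {f g : E n → ℂ}

/-- The standard estimates of a Calderón–Zygmund kernel with fixed constants, as inequalities in
`[0, ∞]`. -/
structure StandardKernel (K : E n → E n → ℂ) (A : ℝ≥0) (δ : ℝ) : Prop where
  pos : 0 < δ
  continuousOn : ContinuousOn (fun z : E n × E n => K z.1 z.2) {z | z.1 ≠ z.2}
  size : ∀ x y, x ≠ y → ‖K x y‖ₑ ≤ A * ENNReal.ofReal (dist x y ^ (-(n : ℝ)))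
  regular_left : ∀ x x' y, x ≠ y → dist x x' ≤ dist x y / 2 →
    ‖K x y - K x' y‖ₑ ≤
      A * ENNReal.ofReal (dist x x' ^ δ) * ENNReal.ofReal (dist x y ^ (-((n : ℝ) + δ)))
  regular_right : ∀ x y y', x ≠ y → dist y y' ≤ dist x y / 2 →
    ‖K x y - K x y'‖ₑ ≤
      A * ENNReal.ofReal (dist y y' ^ δ) * ENNReal.ofReal (dist x y ^ (-((n : ℝ) + δ)))

lemma IsCalderonZygmund.exists_standardKernel (hK : IsCalderonZygmund K) :
    ∃ A δ, StandardKernel K A δ := by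
  obtain ⟨A, δ, hδ, -, h1, h2, h3⟩ := hK.standard
  have key : ∀ (z : ℂ) (a d : ℝ), 0 ≤ a → 0 ≤ d → ‖z‖ ≤ A * a * d →
      ‖z‖ₑ ≤ A.toNNReal * ENNReal.ofReal a * ENNReal.ofReal d := by
    intro z a d ha hd h
    rw [← ofReal_norm, show ((A.toNNReal : ℝ≥0) : ℝ≥0∞) = ENNReal.ofReal A from rfl,
      mul_assoc, ← ENNReal.ofReal_mul ha, ← ENNReal.ofReal_mul' (by positivity)]
    exact ENNReal.ofReal_le_ofReal (by linarith)
  refine ⟨A.toNNReal, δ, hδ, hK.continuousOn, fun x y hxy => ?_, fun x x' y hxy hd => ?_,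
    fun x y y' hxy hd => ?_⟩
  · have h := key (K x y) 1 (dist x y ^ (-(n : ℝ))) zero_le_one (by positivity) (by
      rw [mul_one, dist_eq_norm, Real.rpow_neg (norm_nonneg _), Real.rpow_natCast,
        ← div_eq_mul_inv]
      exact h1 x y hxy)
    simpa using h
  · refine key _ _ _ (by positivity) (by positivity) ?_
    rw [dist_eq_norm, dist_eq_norm, Real.rpow_neg (norm_nonneg _), ← div_eq_mul_inv]
    exact h2 x x' y hxy (by simpa [dist_eq_norm] using hd)
  · refine key _ _ _ (by positivity) (by positivity) ?_
    rw [dist_eq_norm, dist_eq_norm, Real.rpow_neg (norm_nonneg _), ← div_eq_mul_inv]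
    exact h3 x y y' hxy (by simpa [dist_eq_norm] using hd)

/-- The integral of `|f|` against `|x - y| ^ (-n)` over the complement of the ball of radius `r`
about `x`. Up to a constant it bounds the truncated singular integrals. -/
def tailIntegral (f : E n → ℂ) (x : E n) (r : ℝ) : ℝ≥0∞ :=
  ∫⁻ y in (ball x r)ᶜ, ‖f y‖ₑ * ENNReal.ofReal (dist x y ^ (-(n : ℝ)))

/-- Measurable functions for which all truncated singular integrals converge absolutely. -/
structure TailIntegrable (f : E n → ℂ) : Prop where
  aestronglyMeasurable : AEStronglyMeasurable f volume
  tail_lt_top : ∀ (x : E n) (r : ℝ), 0 < r → tailIntegral f x r < ∞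

lemma dist_rpow_neg_le {x y : E n} {r : ℝ} (hr : 0 < r) (h : r ≤ dist x y) {s : ℝ} (hs : 0 ≤ s) :
    ENNReal.ofReal (dist x y ^ (-s)) ≤ ENNReal.ofReal (r ^ (-s)) :=
  ENNReal.ofReal_le_ofReal (Real.rpow_le_rpow_of_nonpos hr h (by linarith))

lemma le_dist_of_mem_compl_ball {x y : E n} {r : ℝ} (h : y ∈ (ball x r)ᶜ) : r ≤ dist x y := by
  simpa [dist_comm] using h

lemma tailIntegral_le (f : E n → ℂ) (x : E n) {r : ℝ} (hr : 0 < r) :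
    tailIntegral f x r ≤ ENNReal.ofReal (r ^ (-(n : ℝ))) * ∫⁻ y, ‖f y‖ₑ := by
  rw [← lintegral_const_mul' _ _ ENNReal.ofReal_ne_top]
  refine (setLIntegral_mono' measurableSet_ball.compl fun y hy => ?_).trans
    (setLIntegral_le_lintegral _ _)
  rw [mul_comm]
  exact mul_le_mul_left (dist_rpow_neg_le hr (le_dist_of_mem_compl_ball hy) (Nat.cast_nonneg n)) _

lemma tailIntegrable_of_integrable (hf : Integrable f volume) : TailIntegrable f :=
  ⟨hf.1, fun x _ hr => (tailIntegral_le f x hr).trans_lt (ENNReal.mul_lt_top ENNReal.ofReal_lt_top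
    hf.2)⟩

namespace StandardKernel

variable (hK : StandardKernel K A δ)
include hK

lemma continuousOn_right (x : E n) : ContinuousOn (K x) {y | x ≠ y} :=
  hK.continuousOn.comp (f := fun y => (x, y)) (by fun_prop) fun _ hy => hy

lemma continuousOn_left (y : E n) : ContinuousOn (fun x => K x y) {x | x ≠ y} :=
  hK.continuousOn.comp (f := fun x => (x, y)) (by fun_prop) fun _ hy => hy

lemma aestronglyMeasurable (x : E n) {ε : ℝ} (hε : 0 < ε) :
    AEStronglyMeasurable (K x) (volume.restrict (ball x ε)ᶜ) := by
  refine ((hK.continuousOn_right x).mono fun y hy => ?_).aestronglyMeasurable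
    measurableSet_ball.compl
  rintro rfl
  exact hy (mem_ball_self hε)

lemma enorm_le {x y : E n} {r : ℝ} (hr : 0 < r) (h : r ≤ dist x y) :
    ‖K x y‖ₑ ≤ A * ENNReal.ofReal (r ^ (-(n : ℝ))) :=
  (hK.size x y (dist_pos.1 (hr.trans_le h))).trans
    (mul_le_mul_right (dist_rpow_neg_le hr h (Nat.cast_nonneg n)) _)

lemma integrableOn (hf : TailIntegrable f) (x : E n) {ε : ℝ} (hε : 0 < ε) :
    IntegrableOn (fun y => K x y * f y) (ball x ε)ᶜ volume := by
  refine ⟨(hK.aestronglyMeasurable x hε).mul hf.1.restrict, ?_⟩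
  refine lt_of_le_of_lt ?_ (ENNReal.mul_lt_top (ENNReal.coe_lt_top (r := A)) (hf.2 x ε hε))
  rw [tailIntegral, ← lintegral_const_mul' _ _ ENNReal.coe_ne_top]
  refine setLIntegral_mono' measurableSet_ball.compl fun y hy => ?_
  have hxy : x ≠ y := dist_pos.1 (hε.trans_le (le_dist_of_mem_compl_ball hy))
  rw [enorm_mul, mul_comm ‖f y‖ₑ, ← mul_assoc]
  exact mul_le_mul_left (hK.size x y hxy) _

lemma truncated_sub (hf : TailIntegrable f) (hg : TailIntegrable g) (x : E n) {ε : ℝ}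
    (hε : 0 < ε) : truncated K ε (f - g) x = truncated K ε f x - truncated K ε g x := by
  simp only [truncated, Pi.sub_apply, mul_sub]
  exact integral_sub (hK.integrableOn hf x hε) (hK.integrableOn hg x hε)

/-- For each `ε > 0` the truncated integral is a continuous function of the point, since spheres
are null sets. -/
lemma continuous_truncated (hf : TailIntegrable f) {ε : ℝ} (hε : 0 < ε) :
    Continuous (truncated K ε f) := by
  refine continuous_iff_continuousAt.2 fun x₀ => ?_
  let F : E n → E n → ℂ := fun x y => (ball x ε)ᶜ.indicator (fun y => K x y * f y) y
  have hF : truncated K ε f = fun x => ∫ y, F x y := by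
    funext x
    exact (integral_indicator measurableSet_ball.compl).symm
  rw [hF]
  let b : E n → ℝ := (ball x₀ (ε / 2))ᶜ.indicator
    fun y => A * (3 / 2) ^ (n : ℝ) * (‖f y‖ * dist x₀ y ^ (-(n : ℝ)))
  have hε2 : 0 < ε / 2 := by positivity
  refine continuousAt_of_dominated (bound := b) ?_ ?_ ?_ ?_
  · refine .of_forall fun x => ?_
    exact (aestronglyMeasurable_indicator_iff measurableSet_ball.compl).2
      (hK.integrableOn hf x hε).1
  · filter_upwards [ball_mem_nhds x₀ hε2] with x hx
    refine .of_forall fun y => ?_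
    by_cases hy : y ∈ (ball x ε)ᶜ
    · have h1 := le_dist_of_mem_compl_ball hy
      have h2 : dist x₀ x < ε / 2 := by rw [dist_comm]; exact hx
      have h3 := dist_triangle x x₀ y
      have h4 := dist_triangle x₀ x y
      rw [dist_comm x x₀] at h3
      have hy' : y ∈ (ball x₀ (ε / 2))ᶜ := by
        simp only [mem_compl_iff, mem_ball, not_lt]
        rw [dist_comm]; linarith
      simp only [F, b, indicator_of_mem hy, indicator_of_mem hy', norm_mul]
      have hd : 0 < dist x y := hε.trans_le h1
      have hsz : ‖K x y‖ ≤ A * dist x y ^ (-(n : ℝ)) := by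
        have h := hK.size x y (dist_pos.1 hd)
        rw [← ofReal_norm, ← ENNReal.ofReal_coe_nnreal, ← ENNReal.ofReal_mul (by positivity)] at h
        exact (ENNReal.ofReal_le_ofReal_iff (by positivity)).1 h
      have hcmp : dist x y ^ (-(n : ℝ)) ≤ (3 / 2) ^ (n : ℝ) * dist x₀ y ^ (-(n : ℝ)) := by
        have h5 : (3 / 2 * dist x y) ^ (-(n : ℝ)) ≤ dist x₀ y ^ (-(n : ℝ)) :=
          Real.rpow_le_rpow_of_nonpos (by linarith) (by linarith) (by simp)
        rw [Real.mul_rpow (by norm_num) hd.le] at h5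
        calc dist x y ^ (-(n : ℝ))
            = (3 / 2) ^ (n : ℝ) * ((3 / 2) ^ (-(n : ℝ)) * dist x y ^ (-(n : ℝ))) := by
              rw [← mul_assoc, ← Real.rpow_add (by norm_num)]; simp
          _ ≤ _ := by gcongr
      calc ‖K x y‖ * ‖f y‖ ≤ A * ((3 / 2) ^ (n : ℝ) * dist x₀ y ^ (-(n : ℝ))) * ‖f y‖ := by
            gcongr
            exact hsz.trans (by gcongr)
        _ = _ := by ring
    · simp only [F, indicator_of_notMem hy, norm_zero, b]
      exact indicator_nonneg (fun y _ => by positivity) y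
  · refine (integrable_indicator_iff measurableSet_ball.compl).2 (Integrable.const_mul ?_ _)
    refine ⟨(hf.1.norm.mul ?_).restrict, ?_⟩
    · exact (by fun_prop : Measurable fun y => dist x₀ y ^ (-(n : ℝ))).aestronglyMeasurable
    · refine lt_of_eq_of_lt (lintegral_congr fun y => ?_) (hf.2 x₀ _ hε2)
      rw [enorm_mul, enorm_norm, Real.enorm_of_nonneg (by positivity)]
  · have hs : ∀ᵐ y, y ∉ sphere x₀ ε :=
      measure_eq_zero_iff_ae_notMem.1 (Measure.addHaar_sphere_of_ne_zero volume x₀ hε.ne')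
    filter_upwards [hs] with y hy
    rcases lt_or_gt_of_ne (show dist y x₀ ≠ ε from hy) with h | h
    · have hev : (fun x => F x y) =ᶠ[nhds x₀] fun _ => 0 := by
        have : ∀ᶠ x in nhds x₀, dist y x < ε :=
          (continuous_const.dist continuous_id).continuousAt.eventually_lt continuousAt_const h
        filter_upwards [this] with x hx
        exact indicator_of_notMem (notMem_compl_iff.2 (show y ∈ ball x ε from hx)) _
      exact (continuousAt_const (y := (0 : ℂ))).congr hev.symm
    · have hev : (fun x => F x y) =ᶠ[nhds x₀] fun x => K x y * f y := by
        have : ∀ᶠ x in nhds x₀, ε < dist y x :=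
          continuousAt_const.eventually_lt (continuous_const.dist continuous_id).continuousAt h
        filter_upwards [this] with x hx
        exact indicator_of_mem (show y ∈ (ball x ε)ᶜ by simpa using hx.le) _
      have hne : x₀ ≠ y := by
        rintro rfl
        rw [dist_self] at h
        linarith
      exact (((hK.continuousOn_left y).continuousAt (isOpen_ne.mem_nhds hne)).mul
        continuousAt_const).congr hev.symm

lemma isOpen_lt_maximalTruncated (hf : TailIntegrable f) (t : ℝ≥0∞) :
    IsOpen {x | t < maximalTruncated K f x} := by
  have h : {x | t < maximalTruncated K f x} =
      ⋃ (ε : ℝ) (_ : 0 < ε), {x | t < ‖truncated K ε f x‖ₑ} := by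
    ext x
    simp [maximalTruncated, lt_iSup_iff]
  rw [h]
  exact isOpen_biUnion fun ε hε =>
    isOpen_lt continuous_const (hK.continuous_truncated hf hε).enorm

lemma measurable_maximalTruncated (hf : TailIntegrable f) :
    Measurable (maximalTruncated K f) :=
  measurable_of_Ioi fun t => (hK.isOpen_lt_maximalTruncated hf t).measurableSet

omit hK in
lemma maximalTruncated_le {x : E n} {c : ℝ≥0∞}
    (h : ∀ ε, 0 < ε → ‖truncated K ε f x‖ₑ ≤ c) : maximalTruncated K f x ≤ c :=
  iSup_le fun ε => iSup_le fun hε => h ε hε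

omit hK in
lemma enorm_truncated_le_maximalTruncated (f : E n → ℂ) (x : E n) {ε : ℝ} (hε : 0 < ε) :
    ‖truncated K ε f x‖ₑ ≤ maximalTruncated K f x :=
  le_iSup_of_le ε (le_iSup_of_le hε le_rfl)

/-- Sublinearity of the maximal operator for a decomposition `f = g + (f - g)`. -/
lemma maximalTruncated_le_add (hf : TailIntegrable f) (hg : TailIntegrable g) (x : E n) :
    maximalTruncated K f x ≤ maximalTruncated K g x + maximalTruncated K (f - g) x := by
  refine maximalTruncated_le fun ε hε => ?_
  have h : truncated K ε f x = truncated K ε g x + truncated K ε (f - g) x := by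
    rw [hK.truncated_sub hf hg x hε]; ring
  rw [h]
  exact (enorm_add_le _ _).trans (add_le_add (enorm_truncated_le_maximalTruncated _ _ hε)
    (enorm_truncated_le_maximalTruncated _ _ hε))

/-- Moving the point of a singular integral over the complement of `ball x r` by at most `r / 2`
changes it by at most a constant times a bound for the means of `|f|` over larger balls. -/
lemma lintegral_enorm_kernel_sub_le (hf : AEStronglyMeasurable f volume) {x z : E n} {r : ℝ}
    (hr : 0 < r) (hz : dist x z ≤ r / 2) {m : ℝ≥0∞}
    (hm : ∀ t, r < t → ∫⁻ y in ball x t, ‖f y‖ₑ ≤ m * ENNReal.ofReal (t ^ n)) :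
    ∫⁻ y in (ball x r)ᶜ, ‖(K x y - K z y) * f y‖ₑ ≤ A * ENNReal.ofReal ((n + δ) / δ) * m := by
  have hδ := hK.pos
  have h := lintegral_compl_ball_le_of_forall hf.enorm x hδ hr hm
  calc _ ≤ ∫⁻ y in (ball x r)ᶜ, A * ENNReal.ofReal (r ^ δ) *
        (‖f y‖ₑ * ENNReal.ofReal (dist x y ^ (-((n : ℝ) + δ)))) := by
        refine setLIntegral_mono' measurableSet_ball.compl fun y hy => ?_
        have hy := le_dist_of_mem_compl_ball hy
        rw [enorm_mul, mul_comm ‖f y‖ₑ, ← mul_assoc]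
        gcongr
        refine (hK.regular_left x z y (dist_pos.1 (hr.trans_le hy)) (by linarith)).trans ?_
        gcongr
        linarith
    _ ≤ A * ENNReal.ofReal (r ^ δ) * (ENNReal.ofReal ((n + δ) / δ * r ^ (-δ)) * m) := by
        rw [lintegral_const_mul' _ _ (by finiteness)]
        gcongr
    _ = _ := by
        rw [ENNReal.ofReal_mul (by positivity)]
        have : ENNReal.ofReal (r ^ δ) * ENNReal.ofReal (r ^ (-δ)) = 1 := by
          rw [← ENNReal.ofReal_mul (by positivity), ← Real.rpow_add hr]
          simp
        calc _ = A * ENNReal.ofReal ((n + δ) / δ) *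
              (ENNReal.ofReal (r ^ δ) * ENNReal.ofReal (r ^ (-δ))) * m := by ring
          _ = _ := by rw [this, mul_one]

end StandardKernel

lemma setLIntegral_ball_le_maximalFn_mul_pow {g : E n → ℝ≥0∞} {x z : E n} {t : ℝ}
    (hz : z ∈ ball x t) : ∫⁻ y in ball x t, g y ≤
      maximalFn volume g z * volume (ball (0 : E n) 1) * ENNReal.ofReal (t ^ n) := by
  refine (setLIntegral_ball_le_maximalFn hz measure_ball_lt_top.ne).trans (le_of_eq ?_)
  rw [volume_ball_eq x (pos_of_mem_ball hz)]
  ring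

end Kernel

/-! ### The maximal operator on `L_2` -/

section SquareIntegrable

variable {n : ℕ} {K : E n → E n → ℂ} {A : ℝ≥0} {δ : ℝ} {f : E n → ℂ}

lemma lintegral_enorm_sq_eq (φ : Lp ℂ 2 (volume : Measure (E n))) :
    ∫⁻ y, ‖φ y‖ₑ ^ 2 = ‖φ‖ₑ ^ 2 := by
  have h := eLpNorm_nnreal_pow_eq_lintegral (f := φ) (μ := (volume : Measure (E n)))
    (p := 2) (by norm_num)
  rw [Lp.enorm_def]
  simpa using h.symm

lemma lintegral_enorm_toLp_sq (hf : MemLp f 2 volume) :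
    ‖hf.toLp f‖ₑ ^ 2 = ∫⁻ y, ‖f y‖ₑ ^ 2 := by
  rw [← lintegral_enorm_sq_eq]
  exact lintegral_congr_ae (hf.coeFn_toLp.mono fun y hy => by simp only [hy])

/-- Square integrable functions that vanish on a ball are limits of smooth compactly supported
functions with support away from the closed ball. -/
lemma toLp_mem_closure_span {x : E n} {r : ℝ} (hr : 0 < r) (hf : MemLp f 2 volume)
    (h0 : ∀ y ∈ ball x r, f y = 0) :
    hf.toLp f ∈ (Submodule.span ℂ {φ : Lp ℂ 2 (volume : Measure (E n)) |
      ∃ (g : E n → ℂ) (hg : MemLp g 2 volume), ContDiff ℝ ((⊤ : ℕ∞) : WithTop ℕ∞) g ∧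
        HasCompactSupport g ∧ tsupport g ⊆ (closedBall x r)ᶜ ∧
        φ = hg.toLp g}).topologicalClosure := by
  rw [← Submodule.orthogonal_orthogonal_eq_closure, Submodule.mem_orthogonal]
  intro h hh
  rw [Submodule.mem_orthogonal] at hh
  have hloc : LocallyIntegrable h volume := (Lp.memLp h).locallyIntegrable (by norm_num)
  have hzero : ∀ᵐ y, y ∈ (closedBall x r)ᶜ → h y = 0 := by
    refine isClosed_closedBall.isOpen_compl.ae_eq_zero_of_integral_contDiff_smul_eq_zero
      (hloc.locallyIntegrableOn _) fun g hg hgc hgs => ?_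
    have hgC : ContDiff ℝ ((⊤ : ℕ∞) : WithTop ℕ∞) (fun y => (g y : ℂ)) :=
      Complex.ofRealCLM.contDiff.comp hg
    have hgcC : HasCompactSupport (fun y => (g y : ℂ)) :=
      hgc.comp_left (g := fun t : ℝ => (t : ℂ)) Complex.ofReal_zero
    have hm : MemLp (fun y => (g y : ℂ)) 2 (volume : Measure (E n)) :=
      hgC.continuous.memLp_of_hasCompactSupport hgcC
    have h1 := hh (hm.toLp _) (Submodule.subset_span ⟨_, hm, hgC, hgcC,
      (tsupport_comp_subset (g := fun t : ℝ => (t : ℂ)) Complex.ofReal_zero g).trans hgs, rfl⟩)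
    rw [L2.inner_def] at h1
    rw [← h1]
    refine integral_congr_ae ?_
    filter_upwards [hm.coeFn_toLp] with y hy
    rw [hy]
    simp [mul_comm]
  rw [L2.inner_def]
  refine integral_eq_zero_of_ae ?_
  have hs : ∀ᵐ y, y ∉ sphere x r :=
    measure_eq_zero_iff_ae_notMem.1 (Measure.addHaar_sphere_of_ne_zero volume x hr.ne')
  filter_upwards [hf.coeFn_toLp, hzero, hs] with y hy hz hys
  rw [hy]
  by_cases hyb : y ∈ ball x r
  · simp [h0 y hyb]
  · have : y ∈ (closedBall x r)ᶜ := by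
      rw [← ball_union_sphere]
      exact fun h => h.elim hyb hys
    simp [hz this]

namespace StandardKernel

variable (hK : StandardKernel K A δ)
include hK

/-- Integration against the kernel over the complement of a ball is a continuous functional on
`L_2` if the point is well inside the ball. -/
lemma exists_inner_eq (hn : 0 < n) {x z : E n} {r : ℝ} (hr : 0 < r) (hz : z ∈ ball x (r / 2)) :
    ∃ κ : Lp ℂ 2 (volume : Measure (E n)), ∀ φ : Lp ℂ 2 (volume : Measure (E n)),
      inner ℂ κ φ = ∫ y in (ball x r)ᶜ, K z y * φ y := by
  have hr2 : 0 < r / 2 := by positivity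
  have hn' : (0 : ℝ) < n := by exact_mod_cast hn
  have hsub : (ball x r)ᶜ ⊆ (ball z (r / 2))ᶜ := by
    refine compl_subset_compl.2 (ball_subset_ball' ?_)
    have : dist z x < r / 2 := hz
    linarith
  have hKm : AEStronglyMeasurable (K z) (volume.restrict (ball x r)ᶜ) :=
    (hK.aestronglyMeasurable z hr2).mono_measure (Measure.restrict_mono hsub le_rfl)
  have hm : AEStronglyMeasurable ((ball x r)ᶜ.indicator fun y => (starRingEnd ℂ) (K z y))
      volume :=
    (aestronglyMeasurable_indicator_iff measurableSet_ball.compl).2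
      (Complex.continuous_conj.comp_aestronglyMeasurable hKm)
  have hL : MemLp ((ball x r)ᶜ.indicator fun y => (starRingEnd ℂ) (K z y)) 2 volume := by
    refine ⟨hm, ?_⟩
    rw [eLpNorm_lt_top_iff_lintegral_rpow_enorm_lt_top (by norm_num) (by norm_num)]
    have hb := lintegral_compl_ball_le_of_forall (g := fun _ => 1) aemeasurable_const z hn' hr2
      (m := volume (ball (0 : E n) 1)) (fun t ht => by
        rw [setLIntegral_const, one_mul, volume_ball_eq z (hr2.trans ht), mul_comm])
    calc _ ≤ ∫⁻ y in (ball z (r / 2))ᶜ,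
          (A : ℝ≥0∞) ^ 2 * (1 * ENNReal.ofReal (dist z y ^ (-((n : ℝ) + n)))) := by
          rw [← lintegral_indicator measurableSet_ball.compl]
          refine lintegral_mono fun y => ?_
          by_cases hy : y ∈ (ball x r)ᶜ
          · have hy' := hsub hy
            rw [indicator_of_mem hy, indicator_of_mem hy']
            have hd := hr2.trans_le (le_dist_of_mem_compl_ball hy')
            have h1 := hK.size z y (dist_pos.1 hd)
            simp only [RCLike.enorm_conj, ENNReal.toReal_ofNat, ENNReal.rpow_two]
            calc ‖K z y‖ₑ ^ 2 ≤ (A * ENNReal.ofReal (dist z y ^ (-(n : ℝ)))) ^ 2 := by gcongr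
              _ = _ := by
                rw [mul_pow, one_mul, ← ENNReal.ofReal_pow (by positivity), sq (_ ^ _),
                  ← Real.rpow_add hd]
                congr 3
                ring
          · rw [indicator_of_notMem hy]
            simp
      _ ≤ _ := by
          rw [lintegral_const_mul' _ _ (by finiteness)]
          exact mul_le_mul_right hb _
      _ < ∞ := ENNReal.mul_lt_top (by finiteness)
          (ENNReal.mul_lt_top ENNReal.ofReal_lt_top measure_ball_lt_top)
  refine ⟨hL.toLp _, fun φ => ?_⟩
  rw [L2.inner_def, ← integral_indicator measurableSet_ball.compl]
  refine integral_congr_ae ?_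
  filter_upwards [hL.coeFn_toLp] with y hy
  rw [hy]
  by_cases hyb : y ∈ (ball x r)ᶜ
  · simp only [indicator_of_mem hyb]
    simp [mul_comm]
  · simp only [indicator_of_notMem hyb, inner_zero_left]

/-- The integral representation of a Calderón–Zygmund operator extends from smooth functions to
square integrable functions that vanish on a ball. -/
lemma ae_apply_eq_integral (hn : 0 < n)
    {T : Lp ℂ 2 (volume : Measure (E n)) →L[ℂ] Lp ℂ 2 (volume : Measure (E n))}
    (hT : ∀ (f : E n → ℂ) (hf : MemLp f 2 volume),
      ContDiff ℝ ((⊤ : ℕ∞) : WithTop ℕ∞) f → HasCompactSupport f →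
        ∀ᵐ x, x ∉ tsupport f → T (hf.toLp f) x = ∫ y, K x y * f y)
    {x : E n} {r : ℝ} (hr : 0 < r) (hf : MemLp f 2 volume) (h0 : ∀ y ∈ ball x r, f y = 0) :
    ∀ᵐ z, z ∈ ball x (r / 2) → T (hf.toLp f) z = ∫ y in (ball x r)ᶜ, K z y * f y := by
  have hex : ∀ z : E n, ∃ κ : Lp ℂ 2 (volume : Measure (E n)), z ∈ ball x (r / 2) →
      ∀ φ : Lp ℂ 2 (volume : Measure (E n)), inner ℂ κ φ = ∫ y in (ball x r)ᶜ, K z y * φ y := by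
    intro z
    by_cases hz : z ∈ ball x (r / 2)
    · obtain ⟨κ, hκ⟩ := hK.exists_inner_eq hn hr hz
      exact ⟨κ, fun _ => hκ⟩
    · exact ⟨0, fun h => absurd h hz⟩
  choose κ hκ using hex
  -- The functions for which the representation holds form a closed subspace.
  let P : Submodule ℂ (Lp ℂ 2 (volume : Measure (E n))) :=
    { carrier := {φ | ∀ᵐ z, z ∈ ball x (r / 2) → T φ z = inner ℂ (κ z) φ}
      add_mem' := by
        intro φ ψ hφ hψ
        filter_upwards [hφ, hψ, Lp.coeFn_add (T φ) (T ψ)] with z h1 h2 h3 hz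
        rw [map_add, h3, Pi.add_apply, h1 hz, h2 hz, inner_add_right]
      zero_mem' := by
        filter_upwards [Lp.coeFn_zero ℂ 2 (volume : Measure (E n))] with z h1 _
        rw [map_zero, h1, inner_zero_right, Pi.zero_apply]
      smul_mem' := by
        intro c φ hφ
        filter_upwards [hφ, Lp.coeFn_smul c (T φ)] with z h1 h2 hz
        rw [map_smul, h2, Pi.smul_apply, h1 hz, inner_smul_right, smul_eq_mul] }
  have hPc : IsClosed (P : Set (Lp ℂ 2 (volume : Measure (E n)))) := by
    refine IsSeqClosed.isClosed fun u φ hu hφ => ?_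
    obtain ⟨ns, hns, hlim⟩ := (tendstoInMeasure_of_tendsto_Lp
      ((T.continuous.tendsto φ).comp hφ)).exists_seq_tendsto_ae
    filter_upwards [hlim, ae_all_iff.2 fun i => hu i] with z h1 h2 hz
    refine tendsto_nhds_unique h1 ?_
    have h3 : Filter.Tendsto (fun i => inner ℂ (κ z) (u (ns i))) Filter.atTop
        (nhds (inner ℂ (κ z) φ)) :=
      (tendsto_const_nhds.inner hφ).comp hns.tendsto_atTop
    exact h3.congr fun i => (h2 (ns i) hz).symm
  have hmem : hf.toLp f ∈ P := by
    refine Submodule.topologicalClosure_minimal _ (Submodule.span_le.2 ?_) hPc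
      (toLp_mem_closure_span hr hf h0)
    rintro φ ⟨g, hg, hgd, hgc, hgs, rfl⟩
    filter_upwards [hT g hg hgd hgc] with z hz hzb
    have hz1 : z ∉ tsupport g := fun h => hgs h (ball_subset_closedBall
      (ball_subset_ball (by linarith) hzb))
    rw [hz hz1, hκ z hzb, ← integral_indicator measurableSet_ball.compl]
    refine integral_congr_ae ?_
    filter_upwards [hg.coeFn_toLp] with y hy
    by_cases hyb : y ∈ (ball x r)ᶜ
    · rw [indicator_of_mem hyb, hy]
    · rw [indicator_of_notMem hyb]
      have : g y = 0 := by
        by_contra hne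
        exact hgs (subset_tsupport g hne) (ball_subset_closedBall (notMem_compl_iff.1 hyb))
      rw [this, mul_zero]
  filter_upwards [hmem] with z hz hzb
  rw [hz hzb, hκ z hzb]
  exact integral_congr_ae (ae_restrict_of_ae (hf.coeFn_toLp.mono fun y hy => by simp only [hy]))

omit hK in
lemma add_add_sq_le (a b c : ℝ≥0∞) : (a + b + c) ^ 2 ≤ 9 * (a ^ 2 + b ^ 2 + c ^ 2) := by
  have h : a + b + c ≤ 3 * max a (max b c) := by
    calc a + b + c ≤ max a (max b c) + max a (max b c) + max a (max b c) := by
          gcongr <;> simp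
      _ = _ := by ring
  refine (pow_le_pow_left' h 2).trans ?_
  rw [mul_pow]
  norm_num
  gcongr
  rcases max_choice a (max b c) with h1 | h1
  · rw [h1, add_assoc]; exact le_self_add
  rcases max_choice b c with h2 | h2
  · rw [h1, h2]; exact le_add_right (le_add_left le_rfl)
  · rw [h1, h2]; exact le_add_left le_rfl

omit hK in
lemma maximalFn_sq_le {g : E n → ℝ≥0∞} (hg : AEMeasurable g volume) (x : E n) :
    maximalFn volume g x ^ 2 ≤ maximalFn volume (fun y => g y ^ 2) x := by
  suffices h : maximalFn volume g x ≤ maximalFn volume (fun y => g y ^ 2) x ^ (1 / 2 : ℝ) by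
    refine (pow_le_pow_left' h 2).trans (le_of_eq ?_)
    rw [← ENNReal.rpow_two, ← ENNReal.rpow_mul]
    norm_num
  refine iSup_le fun c => iSup_le fun r => iSup_le fun hx => ?_
  have h0 : volume (ball c r) ≠ 0 := (measure_ball_pos _ _ (pos_of_mem_ball hx)).ne'
  have ht : volume (ball c r) ≠ ∞ := measure_ball_lt_top.ne
  have h := ENNReal.lintegral_mul_le_Lp_mul_Lq (volume.restrict (ball c r))
    Real.HolderConjugate.two_two hg.restrict (g := fun _ => 1) aemeasurable_const
  simp only [Pi.mul_apply, mul_one, setLIntegral_const, one_mul, ENNReal.rpow_two,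
    one_pow] at h
  rw [ENNReal.div_le_iff h0 ht]
  refine h.trans ?_
  calc _ ≤ (maximalFn volume (fun y => g y ^ 2) x * volume (ball c r)) ^ (1 / 2 : ℝ) *
        volume (ball c r) ^ (1 / 2 : ℝ) := by
        gcongr
        exact setLIntegral_ball_le_maximalFn hx ht
    _ = _ := by
        rw [ENNReal.mul_rpow_of_nonneg _ _ (by norm_num), mul_assoc,
          ← ENNReal.rpow_add_of_nonneg _ _ (by norm_num) (by norm_num)]
        norm_num

/-- Cotlar's inequality in a form that needs only the `L_2` theory. For a point `z` near `x` the
truncated integral at `x` differs from `T f z - T (f 1_B) z`, with `B = ball x ε`, by at most a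
constant times the maximal function of `f`; then one takes the mean square over `z`. -/
lemma exists_cotlar (hn : 0 < n)
    {T : Lp ℂ 2 (volume : Measure (E n)) →L[ℂ] Lp ℂ 2 (volume : Measure (E n))}
    (hT : ∀ (f : E n → ℂ) (hf : MemLp f 2 volume),
      ContDiff ℝ ((⊤ : ℕ∞) : WithTop ℕ∞) f → HasCompactSupport f →
        ∀ᵐ x, x ∉ tsupport f → T (hf.toLp f) x = ∫ y, K x y * f y) :
    ∃ C : ℝ≥0, ∀ (f : E n → ℂ) (hf : MemLp f 2 volume), Integrable f volume → ∀ x,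
      maximalTruncated K f x ^ 2 ≤ C * (maximalFn volume (fun y => ‖f y‖ₑ ^ 2) x +
        maximalFn volume (fun y => ‖T (hf.toLp f) y‖ₑ ^ 2) x) := by
  set C₁ : ℝ≥0 := A * ((n + δ) / δ).toNNReal * (volume (ball (0 : E n) 1)).toNNReal
  refine ⟨9 * (C₁ ^ 2 + ‖T‖₊ ^ 2 * 2 ^ n + 1), fun f hf hfi x => ?_⟩
  set M₁ := maximalFn volume (fun y => ‖f y‖ₑ ^ 2) x
  set M₂ := maximalFn volume (fun y => ‖T (hf.toLp f) y‖ₑ ^ 2) x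
  -- The square is moved inside the supremum over `ε` by means of a square root.
  suffices h : ∀ ε : ℝ, 0 < ε → ‖truncated K ε f x‖ₑ ^ 2 ≤
      (9 * (C₁ ^ 2 + ‖T‖₊ ^ 2 * 2 ^ n + 1) : ℝ≥0) * (M₁ + M₂) by
    have h2 : maximalTruncated K f x ≤
        ((9 * (C₁ ^ 2 + ‖T‖₊ ^ 2 * 2 ^ n + 1) : ℝ≥0) * (M₁ + M₂)) ^ (1 / 2 : ℝ) := by
      refine maximalTruncated_le fun ε hε => ?_
      refine le_trans (le_of_eq ?_) (ENNReal.rpow_le_rpow (h ε hε) (by norm_num))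
      rw [← ENNReal.rpow_two, ← ENNReal.rpow_mul]
      norm_num
    refine (pow_le_pow_left' h2 2).trans (le_of_eq ?_)
    rw [← ENNReal.rpow_two, ← ENNReal.rpow_mul]
    norm_num
  intro ε hε
  have hε2 : 0 < ε / 2 := by positivity
  set f₁ := (ball x ε).indicator f
  set f₂ := (ball x ε)ᶜ.indicator f
  have hf₁ : MemLp f₁ 2 volume := hf.indicator measurableSet_ball
  have hf₂ : MemLp f₂ 2 volume := hf.indicator measurableSet_ball.compl
  have hsum : hf.toLp f = hf₁.toLp f₁ + hf₂.toLp f₂ := by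
    rw [← MemLp.toLp_add]
    congr 1
    exact (indicator_self_add_compl (ball x ε) f).symm
  have hrep := hK.ae_apply_eq_integral hn hT hε hf₂
    (fun y hy => indicator_of_notMem (notMem_compl_iff.2 hy) _)
  have hxM : ∀ t, ε < t → ∫⁻ y in ball x t, ‖f y‖ₑ ≤
      (maximalFn volume (fun y => ‖f y‖ₑ) x * volume (ball (0 : E n) 1)) *
        ENNReal.ofReal (t ^ n) :=
    fun t ht => setLIntegral_ball_le_maximalFn_mul_pow (mem_ball_self (hε.trans ht))
  set M₀ := maximalFn volume (fun y => ‖f y‖ₑ) x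
  have hM₀ : M₀ ^ 2 ≤ M₁ := maximalFn_sq_le hfi.1.enorm x
  have hpt : ∀ᵐ z, z ∈ ball x (ε / 2) → ‖truncated K ε f x‖ₑ ^ 2 ≤
      9 * (C₁ ^ 2 * M₁ + ‖T (hf.toLp f) z‖ₑ ^ 2 + ‖T (hf₁.toLp f₁) z‖ₑ ^ 2) := by
    have hadd := Lp.coeFn_add (T (hf₁.toLp f₁)) (T (hf₂.toLp f₂))
    rw [← map_add, ← hsum] at hadd
    filter_upwards [hrep, hadd] with z h1 h2 hz
    have h3 : ∫ y in (ball x ε)ᶜ, K z y * f₂ y = ∫ y in (ball x ε)ᶜ, K z y * f y :=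
      setIntegral_congr_fun measurableSet_ball.compl fun y hy => by
        simp only [f₂, indicator_of_mem hy]
    have hint : IntegrableOn (fun y => K z y * f y) (ball x ε)ᶜ volume := by
      refine (hK.integrableOn (tailIntegrable_of_integrable hfi) z hε2).mono_set
        (compl_subset_compl.2 (ball_subset_ball' ?_))
      have : dist z x < ε / 2 := hz
      linarith
    have h4 : truncated K ε f x - ∫ y in (ball x ε)ᶜ, K z y * f y =
        ∫ y in (ball x ε)ᶜ, (K x y - K z y) * f y := by
      rw [truncated, ← integral_sub
        (hK.integrableOn (tailIntegrable_of_integrable hfi) x hε) hint]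
      simp only [sub_mul]
    have h5 : ‖truncated K ε f x - ∫ y in (ball x ε)ᶜ, K z y * f y‖ₑ ≤ C₁ * M₀ := by
      rw [h4]
      refine (enorm_integral_le_lintegral_enorm _).trans
        ((hK.lintegral_enorm_kernel_sub_le hfi.1 hε ?_ hxM).trans (le_of_eq ?_))
      · rw [dist_comm]; exact (show dist z x < ε / 2 from hz).le
      · simp only [C₁, ENNReal.coe_mul, ENNReal.coe_toNNReal volume_unitBall_ne_top]
        rw [ENNReal.ofReal]
        ring
    have h6 : truncated K ε f x = (truncated K ε f x - ∫ y in (ball x ε)ᶜ, K z y * f y) +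
        T (hf.toLp f) z + -T (hf₁.toLp f₁) z := by
      rw [h2, Pi.add_apply, h1 hz, h3]; ring
    have h7 : ‖truncated K ε f x‖ₑ ≤ C₁ * M₀ + ‖T (hf.toLp f) z‖ₑ + ‖T (hf₁.toLp f₁) z‖ₑ := by
      conv_lhs => rw [h6]
      refine (enorm_add_le _ _).trans ?_
      rw [enorm_neg]
      gcongr
      exact (enorm_add_le _ _).trans (by gcongr)
    refine (pow_le_pow_left' h7 2).trans ((add_add_sq_le _ _ _).trans ?_)
    gcongr
    rw [mul_pow]
    gcongr
  set V := volume (ball x (ε / 2))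
  have hV0 : V ≠ 0 := (measure_ball_pos _ _ hε2).ne'
  have hVt : V ≠ ∞ := measure_ball_lt_top.ne
  have hTf : ∫⁻ z in ball x (ε / 2), ‖T (hf.toLp f) z‖ₑ ^ 2 ≤ M₂ * V :=
    setLIntegral_ball_le_maximalFn (mem_ball_self hε2) hVt
  have hTf₁ : ∫⁻ z in ball x (ε / 2), ‖T (hf₁.toLp f₁) z‖ₑ ^ 2 ≤
      ‖T‖₊ ^ 2 * (M₁ * (2 ^ n * V)) := by
    calc _ ≤ ∫⁻ z, ‖T (hf₁.toLp f₁) z‖ₑ ^ 2 := setLIntegral_le_lintegral _ _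
      _ = ‖T (hf₁.toLp f₁)‖ₑ ^ 2 := lintegral_enorm_sq_eq _
      _ ≤ (‖T‖ₑ * ‖hf₁.toLp f₁‖ₑ) ^ 2 := by
          gcongr
          exact T.le_opENorm _
      _ = ‖T‖ₑ ^ 2 * ∫⁻ y in ball x ε, ‖f y‖ₑ ^ 2 := by
          rw [mul_pow, lintegral_enorm_toLp_sq, ← lintegral_indicator measurableSet_ball]
          congr 1
          refine lintegral_congr fun y => ?_
          by_cases hy : y ∈ ball x ε
          · simp only [f₁, indicator_of_mem hy]
          · simp [f₁, indicator_of_notMem hy]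
      _ ≤ ‖T‖ₑ ^ 2 * (M₁ * volume (ball x ε)) := by
          gcongr
          exact setLIntegral_ball_le_maximalFn (mem_ball_self hε) measure_ball_lt_top.ne
      _ = _ := by
          have : ε = 2 * (ε / 2) := by ring
          rw [this, volume_ball_mul x x two_pos hε2, ENNReal.ofReal_pow (by norm_num)]
          simp [enorm_eq_nnnorm, V]
  refine (ENNReal.mul_le_mul_iff_left hV0 hVt).1 ?_
  calc ‖truncated K ε f x‖ₑ ^ 2 * V
      = ∫⁻ _ in ball x (ε / 2), ‖truncated K ε f x‖ₑ ^ 2 := (setLIntegral_const _ _).symm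
    _ ≤ ∫⁻ z in ball x (ε / 2), 9 * (C₁ ^ 2 * M₁ + ‖T (hf.toLp f) z‖ₑ ^ 2 +
          ‖T (hf₁.toLp f₁) z‖ₑ ^ 2) :=
        lintegral_mono_ae ((ae_restrict_iff' measurableSet_ball).2 hpt)
    _ = 9 * (C₁ ^ 2 * M₁ * V + (∫⁻ z in ball x (ε / 2), ‖T (hf.toLp f) z‖ₑ ^ 2) +
          ∫⁻ z in ball x (ε / 2), ‖T (hf₁.toLp f₁) z‖ₑ ^ 2) := by
        have hm1 : AEMeasurable (fun z => ‖T (hf.toLp f) z‖ₑ ^ 2) (volume : Measure (E n)) :=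
          (Lp.aestronglyMeasurable _).enorm.pow_const 2
        have hm2 : AEMeasurable (fun z => ‖T (hf₁.toLp f₁) z‖ₑ ^ 2)
            (volume : Measure (E n)) := (Lp.aestronglyMeasurable _).enorm.pow_const 2
        rw [lintegral_const_mul' _ _ (by norm_num), lintegral_add_right' _ hm2.restrict,
          lintegral_add_right' _ hm1.restrict, setLIntegral_const]
    _ ≤ 9 * (C₁ ^ 2 * M₁ * V + M₂ * V + ‖T‖₊ ^ 2 * (M₁ * (2 ^ n * V))) := by gcongr
    _ ≤ 9 * (C₁ ^ 2 * M₁ * V + M₂ * V + ‖T‖₊ ^ 2 * (M₁ * (2 ^ n * V))) +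
          9 * ((C₁ ^ 2 + ‖T‖₊ ^ 2 * 2 ^ n) * M₂ * V + M₁ * V) := le_self_add
    _ = _ := by
        push_cast
        ring

omit hK in
/-- A function whose square is dominated by two maximal functions satisfies a weak type estimate. -/
lemma sq_mul_volume_lt_le {F g₁ g₂ : E n → ℝ≥0∞} {C : ℝ≥0}
    (h : ∀ x, F x ^ 2 ≤ C * (maximalFn volume g₁ x + maximalFn volume g₂ x)) (t : ℝ≥0∞) :
    t ^ 2 * volume {x | t < F x} ≤
      (2 * (C + 1) * 5 ^ n : ℝ≥0) * (∫⁻ y, (g₁ y + g₂ y)) := by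
  have hC'0 : ((2 * (C + 1) : ℝ≥0) : ℝ≥0∞) ≠ 0 := by simp
  obtain ⟨s, hs⟩ : ∃ s : ℝ≥0∞, t ^ 2 = (2 * (C + 1) : ℝ≥0) * s :=
    ⟨_, (ENNReal.mul_div_cancel hC'0 ENNReal.coe_ne_top).symm⟩
  have hmax : ∀ x, maximalFn volume g₁ x ≤ maximalFn volume (fun y => g₁ y + g₂ y) x ∧
      maximalFn volume g₂ x ≤ maximalFn volume (fun y => g₁ y + g₂ y) x := fun x =>
    ⟨maximalFn_mono (fun _ => le_self_add) x, maximalFn_mono (fun _ => le_add_self) x⟩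
  have hsub : {x | t < F x} ⊆ {x | s < maximalFn volume (fun y => g₁ y + g₂ y) x} := by
    intro x hx
    by_contra hcon
    have hcon' : maximalFn volume (fun y => g₁ y + g₂ y) x ≤ s := not_lt.1 hcon
    have h1 : t ^ 2 < F x ^ 2 := ENNReal.pow_lt_pow_left two_ne_zero hx
    have h2 : F x ^ 2 ≤ t ^ 2 := by
      calc _ ≤ C * (maximalFn volume g₁ x + maximalFn volume g₂ x) := h x
        _ ≤ (C + 1) * (s + s) := by
            gcongr
            · exact le_self_add
            · exact (hmax x).1.trans hcon'
            · exact (hmax x).2.trans hcon'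
        _ = t ^ 2 := by rw [hs]; push_cast; ring
    exact absurd h1 (not_lt.2 h2)
  have hw := mul_measure_lt_maximalFn_le ballDoubling_volume (fun y => g₁ y + g₂ y) s
  calc _ ≤ t ^ 2 * volume {x | s < maximalFn volume (fun y => g₁ y + g₂ y) x} := by gcongr
    _ = (2 * (C + 1) : ℝ≥0) *
          (s * volume {x | s < maximalFn volume (fun y => g₁ y + g₂ y) x}) := by
        rw [hs, mul_assoc]
    _ ≤ (2 * (C + 1) : ℝ≥0) * ((5 ^ n : ℝ≥0) * ∫⁻ y, (g₁ y + g₂ y)) := by gcongr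
    _ = _ := by rw [← mul_assoc, ← ENNReal.coe_mul]

/-- The maximal truncated operator is of weak type `(2,2)`. -/
theorem exists_weak_type_two (hn : 0 < n)
    {T : Lp ℂ 2 (volume : Measure (E n)) →L[ℂ] Lp ℂ 2 (volume : Measure (E n))}
    (hT : ∀ (f : E n → ℂ) (hf : MemLp f 2 volume),
      ContDiff ℝ ((⊤ : ℕ∞) : WithTop ℕ∞) f → HasCompactSupport f →
        ∀ᵐ x, x ∉ tsupport f → T (hf.toLp f) x = ∫ y, K x y * f y) :
    ∃ C : ℝ≥0, ∀ f : E n → ℂ, MemLp f 2 volume → Integrable f volume → ∀ t : ℝ≥0∞,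
      t ^ 2 * volume {x | t < maximalTruncated K f x} ≤ C * ∫⁻ y, ‖f y‖ₑ ^ 2 := by
  obtain ⟨C, hC⟩ := hK.exists_cotlar hn hT
  refine ⟨2 * (C + 1) * 5 ^ n * (1 + ‖T‖₊ ^ 2), fun f hf hfi t => ?_⟩
  refine (sq_mul_volume_lt_le (hC f hf hfi) t).trans ?_
  have hm : AEMeasurable (fun y => ‖f y‖ₑ ^ 2) (volume : Measure (E n)) :=
    hf.1.enorm.pow_const 2
  rw [lintegral_add_left' hm, lintegral_enorm_sq_eq, ENNReal.coe_mul _ (1 + ‖T‖₊ ^ 2),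
    mul_assoc (_ : ℝ≥0∞)]
  have h1 : ‖T (hf.toLp f)‖ₑ ^ 2 ≤ ‖T‖ₑ ^ 2 * ∫⁻ y, ‖f y‖ₑ ^ 2 := by
    rw [← lintegral_enorm_toLp_sq hf, ← mul_pow]
    exact pow_le_pow_left' (T.le_opENorm _) 2
  refine mul_le_mul_right ((add_le_add_right h1 _).trans (le_of_eq ?_)) _
  rw [ENNReal.coe_add, ENNReal.coe_one, ENNReal.coe_pow, add_mul, one_mul]
  rfl

end StandardKernel

end SquareIntegrable

/-! ### Calderón–Zygmund decomposition -/

section Decomposition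

variable {n : ℕ} {f : E n → ℂ}

/-- A countable family of measurable sets has a disjoint refinement with the same union. -/
lemma exists_disjoint_refinement {α ι : Type*} [MeasurableSpace α] [Countable ι]
    {S : ι → Set α} (hS : ∀ i, MeasurableSet (S i)) :
    ∃ Q : ι → Set α, (∀ i, MeasurableSet (Q i)) ∧ (∀ i, Q i ⊆ S i) ∧
      Pairwise (Function.onFun Disjoint Q) ∧ ⋃ i, Q i = ⋃ i, S i := by
  obtain ⟨e, he⟩ := exists_injective_nat ι
  refine ⟨fun i => S i \ ⋃ (j) (_ : e j < e i), S j, fun i => (hS i).diff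
    (.iUnion fun j => .iUnion fun _ => hS j), fun i => sdiff_subset, ?_, ?_⟩
  · have key : ∀ i j, e i < e j →
        Disjoint (S i \ ⋃ (k) (_ : e k < e i), S k) (S j \ ⋃ (k) (_ : e k < e j), S k) := by
      intro i j hij
      refine disjoint_left.2 fun y hy hy' => hy'.2 ?_
      exact mem_iUnion₂.2 ⟨i, hij, hy.1⟩
    intro i j hij
    rcases lt_or_gt_of_ne (he.ne hij) with h | h
    · exact key i j h
    · exact (key j i h).symm
  · refine subset_antisymm (iUnion_mono fun i => sdiff_subset) fun y hy => ?_
    obtain ⟨i, hi⟩ := mem_iUnion.1 hy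
    obtain ⟨j, hj, hmin⟩ := (measure e).wf.has_min {i | y ∈ S i} ⟨i, hi⟩
    refine mem_iUnion.2 ⟨j, hj, fun hy' => ?_⟩
    obtain ⟨k, hk, hyk⟩ := mem_iUnion₂.1 hy'
    exact hmin k hyk hk

/-- A function is almost everywhere bounded by its maximal function. -/
lemma ae_le_maximalFn {g : E n → ℝ≥0∞} (hg : AEMeasurable g volume) (hfin : ∫⁻ y, g y ≠ ∞) :
    ∀ᵐ x, g x ≤ maximalFn volume g x := by
  filter_upwards [VitaliFamily.ae_tendsto_lintegral_div
    (Besicovitch.vitaliFamily (volume : Measure (E n))) hg hfin] with x hx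
  refine le_of_tendsto (hx.comp (Besicovitch.tendsto_filterAt volume x)) ?_
  filter_upwards [self_mem_nhdsWithin] with r hr
  have hr : 0 < r := hr
  have hae : closedBall x r =ᵐ[volume] ball x r := by
    have hs : ∀ᵐ y, y ∉ sphere x r :=
      measure_eq_zero_iff_ae_notMem.1 (Measure.addHaar_sphere_of_ne_zero volume x hr.ne')
    filter_upwards [hs] with y hy
    rw [← ball_union_sphere]
    exact propext ⟨fun h => h.elim id fun h' => absurd h' hy, Or.inl⟩
  simp only [Function.comp]
  rw [setLIntegral_congr hae, measure_congr hae]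
  exact le_iSup_of_le x (le_iSup_of_le r (le_iSup_of_le (mem_ball_self hr) le_rfl))

lemma exists_forall_infDist_le (hn : 0 < n) {U : Set (E n)} (hfin : volume U ≠ ∞) :
    ∃ R : ℝ, ∀ x ∈ U, infDist x Uᶜ ≤ R := by
  set v := (volume U / volume (ball (0 : E n) 1)).toReal
  refine ⟨max 1 v, fun x _ => ?_⟩
  by_contra! hcon
  obtain ⟨h1, hv⟩ := max_lt_iff.1 hcon
  have hr : 0 < infDist x Uᶜ := one_pos.trans h1
  have hsub : ball x (infDist x Uᶜ) ⊆ U := by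
    intro y hy
    by_contra hyU
    have := infDist_le_dist_of_mem (x := x) (s := Uᶜ) hyU
    rw [mem_ball, dist_comm] at hy
    linarith
  have h2 := measure_mono (μ := volume) hsub
  rw [volume_ball_eq x hr, ← ENNReal.le_div_iff_mul_le (.inl volume_unitBall_ne_zero)
    (.inl volume_unitBall_ne_top)] at h2
  have h3 : infDist x Uᶜ ^ n ≤ v := by
    rwa [← ENNReal.ofReal_le_iff_le_toReal
      (ENNReal.div_ne_top hfin volume_unitBall_ne_zero)]
  have h4 : infDist x Uᶜ ≤ infDist x Uᶜ ^ n := le_self_pow₀ h1.le hn.ne'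
  linarith

lemma volume_univ_eq_top (hn : 0 < n) : volume (univ : Set (E n)) = ∞ := by
  have : Nonempty (Fin n) := ⟨⟨0, hn⟩⟩
  exact measure_univ_of_isAddLeftInvariant volume

/-- A Calderón–Zygmund decomposition of `f` at height `t`, based on balls. The open set
`U = {t < M f}` is a disjoint union of sets `Q i` contained in `ball (c i) (5 * r i)`. The good
part `g` agrees with `f` off `U`; on `U` the mass of `f` on `Q i` is spread evenly over the ball
`ball (c i) (r i)`, and these balls are disjoint. -/
structure IsCZDecomposition {ι : Type} (f : E n → ℂ) (t : ℝ≥0∞) (c : ι → E n) (r : ι → ℝ)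
    (Q : ι → Set (E n)) (a : ι → ℂ) (g : E n → ℂ) : Prop where
  pos : ∀ i, 0 < r i
  disjoint_ball : Pairwise (Function.onFun Disjoint fun i => ball (c i) (r i))
  measurableSet : ∀ i, MeasurableSet (Q i)
  subset_ball : ∀ i, Q i ⊆ ball (c i) (5 * r i)
  disjoint : Pairwise (Function.onFun Disjoint Q)
  iUnion_eq : ⋃ i, Q i = {x | t < maximalFn volume (fun y => ‖f y‖ₑ) x}
  ball_subset : ∀ i, ball (c i) (40 * r i) ⊆ {x | t < maximalFn volume (fun y => ‖f y‖ₑ) x}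
  mul_volume : ∀ i, a i * (volume (ball (c i) (r i))).toReal = ∫ y in Q i, f y
  aestronglyMeasurable : AEStronglyMeasurable g volume
  eq_off : ∀ y, y ∉ {x | t < maximalFn volume (fun y => ‖f y‖ₑ) x} → g y = f y
  eq_on : ∀ i, ∀ y ∈ ball (c i) (r i), g y = a i
  eq_zero : ∀ y ∈ {x | t < maximalFn volume (fun y => ‖f y‖ₑ) x},
    y ∉ ⋃ i, ball (c i) (r i) → g y = 0
  bound : ∀ᵐ y, ‖g y‖ₑ ≤ ENNReal.ofReal (41 ^ n) * t
  lintegral_le : ∫⁻ y, ‖g y‖ₑ ≤ ∫⁻ y, ‖f y‖ₑ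

lemma enorm_mul_volume_le {a : ℂ} {B Q : Set (E n)} (hB : volume B ≠ ∞)
    (ha : a * (volume B).toReal = ∫ y in Q, f y) :
    ‖a‖ₑ * volume B ≤ ∫⁻ y in Q, ‖f y‖ₑ := by
  have h : ‖a‖ₑ * volume B = ‖∫ y in Q, f y‖ₑ := by
    rw [← ha, enorm_mul]
    congr 1
    rw [← ofReal_norm, Complex.norm_real, Real.norm_of_nonneg ENNReal.toReal_nonneg,
      ENNReal.ofReal_toReal hB]
  rw [h]
  exact enorm_integral_le_lintegral_enorm _

theorem exists_isCZDecomposition (hn : 0 < n) (hf : Integrable f volume) {t : ℝ≥0∞}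
    (ht0 : t ≠ 0) : ∃ (ι : Type) (_ : Countable ι) (c : ι → E n) (r : ι → ℝ)
      (Q : ι → Set (E n)) (a : ι → ℂ) (g : E n → ℂ), IsCZDecomposition f t c r Q a g := by
  classical
  set F : E n → ℝ≥0∞ := fun y => ‖f y‖ₑ
  have hF : AEMeasurable F volume := hf.1.enorm
  have hFfin : ∫⁻ y, F y ≠ ∞ := hf.2.ne
  set U := {x | t < maximalFn volume F x}
  have hUo : IsOpen U := isOpen_lt_maximalFn t
  have hUfin : volume U ≠ ∞ := by
    intro h
    have h1 := mul_measure_lt_maximalFn_le ballDoubling_volume F t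
    rw [show {x | t < maximalFn volume F x} = U from rfl, h, ENNReal.mul_top ht0, top_le_iff] at h1
    exact ENNReal.mul_ne_top ENNReal.coe_ne_top hFfin h1
  have hne : Uᶜ.Nonempty := by
    rw [nonempty_compl]
    intro h
    rw [h] at hUfin
    exact hUfin (volume_univ_eq_top hn)
  obtain ⟨R, hR⟩ := exists_forall_infDist_le hn hUfin
  obtain ⟨u, ρ, hu, hρ, h40, hz, hdisj, hcov⟩ := exists_whitney_balls hUo hne hR
  have : Countable u := hu.to_subtype
  let B : u → Set (E n) := fun i => ball (i : E n) (ρ i)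
  have hBm : ∀ i, MeasurableSet (B i) := fun i => measurableSet_ball
  have hBv : ∀ i, volume (B i) ≠ ∞ := fun i => measure_ball_lt_top.ne
  have hBv0 : ∀ i, volume (B i) ≠ 0 := fun i => (measure_ball_pos _ _ (hρ i i.2)).ne'
  obtain ⟨Q, hQm, hQsub, hQd, hQU⟩ :=
    exists_disjoint_refinement (S := fun i : u => ball (i : E n) (5 * ρ i))
      fun _ => measurableSet_ball
  have hBd : Pairwise (Function.onFun Disjoint B) := fun i j hij =>
    hdisj i.2 j.2 (fun h => hij (Subtype.ext h))
  have hBU : ∀ i, B i ⊆ U := fun i => (ball_subset_ball (by have := hρ i i.2; linarith)).trans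
    (h40 i i.2)
  have hQU' : ⋃ i, Q i = U := by
    rw [hQU]
    refine subset_antisymm (iUnion_subset fun i => (ball_subset_ball
      (by have := hρ i i.2; linarith)).trans (h40 i i.2)) (hcov.trans ?_)
    rw [biUnion_eq_iUnion]
  let a : u → ℂ := fun i => (∫ y in Q i, f y) / (volume (B i)).toReal
  have ha : ∀ i, a i * (volume (B i)).toReal = ∫ y in Q i, f y := fun i =>
    div_mul_cancel₀ _ (by exact_mod_cast ENNReal.toReal_ne_zero.2 ⟨hBv0 i, hBv i⟩)
  have ha' : ∀ i, ‖a i‖ₑ * volume (B i) ≤ ∫⁻ y in Q i, F y := fun i =>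
    enorm_mul_volume_le (hBv i) (ha i)
  let g : E n → ℂ := fun y =>
    if y ∈ U then (if h : ∃ i, y ∈ B i then a h.choose else 0) else f y
  have hg_off : ∀ y, y ∉ U → g y = f y := fun y hy => if_neg hy
  have hg_on : ∀ i, ∀ y ∈ B i, g y = a i := by
    intro i y hy
    have hex : ∃ i, y ∈ B i := ⟨i, hy⟩
    simp only [g, if_pos (hBU i hy), dif_pos hex]
    congr 1
    by_contra hne
    exact disjoint_left.1 (hBd hne) hex.choose_spec hy
  have hg_zero : ∀ y ∈ U, y ∉ ⋃ i, B i → g y = 0 := by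
    intro y hy hyB
    have hex : ¬ ∃ i, y ∈ B i := fun ⟨i, hi⟩ => hyB (mem_iUnion.2 ⟨i, hi⟩)
    simp only [g, if_pos hy, dif_neg hex]
  have hUB : U = (⋃ i, B i) ∪ (U \ ⋃ i, B i) := (union_sdiff_cancel (iUnion_subset hBU)).symm
  have hBUm : MeasurableSet (⋃ i, B i) := .iUnion hBm
  have hgm : AEStronglyMeasurable g volume := by
    rw [← Measure.restrict_univ (μ := volume), ← union_compl_self U,
      aestronglyMeasurable_union_iff]
    constructor
    · rw [hUB, aestronglyMeasurable_union_iff, aestronglyMeasurable_iUnion_iff]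
      refine ⟨fun i => ?_, ?_⟩
      · refine (aestronglyMeasurable_const (b := a i)).congr ?_
        filter_upwards [ae_restrict_mem (hBm i)] with y hy using (hg_on i y hy).symm
      · refine (aestronglyMeasurable_const (b := (0 : ℂ))).congr ?_
        filter_upwards [ae_restrict_mem (hUo.measurableSet.diff hBUm)] with y hy
          using (hg_zero y hy.1 hy.2).symm
    · refine hf.1.restrict.congr ?_
      filter_upwards [ae_restrict_mem hUo.measurableSet.compl] with y hy using (hg_off y hy).symm
  refine ⟨u, this, fun i => i, fun i => ρ i, Q, a, g, fun i => hρ i i.2, hBd, hQm, hQsub, hQd, hQU',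
    fun i => h40 i i.2, ha, hgm, hg_off, hg_on, hg_zero, ?_, ?_⟩
  · have h41 : (1 : ℝ≥0∞) ≤ ENNReal.ofReal (41 ^ n) := by
      rw [ENNReal.one_le_ofReal]
      exact one_le_pow₀ (by norm_num)
    filter_upwards [ae_le_maximalFn hF hFfin] with y hy
    by_cases hyU : y ∈ U
    · by_cases hyB : y ∈ ⋃ i, B i
      · obtain ⟨i, hi⟩ := mem_iUnion.1 hyB
        rw [hg_on i y hi]
        refine (ENNReal.mul_le_mul_iff_left (hBv0 i) (hBv i)).1 ((ha' i).trans ?_)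
        have hρi := hρ i i.2
        obtain ⟨z, hzU, hzd⟩ := hz i i.2
        calc ∫⁻ y in Q i, F y ≤ ∫⁻ y in ball (i : E n) (41 * ρ i), F y :=
              lintegral_mono_set ((hQsub i).trans (ball_subset_ball (by linarith)))
          _ ≤ maximalFn volume F z * volume (ball (i : E n) (41 * ρ i)) :=
              setLIntegral_ball_le_maximalFn hzd measure_ball_lt_top.ne
          _ ≤ t * (ENNReal.ofReal (41 ^ n) * volume (B i)) := by
              rw [volume_ball_mul _ (i : E n) (by norm_num) hρi]
              gcongr
              exact not_lt.1 hzU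
          _ = _ := by ring
      · rw [hg_zero y hyU hyB]
        simp
    · rw [hg_off y hyU]
      calc ‖f y‖ₑ ≤ 1 * t := by
            rw [one_mul]
            exact hy.trans (not_lt.1 hyU)
        _ ≤ _ := by gcongr
  · rw [← lintegral_add_compl _ hUo.measurableSet, ← lintegral_add_compl F hUo.measurableSet]
    refine add_le_add ?_ (le_of_eq (setLIntegral_congr_fun hUo.measurableSet.compl
      fun y hy => by simp only [hg_off y hy, F]))
    calc ∫⁻ y in U, ‖g y‖ₑ ≤ ∫⁻ y in ⋃ i, B i, ‖g y‖ₑ := by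
          rw [← lintegral_indicator hUo.measurableSet, ← lintegral_indicator hBUm]
          refine lintegral_mono fun y => ?_
          by_cases hyB : y ∈ ⋃ i, B i
          · rw [indicator_of_mem hyB]
            exact indicator_le_self _ _ y
          · rw [indicator_of_notMem hyB]
            by_cases hyU : y ∈ U
            · rw [indicator_of_mem hyU, hg_zero y hyU hyB, enorm_zero]
            · rw [indicator_of_notMem hyU]
      _ = ∑' i, ∫⁻ y in B i, ‖g y‖ₑ := lintegral_iUnion hBm hBd _
      _ ≤ ∑' i, ∫⁻ y in Q i, F y := by
          refine ENNReal.tsum_le_tsum fun i => le_trans (le_of_eq ?_) (ha' i)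
          rw [setLIntegral_congr_fun (hBm i) (g := fun _ => ‖a i‖ₑ)
            (fun y hy => by simp only [hg_on i y hy]), setLIntegral_const]
      _ = ∫⁻ y in U, F y := by rw [← hQU', lintegral_iUnion hQm hQd]

end Decomposition

/-! ### Weak type `(1,1)` of the maximal truncated operator -/

section WeakTypeOne

variable {n : ℕ} {K : E n → E n → ℂ} {A : ℝ≥0} {δ : ℝ} {f g : E n → ℂ}

/-- Replacing a function on `Q` by a constant on `B` with the same integral changes the integral
against `h` only through the oscillation of `h`. -/
lemma enorm_setIntegral_sub_le {h : E n → ℂ} {Q B : Set (E n)} {a H : ℂ} {m : ℝ≥0∞}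
    (hQ : MeasurableSet Q) (hB : MeasurableSet B) (hBv : volume B ≠ ∞)
    (hf : IntegrableOn f Q volume) (hhf : IntegrableOn (fun y => h y * f y) Q volume)
    (hh : IntegrableOn h B volume) (ha : a * (volume B).toReal = ∫ y in Q, f y)
    (hmQ : ∀ y ∈ Q, ‖h y - H‖ₑ ≤ m) (hmB : ∀ y ∈ B, ‖h y - H‖ₑ ≤ m) :
    ‖(∫ y in Q, h y * f y) - ∫ y in B, h y * a‖ₑ ≤ 2 * m * ∫⁻ y in Q, ‖f y‖ₑ := by
  have hc : IntegrableOn (fun _ : E n => H) B volume := integrableOn_const hBv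
  have h1 : ∫ y in Q, (h y - H) * f y = (∫ y in Q, h y * f y) - H * ∫ y in Q, f y := by
    simp only [sub_mul]
    rw [integral_sub hhf (hf.const_mul H), integral_const_mul]
  have h2 : ∫ y in B, (h y - H) * a = (∫ y in B, h y * a) - H * ∫ y in Q, f y := by
    rw [integral_mul_const, integral_sub hh hc, integral_mul_const, setIntegral_const, ← ha,
      Measure.real, Complex.real_smul]
    ring
  have h3 : (∫ y in Q, h y * f y) - ∫ y in B, h y * a =
      (∫ y in Q, (h y - H) * f y) - ∫ y in B, (h y - H) * a := by rw [h1, h2]; ring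
  have h4 : ‖∫ y in Q, (h y - H) * f y‖ₑ ≤ m * ∫⁻ y in Q, ‖f y‖ₑ := by
    refine (enorm_integral_le_lintegral_enorm _).trans ?_
    rw [← lintegral_const_mul'' _ hf.1.enorm]
    refine setLIntegral_mono' hQ fun y hy => ?_
    rw [enorm_mul]
    exact mul_le_mul_left (hmQ y hy) _
  have h5 : ‖∫ y in B, (h y - H) * a‖ₑ ≤ m * ∫⁻ y in Q, ‖f y‖ₑ := by
    refine (enorm_integral_le_lintegral_enorm _).trans ?_
    calc ∫⁻ y in B, ‖(h y - H) * a‖ₑ ≤ ∫⁻ _ in B, m * ‖a‖ₑ := by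
          refine setLIntegral_mono' hB fun y hy => ?_
          rw [enorm_mul]
          exact mul_le_mul_left (hmB y hy) _
      _ = m * (‖a‖ₑ * volume B) := by rw [setLIntegral_const, mul_assoc]
      _ ≤ _ := by gcongr; exact enorm_mul_volume_le hBv ha
  rw [h3, sub_eq_add_neg]
  refine (enorm_add_le _ _).trans ?_
  rw [enorm_neg, mul_assoc, two_mul]
  exact add_le_add h4 h5

namespace StandardKernel

variable (hK : StandardKernel K A δ)
include hK

/-- The contribution of one set of a Calderón–Zygmund decomposition to a truncated integral. If
the set does not meet the truncation ball then the regularity of the kernel is used, and otherwise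
the set is contained in a ball comparable to the truncation ball. -/
lemma enorm_bad_piece_le (hf : Integrable f volume) {x c : E n} {r ε : ℝ} (hε : 0 < ε)
    (hr : 0 < r) (hx : x ∉ ball c (40 * r)) {Q : Set (E n)} (hQ : MeasurableSet Q)
    (hQb : Q ⊆ ball c (5 * r)) {a : ℂ}
    (ha : a * (volume (ball c r)).toReal = ∫ y in Q, f y) :
    ‖(∫ y in Q, (ball x ε)ᶜ.indicator (K x) y * f y) -
        ∫ y in ball c r, (ball x ε)ᶜ.indicator (K x) y * a‖ₑ ≤
      2 * (A * ENNReal.ofReal ((5 * r) ^ δ) *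
        ENNReal.ofReal (dist c x ^ (-((n : ℝ) + δ)))) * (∫⁻ y in Q, ‖f y‖ₑ) +
      2 * (A * ENNReal.ofReal (ε ^ (-(n : ℝ)))) * ∫⁻ y in Q ∩ ball x (3 * ε), ‖f y‖ₑ := by
  set h := (ball x ε)ᶜ.indicator (K x)
  have hδ := hK.pos
  have hd : 40 * r ≤ dist c x := by
    rw [dist_comm]; simpa using hx
  have hhm : AEStronglyMeasurable h volume :=
    (aestronglyMeasurable_indicator_iff measurableSet_ball.compl).2 (hK.aestronglyMeasurable x hε)
  have hhb : ∀ y, ‖h y‖ₑ ≤ A * ENNReal.ofReal (ε ^ (-(n : ℝ))) := by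
    intro y
    by_cases hy : y ∈ (ball x ε)ᶜ
    · simp only [h, indicator_of_mem hy]
      exact hK.enorm_le hε (le_dist_of_mem_compl_ball hy)
    · simp only [h, indicator_of_notMem hy, enorm_zero]
      exact zero_le
  have hhb' : ∀ y, ‖h y‖ ≤ (A * ENNReal.ofReal (ε ^ (-(n : ℝ)))).toReal := by
    intro y
    rw [← toReal_enorm]
    exact ENNReal.toReal_mono (by finiteness) (hhb y)
  have hhf : Integrable (fun y => h y * f y) volume := hf.bdd_mul hhm (.of_forall hhb')
  have hhB : IntegrableOn h (ball c r) volume :=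
    Measure.integrableOn_of_bounded measure_ball_lt_top.ne hhm (.of_forall hhb')
  have hsub : ball c r ⊆ ball c (5 * r) := ball_subset_ball (by linarith)
  by_cases hmeet : ball c (5 * r) ⊆ (ball x ε)ᶜ
  · refine le_trans ?_ le_self_add
    have hosc : ∀ y ∈ ball c (5 * r), ‖h y - K x c‖ₑ ≤ A * ENNReal.ofReal ((5 * r) ^ δ) *
        ENNReal.ofReal (dist c x ^ (-((n : ℝ) + δ))) := by
      intro y hy
      have hy' : dist c y < 5 * r := by rw [dist_comm]; exact hy
      simp only [h, indicator_of_mem (hmeet hy)]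
      rw [enorm_sub_rev]
      refine (hK.regular_right x c y ?_ ?_).trans ?_
      · rintro rfl
        rw [dist_self] at hd
        linarith
      · rw [dist_comm x c]; linarith
      · rw [dist_comm x c]
        gcongr
    exact enorm_setIntegral_sub_le hQ measurableSet_ball measure_ball_lt_top.ne hf.integrableOn
      hhf.integrableOn hhB ha (fun y hy => hosc y (hQb hy)) (fun y hy => hosc y (hsub hy))
  · refine le_trans ?_ le_add_self
    have hQ3 : Q ⊆ ball x (3 * ε) := by
      obtain ⟨z, hz, hzx⟩ := not_subset.1 hmeet
      have hzx : dist z x < ε := notMem_compl_iff.1 hzx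
      have hz : dist z c < 5 * r := hz
      intro y hy
      have hy : dist y c < 5 * r := hQb hy
      have h1 := dist_triangle c z x
      have h2 := dist_triangle y c x
      rw [dist_comm c z] at h1
      rw [mem_ball]
      linarith
    rw [inter_eq_left.2 hQ3]
    exact enorm_setIntegral_sub_le (H := 0) hQ measurableSet_ball measure_ball_lt_top.ne
      hf.integrableOn hhf.integrableOn hhB ha (fun y _ => by rw [sub_zero]; exact hhb y)
      (fun y _ => by rw [sub_zero]; exact hhb y)

/-- The bound for the bad part of a Calderón–Zygmund decomposition, off the exceptional set. -/
lemma maximalTruncated_le_of_isCZDecomposition (hf : Integrable f volume)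
    {ι : Type} [Countable ι] {t : ℝ≥0∞} {c : ι → E n} {r : ι → ℝ} {Q : ι → Set (E n)}
    {a : ι → ℂ} (h : IsCZDecomposition f t c r Q a g) {x : E n}
    (hx : x ∉ {x | t < maximalFn volume (fun y => ‖f y‖ₑ) x}) :
    maximalTruncated K f x ≤ maximalTruncated K g x +
      (∑' i, 2 * (A * ENNReal.ofReal ((5 * r i) ^ δ) *
        ENNReal.ofReal (dist (c i) x ^ (-((n : ℝ) + δ)))) * (∫⁻ y in Q i, ‖f y‖ₑ) +
      2 * A * (ENNReal.ofReal (3 ^ n) * volume (ball (0 : E n) 1)) * t) := by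
  set U := {x | t < maximalFn volume (fun y => ‖f y‖ₑ) x}
  have hUm : MeasurableSet U := (isOpen_lt_maximalFn t).measurableSet
  have hg : Integrable g volume :=
    ⟨h.aestronglyMeasurable, h.lintegral_le.trans_lt hf.2⟩
  refine maximalTruncated_le fun ε hε => ?_
  set k := (ball x ε)ᶜ.indicator (K x)
  have hk : ∀ φ : E n → ℂ, (fun y => k y * φ y) =
      (ball x ε)ᶜ.indicator fun y => K x y * φ y := by
    intro φ
    funext y
    simp only [k, indicator]
    split_ifs <;> simp
  have hkint : ∀ φ : E n → ℂ, Integrable φ volume → Integrable (fun y => k y * φ y) volume := by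
    intro φ hφ
    rw [hk, integrable_indicator_iff measurableSet_ball.compl]
    exact hK.integrableOn (tailIntegrable_of_integrable hφ) x hε
  have htr : ∀ φ : E n → ℂ, truncated K ε φ x = ∫ y, k y * φ y := by
    intro φ
    rw [hk, integral_indicator measurableSet_ball.compl, truncated]
  let B : ι → Set (E n) := fun i => ball (c i) (r i)
  have hBm : ∀ i, MeasurableSet (B i) := fun i => measurableSet_ball
  have hBU : ⋃ i, B i ⊆ U := iUnion_subset fun i =>
    (ball_subset_ball (by have := h.pos i; linarith)).trans (h.ball_subset i)
  have hdiff : truncated K ε f x = truncated K ε g x +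
      ∑' i, ((∫ y in Q i, k y * f y) - ∫ y in B i, k y * a i) := by
    have e1 := hasSum_integral_iUnion h.measurableSet h.disjoint (hkint f hf).integrableOn
    have e2 := hasSum_integral_iUnion hBm h.disjoint_ball (hkint g hg).integrableOn
    have e3 : ∀ i, ∫ y in B i, k y * g y = ∫ y in B i, k y * a i := fun i =>
      setIntegral_congr_fun (hBm i) fun y hy => by simp only [h.eq_on i y hy]
    simp only [e3] at e2
    rw [(e1.sub e2).tsum_eq, h.iUnion_eq, htr f, htr g, ← integral_add_compl hUm (hkint f hf),
      ← integral_add_compl hUm (hkint g hg)]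
    have e4 : ∫ y in U, k y * g y = ∫ y in ⋃ i, B i, k y * g y := by
      refine (setIntegral_eq_of_subset_of_forall_sdiff_eq_zero hUm hBU fun y hy => ?_)
      rw [h.eq_zero y hy.1 hy.2, mul_zero]
    have e5 : ∫ y in Uᶜ, k y * g y = ∫ y in Uᶜ, k y * f y :=
      setIntegral_congr_fun hUm.compl fun y hy => by simp only [h.eq_off y hy]
    rw [e4, e5]
    ring
  rw [hdiff]
  refine (enorm_add_le _ _).trans (add_le_add (enorm_truncated_le_maximalTruncated g x hε) ?_)
  refine enorm_tsum_le_tsum_enorm.trans ?_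
  refine (ENNReal.tsum_le_tsum fun i => hK.enorm_bad_piece_le hf hε (h.pos i)
    (fun hxi => hx (h.ball_subset i hxi)) (h.measurableSet i) (h.subset_ball i)
    (h.mul_volume i)).trans ?_
  rw [ENNReal.tsum_add]
  gcongr ?_ + ?_
  · exact le_rfl
  rw [ENNReal.tsum_mul_left]
  have hsum : ∑' i, ∫⁻ y in Q i ∩ ball x (3 * ε), ‖f y‖ₑ ≤
      t * (ENNReal.ofReal ((3 * ε) ^ n) * volume (ball (0 : E n) 1)) := by
    rw [← lintegral_iUnion (fun i => (h.measurableSet i).inter measurableSet_ball)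
      (fun i j hij => (h.disjoint hij).mono inter_subset_left inter_subset_left)]
    calc _ ≤ ∫⁻ y in ball x (3 * ε), ‖f y‖ₑ :=
          lintegral_mono_set (iUnion_subset fun i => inter_subset_right)
      _ ≤ maximalFn volume (fun y => ‖f y‖ₑ) x * volume (ball x (3 * ε)) :=
          setLIntegral_ball_le_maximalFn (mem_ball_self (by positivity)) measure_ball_lt_top.ne
      _ ≤ _ := by
          rw [volume_ball_eq x (by positivity)]
          gcongr
          exact not_lt.1 hx
  refine (mul_le_mul_right hsum _).trans (le_of_eq ?_)
  rw [mul_pow, ENNReal.ofReal_mul (by positivity)]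
  have : ENNReal.ofReal (ε ^ (-(n : ℝ))) * ENNReal.ofReal (ε ^ n) = 1 := by
    rw [← ENNReal.ofReal_mul (by positivity), ← Real.rpow_natCast, ← Real.rpow_add hε]
    simp
  calc _ = 2 * A * (ENNReal.ofReal (3 ^ n) * volume (ball (0 : E n) 1)) * t *
        (ENNReal.ofReal (ε ^ (-(n : ℝ))) * ENNReal.ofReal (ε ^ n)) := by ring
    _ = _ := by rw [this, mul_one]

omit hK in
lemma lintegral_tsum_le_of_isCZDecomposition (hδ : 0 < δ)
    {ι : Type} [Countable ι] {t : ℝ≥0∞} {c : ι → E n} {r : ι → ℝ} {Q : ι → Set (E n)}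
    {a : ι → ℂ} (h : IsCZDecomposition f t c r Q a g) :
    ∫⁻ x in {x | t < maximalFn volume (fun y => ‖f y‖ₑ) x}ᶜ,
      ∑' i, 2 * (A * ENNReal.ofReal ((5 * r i) ^ δ) *
        ENNReal.ofReal (dist (c i) x ^ (-((n : ℝ) + δ)))) * (∫⁻ y in Q i, ‖f y‖ₑ) ≤
      2 * (A * ENNReal.ofReal ((n + δ) / δ) * volume (ball (0 : E n) 1)) * ∫⁻ y, ‖f y‖ₑ := by
  rw [lintegral_tsum (fun i => by fun_prop)]
  calc _ ≤ ∑' i, 2 * (A * ENNReal.ofReal ((n + δ) / δ) * volume (ball (0 : E n) 1)) *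
        ∫⁻ y in Q i, ‖f y‖ₑ := by
        refine ENNReal.tsum_le_tsum fun i => ?_
        have hr := h.pos i
        have hb := lintegral_compl_ball_le_of_forall (g := fun _ => 1) aemeasurable_const (c i) hδ
          (a := 40 * r i) (by positivity) (m := volume (ball (0 : E n) 1)) (fun t ht => by
            rw [setLIntegral_const, one_mul,
              volume_ball_eq (c i) (lt_trans (by positivity) ht), mul_comm])
        have h40 : ENNReal.ofReal ((5 * r i) ^ δ) * ENNReal.ofReal ((40 * r i) ^ (-δ)) ≤ 1 := by
          rw [← ENNReal.ofReal_mul (by positivity), ENNReal.ofReal_le_one]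
          calc (5 * r i) ^ δ * (40 * r i) ^ (-δ) ≤ (40 * r i) ^ δ * (40 * r i) ^ (-δ) := by
                gcongr
                linarith
            _ = 1 := by rw [← Real.rpow_add (by positivity)]; simp
        rw [lintegral_mul_const _ (by fun_prop), lintegral_const_mul _ (by fun_prop),
          lintegral_const_mul _ (by fun_prop)]
        refine mul_le_mul_left (mul_le_mul_right ?_ 2) _
        calc _ ≤ A * ENNReal.ofReal ((5 * r i) ^ δ) *
              ∫⁻ y in (ball (c i) (40 * r i))ᶜ, 1 *
                ENNReal.ofReal (dist (c i) y ^ (-((n : ℝ) + δ))) := by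
              simp only [one_mul]
              gcongr
              exact h.ball_subset i
          _ ≤ A * ENNReal.ofReal ((5 * r i) ^ δ) *
              (ENNReal.ofReal ((n + δ) / δ * (40 * r i) ^ (-δ)) * volume (ball (0 : E n) 1)) := by
              gcongr
          _ = A * ENNReal.ofReal ((n + δ) / δ) * volume (ball (0 : E n) 1) *
              (ENNReal.ofReal ((5 * r i) ^ δ) * ENNReal.ofReal ((40 * r i) ^ (-δ))) := by
              rw [ENNReal.ofReal_mul (by positivity)]
              ring
          _ ≤ A * ENNReal.ofReal ((n + δ) / δ) * volume (ball (0 : E n) 1) * 1 := by gcongr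
          _ = _ := mul_one _
    _ ≤ _ := by
        rw [ENNReal.tsum_mul_left, ← lintegral_iUnion h.measurableSet h.disjoint]
        gcongr
        exact Measure.restrict_le_self

/-- The maximal truncated operator is of weak type `(1,1)`. -/
theorem exists_weak_type_one (hn : 0 < n)
    (h22 : ∃ C : ℝ≥0, ∀ f : E n → ℂ, MemLp f 2 volume → Integrable f volume → ∀ t : ℝ≥0∞,
      t ^ 2 * volume {x | t < maximalTruncated K f x} ≤ C * ∫⁻ y, ‖f y‖ₑ ^ 2) :
    ∃ C : ℝ≥0, ∀ f : E n → ℂ, Integrable f volume → ∀ t : ℝ≥0∞,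
      t * volume {x | t < maximalTruncated K f x} ≤ C * ∫⁻ y, ‖f y‖ₑ := by
  obtain ⟨C, hC⟩ := h22
  set v : ℝ≥0 := (volume (ball (0 : E n) 1)).toNNReal
  have hv : (v : ℝ≥0∞) = volume (ball (0 : E n) 1) := ENNReal.coe_toNNReal volume_unitBall_ne_top
  -- `C₁` bounds the boundary terms, `C₂` the integral of the bad part.
  set C₁ : ℝ≥0 := 2 * A * (3 ^ n * v) + 2
  set C₂ : ℝ≥0 := 2 * (A * ((n + δ) / δ).toNNReal * v)
  refine ⟨C₁ * (5 ^ n + C * 41 ^ n + C₂), fun f hf s => ?_⟩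
  have hC₁0 : (C₁ : ℝ≥0∞) ≠ 0 := by simp [C₁]
  rcases eq_or_ne s 0 with rfl | hs0
  · simp
  rcases eq_or_ne s ∞ with rfl | hst
  · simp
  set t := s / C₁
  have hst' : s = C₁ * t := (ENNReal.mul_div_cancel hC₁0 ENNReal.coe_ne_top).symm
  have ht0 : t ≠ 0 := by
    intro h; rw [h, mul_zero] at hst'; exact hs0 hst'
  have htt : t ≠ ∞ := ENNReal.div_ne_top hst hC₁0
  obtain ⟨ι, _, c, r, Q, a, g, h⟩ := exists_isCZDecomposition hn hf ht0
  set U := {x | t < maximalFn volume (fun y => ‖f y‖ₑ) x}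
  have hUm : MeasurableSet U := (isOpen_lt_maximalFn t).measurableSet
  have hg : Integrable g volume := ⟨h.aestronglyMeasurable, h.lintegral_le.trans_lt hf.2⟩
  set Φ : E n → ℝ≥0∞ := fun x => ∑' i, 2 * (A * ENNReal.ofReal ((5 * r i) ^ δ) *
        ENNReal.ofReal (dist (c i) x ^ (-((n : ℝ) + δ)))) * (∫⁻ y in Q i, ‖f y‖ₑ)
  have hΦm : Measurable Φ := Measurable.tsum fun i => by fun_prop
  have hΦ : ∫⁻ x in Uᶜ, Φ x ≤ C₂ * ∫⁻ y, ‖f y‖ₑ := by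
    refine (lintegral_tsum_le_of_isCZDecomposition (A := A) hK.pos h).trans (le_of_eq ?_)
    simp only [C₂]
    push_cast
    rw [hv]
    rfl
  have hg2 : ∫⁻ y, ‖g y‖ₑ ^ 2 ≤ (41 ^ n : ℝ≥0) * t * ∫⁻ y, ‖f y‖ₑ := by
    calc ∫⁻ y, ‖g y‖ₑ ^ 2 ≤ ∫⁻ y, ENNReal.ofReal (41 ^ n) * t * ‖g y‖ₑ := by
          refine lintegral_mono_ae (h.bound.mono fun y hy => ?_)
          rw [sq]
          gcongr
      _ ≤ ENNReal.ofReal (41 ^ n) * t * ∫⁻ y, ‖f y‖ₑ := by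
          rw [lintegral_const_mul'' _ hg.1.enorm]
          exact mul_le_mul_right h.lintegral_le _
      _ = _ := by
          rw [ENNReal.ofReal_pow (by norm_num)]
          simp
  have hgL : MemLp g 2 volume := by
    refine ⟨hg.1, ?_⟩
    rw [eLpNorm_lt_top_iff_lintegral_rpow_enorm_lt_top (by norm_num) (by norm_num)]
    simp only [ENNReal.toReal_ofNat, ENNReal.rpow_two]
    refine hg2.trans_lt (ENNReal.mul_lt_top (by finiteness) hf.2)
  have hsub : {x | s < maximalTruncated K f x} ⊆
      U ∪ {x | t < maximalTruncated K g x} ∪ ({x | t < Φ x} ∩ Uᶜ) := by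
    intro x hx
    by_contra hcon
    simp only [mem_union, not_or, mem_inter_iff, not_and, mem_compl_iff, not_not] at hcon
    obtain ⟨⟨h1, h2⟩, h3⟩ := hcon
    have h2 : maximalTruncated K g x ≤ t := not_lt.1 h2
    have h3 : Φ x ≤ t := not_lt.1 fun hlt => h1 (h3 hlt)
    have h4 := hK.maximalTruncated_le_of_isCZDecomposition hf h h1
    have h5 : maximalTruncated K f x ≤ s := by
      refine h4.trans ((add_le_add h2 (add_le_add_left h3 _)).trans (le_of_eq ?_))
      rw [hst', ENNReal.ofReal_pow (by norm_num), ← hv]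
      simp only [C₁]
      push_cast
      simp only [ENNReal.ofReal_ofNat]
      ring
    exact absurd hx (not_lt.2 h5)
  have e1 : t * volume U ≤ (5 ^ n : ℝ≥0) * ∫⁻ y, ‖f y‖ₑ :=
    mul_measure_lt_maximalFn_le ballDoubling_volume _ t
  have e2 : t * volume {x | t < maximalTruncated K g x} ≤ C * ((41 ^ n : ℝ≥0) * ∫⁻ y, ‖f y‖ₑ) := by
    refine (ENNReal.mul_le_mul_iff_right ht0 htt).1 ?_
    calc _ = t ^ 2 * volume {x | t < maximalTruncated K g x} := by ring
      _ ≤ C * ((41 ^ n : ℝ≥0) * t * ∫⁻ y, ‖f y‖ₑ) := (hC g hgL hg t).trans (by gcongr)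
      _ = _ := by ring
  have e3 : t * volume ({x | t < Φ x} ∩ Uᶜ) ≤ C₂ * ∫⁻ y, ‖f y‖ₑ := by
    refine le_trans ?_ hΦ
    refine le_trans ?_ (mul_meas_ge_le_lintegral hΦm t)
    rw [← Measure.restrict_apply (measurableSet_lt measurable_const hΦm)]
    gcongr
    exact fun hx => le_of_lt hx
  calc s * volume {x | s < maximalTruncated K f x}
      ≤ C₁ * t * (volume U + volume {x | t < maximalTruncated K g x} +
          volume ({x | t < Φ x} ∩ Uᶜ)) := by
        rw [hst'] at hsub ⊢
        gcongr
        exact (measure_mono hsub).trans ((measure_union_le _ _).trans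
          (add_le_add_left (measure_union_le _ _) _))
    _ = C₁ * (t * volume U + t * volume {x | t < maximalTruncated K g x} +
          t * volume ({x | t < Φ x} ∩ Uᶜ)) := by ring
    _ ≤ C₁ * ((5 ^ n : ℝ≥0) * (∫⁻ y, ‖f y‖ₑ) + C * ((41 ^ n : ℝ≥0) * ∫⁻ y, ‖f y‖ₑ) +
          C₂ * ∫⁻ y, ‖f y‖ₑ) := by gcongr
    _ = _ := by push_cast; ring

end StandardKernel

end WeakTypeOne

/-! ### Good-λ inequality -/

section GoodLambda

/-- Choice of the ratio of heights in the good-λ argument. -/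
lemma exists_rpow_mul_eq {p : ℝ} (hp : 0 < p) (C : ℝ≥0) :
    ∃ s : ℝ≥0, 0 < s ∧ (C + 1 / 2) * (1 + s) ^ p = C + 1 := by
  have h0 : 0 < C + 1 / 2 := by positivity
  have h1 : 1 < (C + 1) / (C + 1 / 2) := by
    rw [one_lt_div h0]
    gcongr
    exact NNReal.half_lt_self one_ne_zero
  have h2 : 1 < ((C + 1) / (C + 1 / 2)) ^ (1 / p) := NNReal.one_lt_rpow h1 (by positivity)
  refine ⟨((C + 1) / (C + 1 / 2)) ^ (1 / p) - 1, tsub_pos_of_lt h2, ?_⟩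
  rw [add_tsub_cancel_of_le h2.le, ← NNReal.rpow_mul, one_div_mul_cancel hp.ne', NNReal.rpow_one,
    mul_div_cancel₀ _ h0.ne']

/-- Absorption of a finite term `I` that appears on both sides of an inequality. -/
lemma le_of_add_half_mul_le {C : ℝ≥0} {I J : ℝ≥0∞} (hI : I ≠ ∞)
    (h : (C + 1 / 2 : ℝ≥0) * I ≤ C * I + J) : I ≤ 2 * J := by
  rw [ENNReal.coe_add, add_mul] at h
  have h1 := (ENNReal.add_le_add_iff_left (ENNReal.mul_ne_top ENNReal.coe_ne_top hI)).1 h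
  calc I = 2 * (((1 / 2 : ℝ≥0) : ℝ≥0∞) * I) := by
        rw [← mul_assoc]
        have : (2 : ℝ≥0∞) * ((1 / 2 : ℝ≥0) : ℝ≥0∞) = 1 := by
          rw [← ENNReal.coe_ofNat, ← ENNReal.coe_mul]
          norm_num
        rw [this, one_mul]
    _ ≤ _ := by gcongr

/-- A good-λ inequality passes to the truncations of the larger function. -/
lemma goodLambda_min {α : Type} [MeasurableSpace α] {μ : Measure α} {F m : α → ℝ≥0∞}
    {C s γ : ℝ≥0} {t : ℝ≥0∞}
    (h : (C + 1) * μ {x | (1 + s) * t < F x ∧ m x ≤ γ * t} ≤ C * μ {x | t < F x}) (N : ℕ) :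
    (C + 1) * μ {x | (1 + s) * t < min (F x) N} ≤
      C * μ {x | t < min (F x) N} + (C + 1) * μ {x | γ * t < m x} := by
  have hle : t ≤ (1 + s) * t := by
    rw [add_mul, one_mul]; exact le_self_add
  by_cases hN : (1 + s) * t < N
  · have h1 : {x | (1 + s) * t < min (F x) N} ⊆
        {x | (1 + s) * t < F x ∧ m x ≤ γ * t} ∪ {x | γ * t < m x} := by
      intro x hx
      rcases le_or_gt (m x) (γ * t) with hm | hm
      · exact .inl ⟨(lt_min_iff.1 hx).1, hm⟩
      · exact .inr hm
    have h2 : {x | t < F x} ⊆ {x | t < min (F x) N} := fun x hx =>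
      lt_min hx (hle.trans_lt hN)
    calc _ ≤ (C + 1) * (μ {x | (1 + s) * t < F x ∧ m x ≤ γ * t} + μ {x | γ * t < m x}) := by
          gcongr
          exact (measure_mono h1).trans (measure_union_le _ _)
      _ ≤ _ := by
          rw [mul_add]
          exact add_le_add_left (h.trans (mul_le_mul_right (measure_mono h2) _)) _
  · have h1 : {x | (1 + s) * t < min (F x) N} = ∅ := by
      ext x
      simp only [mem_ofPred_eq, lt_min_iff, hN, and_false, mem_empty_iff_false]
    rw [h1, measure_empty, mul_zero]
    exact zero_le

/-- From a good-λ inequality to a bound for `F` by `m` in `L_p`. A priori finiteness is needed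
only for the truncations of `F`. -/
lemma exists_lintegral_rpow_le_of_goodLambda {p : ℝ} (hp : 0 < p) (C : ℝ≥0) :
    ∃ s : ℝ≥0, 0 < s ∧ ∀ γ : ℝ≥0, 0 < γ → ∃ C' : ℝ≥0, 0 < C' ∧
      ∀ {α : Type} [MeasurableSpace α] (μ : Measure α) [SFinite μ] {F m : α → ℝ≥0∞},
        Measurable F → Measurable m →
        (∀ t : ℝ≥0∞, t ≠ 0 → t ≠ ∞ → (C + 1) * μ {x | (1 + s) * t < F x ∧ m x ≤ γ * t} ≤
          C * μ {x | t < F x}) →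
        (∀ N : ℕ, ∫⁻ x, min (F x) N ^ p ∂μ ≠ ∞) →
        ∫⁻ x, F x ^ p ∂μ ≤ C' * ∫⁻ x, m x ^ p ∂μ := by
  obtain ⟨s, hs, hsC⟩ := exists_rpow_mul_eq hp C
  refine ⟨s, hs, fun γ hγ => ⟨2 * ((C + 1) * (γ⁻¹) ^ p), by positivity,
    fun {α} _ μ _ {F m} hF hm h hfin => ?_⟩⟩
  have hs0 : (1 + s) ≠ 0 := by positivity
  have hs0' : ((1 + s : ℝ≥0) : ℝ≥0∞) ≠ 0 := by exact_mod_cast hs0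
  have hγ0' : (γ : ℝ≥0∞) ≠ 0 := by exact_mod_cast hγ.ne'
  have key : ∀ N : ℕ, ∫⁻ x, min (F x) N ^ p ∂μ ≤
      2 * ((C + 1) * ((γ⁻¹ : ℝ≥0) ^ p * ∫⁻ x, m x ^ p ∂μ)) := by
    intro N
    set G : α → ℝ≥0∞ := fun x => min (F x) N
    have hG : Measurable G := hF.min measurable_const
    refine le_of_add_half_mul_le (C := C) (hfin N) ?_
    have hlc := lintegral_rpow_eq_layercake μ hp
      (F := fun x => ((1 + s : ℝ≥0)⁻¹ : ℝ≥0∞) * G x) (hG.const_mul _)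
    have hlc' := lintegral_rpow_eq_layercake μ hp
      (F := fun x => ((γ⁻¹ : ℝ≥0) : ℝ≥0∞) * m x) (hm.const_mul _)
    simp only [ENNReal.mul_rpow_of_nonneg _ _ hp.le] at hlc hlc'
    rw [lintegral_const_mul _ (hG.pow_const _)] at hlc
    rw [lintegral_const_mul _ (hm.pow_const _)] at hlc'
    have e1 : ((C + 1 / 2 : ℝ≥0) : ℝ≥0∞) = (C + 1) * ((1 + s : ℝ≥0)⁻¹ : ℝ≥0∞) ^ p := by
      have : C + 1 / 2 = (C + 1) * ((1 + s)⁻¹) ^ p := by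
        rw [← hsC, mul_assoc, ← NNReal.mul_rpow, mul_inv_cancel₀ hs0, NNReal.one_rpow, mul_one]
      rw [this, ENNReal.coe_mul, ENNReal.coe_rpow_of_nonneg _ hp.le, ENNReal.coe_inv hs0]
      push_cast
      rfl
    rw [e1, mul_assoc, hlc, hlc', lintegral_rpow_eq_layercake μ hp hG]
    set a : ℝ → ℝ≥0∞ := fun t => ENNReal.ofReal (t ^ (p - 1))
    have hmeas : Measurable fun t : ℝ => a t * μ {x | ENNReal.ofReal t < G x} := by
      refine Measurable.mul (by fun_prop) (Antitone.measurable fun t t' htt => ?_)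
      exact measure_mono fun x hx => (ENNReal.ofReal_le_ofReal htt).trans_lt hx
    calc _ = ENNReal.ofReal p * ∫⁻ t in Ioi (0 : ℝ), (C + 1) *
          (a t * μ {x | ENNReal.ofReal t < ((1 + s : ℝ≥0)⁻¹ : ℝ≥0∞) * G x}) := by
          rw [lintegral_const_mul' _ _ (by finiteness)]
          ring
      _ ≤ ENNReal.ofReal p * ∫⁻ t in Ioi (0 : ℝ), (C * (a t * μ {x | ENNReal.ofReal t < G x}) +
          (C + 1) * (a t * μ {x | ENNReal.ofReal t < ((γ⁻¹ : ℝ≥0) : ℝ≥0∞) * m x})) := by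
          refine mul_le_mul_right (setLIntegral_mono' measurableSet_Ioi fun t ht => ?_) _
          have ht : 0 < t := ht
          have h1 := goodLambda_min (h (ENNReal.ofReal t) (by simpa using ht)
            ENNReal.ofReal_ne_top) N
          have h2 : {x | ENNReal.ofReal t < ((1 + s : ℝ≥0)⁻¹ : ℝ≥0∞) * G x} ⊆
              {x | (1 + s) * ENNReal.ofReal t < min (F x) N} := by
            intro x hx
            have hx : ENNReal.ofReal t < ((1 + s : ℝ≥0)⁻¹ : ℝ≥0∞) * G x := hx
            rw [mul_comm, ← div_eq_mul_inv,
              ENNReal.lt_div_iff_mul_lt (.inl hs0') (.inl ENNReal.coe_ne_top)] at hx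
            rw [mem_ofPred_eq, mul_comm]
            exact_mod_cast hx
          have h3 : {x | γ * ENNReal.ofReal t < m x} ⊆
              {x | ENNReal.ofReal t < ((γ⁻¹ : ℝ≥0) : ℝ≥0∞) * m x} := by
            intro x hx
            have hx : γ * ENNReal.ofReal t < m x := hx
            rw [mem_ofPred_eq, ENNReal.coe_inv hγ.ne', mul_comm, ← div_eq_mul_inv,
              ENNReal.lt_div_iff_mul_lt (.inl hγ0') (.inl ENNReal.coe_ne_top), mul_comm]
            exact hx
          calc _ = a t * ((C + 1) *
                μ {x | ENNReal.ofReal t < ((1 + s : ℝ≥0)⁻¹ : ℝ≥0∞) * G x}) := by ring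
            _ ≤ a t * (C * μ {x | ENNReal.ofReal t < G x} +
                (C + 1) * μ {x | ENNReal.ofReal t < ((γ⁻¹ : ℝ≥0) : ℝ≥0∞) * m x}) := by
                gcongr
                exact (mul_le_mul_right (measure_mono h2) _).trans (h1.trans (by gcongr))
            _ = _ := by ring
      _ = _ := by
          rw [lintegral_add_left (hmeas.const_mul _), lintegral_const_mul' _ _ (by finiteness),
            lintegral_const_mul' _ _ (by finiteness)]
          ring
  have hlim : Filter.Tendsto (fun N : ℕ => ∫⁻ x, min (F x) N ^ p ∂μ) Filter.atTop
      (nhds (∫⁻ x, F x ^ p ∂μ)) := by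
    refine lintegral_tendsto_of_tendsto_of_monotone
      (fun N => ((hF.min measurable_const).pow_const _).aemeasurable)
      (.of_forall fun x N N' hN => ?_) (.of_forall fun x => ?_)
    · exact ENNReal.rpow_le_rpow (min_le_min le_rfl (by exact_mod_cast hN)) hp.le
    · have h1 : Filter.Tendsto (fun N : ℕ => min (F x) (N : ℝ≥0∞)) Filter.atTop
          (nhds (min (F x) ∞)) := tendsto_const_nhds.min ENNReal.tendsto_nat_nhds_top
      rw [min_eq_left le_top] at h1
      exact (ENNReal.continuous_rpow_const.tendsto _).comp h1
  refine le_of_tendsto' hlim fun N => (key N).trans (le_of_eq ?_)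
  push_cast
  rw [ENNReal.coe_rpow_of_nonneg _ hp.le]
  ring

/-- From a good-λ inequality to a weak type bound for `F` by `m`. -/
lemma exists_mul_measure_le_of_goodLambda (C : ℝ≥0) :
    ∃ s : ℝ≥0, 0 < s ∧ ∀ γ : ℝ≥0, 0 < γ → ∃ C' : ℝ≥0, 0 < C' ∧
      ∀ {α : Type} [MeasurableSpace α] (μ : Measure α) {F m : α → ℝ≥0∞} {S : ℝ≥0∞},
        (∀ t : ℝ≥0∞, t ≠ 0 → t ≠ ∞ → (C + 1) * μ {x | (1 + s) * t < F x ∧ m x ≤ γ * t} ≤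
          C * μ {x | t < F x}) →
        (∀ t : ℝ≥0∞, t * μ {x | t < m x} ≤ S) →
        (∀ N : ℕ, ∃ D : ℝ≥0, ∀ t : ℝ≥0∞, t * μ {x | t < min (F x) N} ≤ D) →
        ∀ t : ℝ≥0∞, t * μ {x | t < F x} ≤ C' * S := by
  obtain ⟨s, hs, hsC⟩ := exists_rpow_mul_eq one_pos C
  rw [NNReal.rpow_one] at hsC
  refine ⟨s, hs, fun γ hγ => ⟨2 * ((C + 1) * γ⁻¹), by positivity,
    fun {α} _ μ {F m S} h hS hfin t => ?_⟩⟩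
  have hs0' : ((1 + s : ℝ≥0) : ℝ≥0∞) ≠ 0 := by simp
  have hγ0' : (γ : ℝ≥0∞) ≠ 0 := by exact_mod_cast hγ.ne'
  rcases eq_or_ne t ∞ with rfl | htt
  · simp
  have key : ∀ N : ℕ, t * μ {x | t < min (F x) N} ≤ 2 * ((C + 1) * ((γ⁻¹ : ℝ≥0) * S)) := by
    intro N
    obtain ⟨D, hD⟩ := hfin N
    set Φ := ⨆ τ : ℝ≥0∞, τ * μ {x | τ < min (F x) N}
    have hΦ : Φ ≠ ∞ := ((iSup_le hD).trans_lt ENNReal.coe_lt_top).ne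
    refine (le_iSup (fun τ : ℝ≥0∞ => τ * μ {x | τ < min (F x) N}) t).trans
      (le_of_add_half_mul_le (C := C) hΦ ?_)
    rw [ENNReal.mul_iSup]
    refine iSup_le fun τ => ?_
    rcases eq_or_ne τ 0 with rfl | hτ0
    · simp
    rcases eq_or_ne τ ∞ with rfl | hτt
    · simp
    set u := τ / (1 + s : ℝ≥0)
    have hu : τ = (1 + s : ℝ≥0) * u := (ENNReal.mul_div_cancel hs0' ENNReal.coe_ne_top).symm
    have hu0 : u ≠ 0 := by
      intro h0; rw [h0, mul_zero] at hu; exact hτ0 hu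
    have hut : u ≠ ∞ := ENNReal.div_ne_top hτt hs0'
    have h1 := goodLambda_min (h u hu0 hut) N
    have hu' : (1 + s) * u = τ := by rw [hu]; push_cast; rfl
    rw [hu'] at h1
    calc (C + 1 / 2 : ℝ≥0) * (τ * μ {x | τ < min (F x) N})
        = ((C + 1 / 2) * (1 + s) : ℝ≥0) * u * μ {x | τ < min (F x) N} := by
          rw [ENNReal.coe_mul, mul_assoc (_ : ℝ≥0∞) _ u, ← hu, mul_assoc]
      _ = u * ((C + 1) * μ {x | τ < min (F x) N}) := by
          rw [hsC]; push_cast; ring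
      _ ≤ u * (C * μ {x | u < min (F x) N} + (C + 1) * μ {x | γ * u < m x}) := by gcongr
      _ = C * (u * μ {x | u < min (F x) N}) + (C + 1) *
            ((γ⁻¹ : ℝ≥0) * (γ * u * μ {x | γ * u < m x})) := by
          have : ((γ⁻¹ : ℝ≥0) : ℝ≥0∞) * γ = 1 := by
            rw [ENNReal.coe_inv hγ.ne', ENNReal.inv_mul_cancel hγ0' ENNReal.coe_ne_top]
          calc _ = C * (u * μ {x | u < min (F x) N}) +
                1 * ((C + 1) * (u * μ {x | γ * u < m x})) := by ring
            _ = _ := by rw [← this]; ring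
      _ ≤ _ := by
          gcongr
          · exact le_iSup (fun τ : ℝ≥0∞ => τ * μ {x | τ < min (F x) N}) u
          · exact hS _
  have hU : {x | t < F x} = ⋃ N : ℕ, {x | t < min (F x) N} := by
    ext x
    simp only [mem_ofPred_eq, mem_iUnion, lt_min_iff]
    refine ⟨fun hx => ?_, fun ⟨N, hx, _⟩ => hx⟩
    obtain ⟨N, hN⟩ := ENNReal.exists_nat_gt htt
    exact ⟨N, hx, hN⟩
  have hmono : Monotone fun N : ℕ => {x | t < min (F x) N} := fun N N' hN x hx =>
    lt_of_lt_of_le (show t < min (F x) N from hx) (min_le_min le_rfl (by exact_mod_cast hN))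
  rw [hU, hmono.measure_iUnion, ENNReal.mul_iSup]
  refine iSup_le fun N => (key N).trans (le_of_eq ?_)
  push_cast
  ring

variable {n : ℕ} {K : E n → E n → ℂ} {A : ℝ≥0} {δ : ℝ} {f : E n → ℂ}

namespace StandardKernel

variable (hK : StandardKernel K A δ)
include hK

/-- Comparison of the maximal truncated operator at two nearby points, for the part of the
function far from these points. -/
lemma maximalTruncated_far_le (hf : Integrable f volume) {x₀ x z ξ : E n} {r : ℝ} (hr : 0 < r)
    (hx : x ∈ ball x₀ r) (hξ : ξ ∈ ball x₀ r) (hz : dist z x₀ < 41 * r) :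
    maximalTruncated K (f - (ball x₀ (200 * r)).indicator f) x ≤ maximalTruncated K f z +
      A * (ENNReal.ofReal ((n + δ) / δ) + ENNReal.ofReal (4 ^ n)) *
        volume (ball (0 : E n) 1) * maximalFn volume (fun y => ‖f y‖ₑ) ξ := by
  have hx : dist x x₀ < r := hx
  have hξ : dist ξ x₀ < r := hξ
  have htail := tailIntegrable_of_integrable hf
  refine maximalTruncated_le fun ε₀ hε₀ => ?_
  -- A point outside of `ball x₀ (200 * r)` has distance at least `199 * r` from `x`.
  set ε := max ε₀ (199 * r)
  have hεr : 199 * r ≤ ε := le_max_right _ _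
  have hε : 0 < ε := lt_of_lt_of_le (by positivity) hεr
  set S := (ball x ε)ᶜ ∩ (ball x₀ (200 * r))ᶜ
  have hSm : MeasurableSet S := measurableSet_ball.compl.inter measurableSet_ball.compl
  set S' := (ball z ε)ᶜ
  have hS'm : MeasurableSet S' := measurableSet_ball.compl
  have hxz : dist x z < 42 * r := by
    have := dist_triangle x x₀ z
    rw [dist_comm x₀ z] at this
    linarith
  have hε2 : 0 < ε / 2 := by positivity
  have hS2 : S ⊆ (ball z (ε / 2))ᶜ := by
    intro y hy
    have h1 := le_dist_of_mem_compl_ball hy.1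
    have h2 := dist_triangle x z y
    simp only [mem_compl_iff, mem_ball, not_lt]
    rw [dist_comm]
    linarith
  have hS'2 : S' ⊆ (ball z (ε / 2))ᶜ := compl_subset_compl.2 (ball_subset_ball (by linarith))
  -- The truncation at `ε₀` can be replaced by the truncation at `ε`.
  have htr : truncated K ε₀ (f - (ball x₀ (200 * r)).indicator f) x = ∫ y in S, K x y * f y := by
    rw [truncated, ← integral_indicator measurableSet_ball.compl, ← integral_indicator hSm]
    refine integral_congr_ae (.of_forall fun y => ?_)
    simp only [S, indicator, mem_inter_iff, mem_compl_iff, mem_ball, not_lt, Pi.sub_apply]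
    by_cases h1 : dist y x₀ < 200 * r
    · simp [h1]
    · have h2 : 199 * r ≤ dist y x := by
        have := dist_triangle y x x₀
        linarith
      have h3 : ε₀ ≤ dist y x ↔ ε ≤ dist y x := by
        simp [ε, h2]
      have h4 : 200 * r ≤ dist y x₀ := not_lt.1 h1
      by_cases h5 : ε ≤ dist y x
      · simp [h1, h4, h5, h3.2 h5]
      · simp [h4, h5, h3]
  have hFint : IntegrableOn (fun y => K z y * f y) (ball z (ε / 2))ᶜ volume :=
    hK.integrableOn htail z hε2
  have hF := hFint.mono_set hS2
  have hF' := hFint.mono_set hS'2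
  have hKx : IntegrableOn (fun y => K x y * f y) S volume :=
    (hK.integrableOn htail x hε).mono_set inter_subset_left
  have hdec : truncated K ε₀ (f - (ball x₀ (200 * r)).indicator f) x =
      truncated K ε f z + (∫ y in S, (K x y - K z y) * f y) +
        ∫ y, (S.indicator (fun y => K z y * f y) y - S'.indicator (fun y => K z y * f y) y) := by
    rw [htr, integral_sub ((integrable_indicator_iff hSm).2 hF)
      ((integrable_indicator_iff hS'm).2 hF'), integral_indicator hSm, integral_indicator hS'm]
    simp only [sub_mul]
    rw [integral_sub hKx hF, truncated]
    ring
  have hκ : ∀ {y : E n} {t : ℝ}, dist ξ y < t → ∫⁻ y in ball y t, ‖f y‖ₑ ≤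
      maximalFn volume (fun y => ‖f y‖ₑ) ξ * volume (ball (0 : E n) 1) * ENNReal.ofReal (t ^ n) :=
    fun h => setLIntegral_ball_le_maximalFn_mul_pow h
  have hb1 : ‖∫ y in S, (K x y - K z y) * f y‖ₑ ≤ A * ENNReal.ofReal ((n + δ) / δ) *
      (maximalFn volume (fun y => ‖f y‖ₑ) ξ * volume (ball (0 : E n) 1)) := by
    refine (enorm_integral_le_lintegral_enorm _).trans
      ((lintegral_mono_set inter_subset_left).trans
        (hK.lintegral_enorm_kernel_sub_le hf.1 hε (by linarith) fun t ht => hκ ?_))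
    have := dist_triangle ξ x₀ x
    rw [dist_comm x₀ x] at this
    linarith
  have hb2 : ‖∫ y, (S.indicator (fun y => K z y * f y) y -
      S'.indicator (fun y => K z y * f y) y)‖ₑ ≤ A * ENNReal.ofReal (4 ^ n) *
      (maximalFn volume (fun y => ‖f y‖ₑ) ξ * volume (ball (0 : E n) 1)) := by
    calc _ ≤ ∫⁻ y in ball z (2 * ε), A * ENNReal.ofReal ((ε / 2) ^ (-(n : ℝ))) * ‖f y‖ₑ := by
          refine (enorm_integral_le_lintegral_enorm _).trans ?_
          rw [← lintegral_indicator measurableSet_ball]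
          refine lintegral_mono fun y => ?_
          by_cases hyS : y ∈ S <;> by_cases hyS' : y ∈ S'
          · simp [hyS, hyS']
          · have hy2 : y ∈ ball z (2 * ε) :=
              ball_subset_ball (by linarith) (notMem_compl_iff.1 hyS')
            simp only [indicator_of_mem hyS, indicator_of_notMem hyS', indicator_of_mem hy2,
              sub_zero, enorm_mul]
            exact mul_le_mul_left (hK.enorm_le hε2 (le_dist_of_mem_compl_ball (hS2 hyS))) _
          · have hy2 : y ∈ ball z (2 * ε) := by
              rw [mem_ball]
              by_cases h1 : dist y x < ε
              · have := dist_triangle y x z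
                linarith
              · have h2 : dist y x₀ < 200 * r := by
                  by_contra h2
                  exact hyS ⟨h1, h2⟩
                have := dist_triangle y x₀ z
                rw [dist_comm x₀ z] at this
                linarith
            simp only [indicator_of_notMem hyS, indicator_of_mem hyS', indicator_of_mem hy2,
              zero_sub, enorm_neg, enorm_mul]
            exact mul_le_mul_left (hK.enorm_le hε2 (le_dist_of_mem_compl_ball (hS'2 hyS'))) _
          · simp [hyS, hyS']
      _ = A * ENNReal.ofReal ((ε / 2) ^ (-(n : ℝ))) * ∫⁻ y in ball z (2 * ε), ‖f y‖ₑ :=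
          lintegral_const_mul'' _ hf.1.enorm.restrict
      _ ≤ A * ENNReal.ofReal ((ε / 2) ^ (-(n : ℝ))) * (maximalFn volume (fun y => ‖f y‖ₑ) ξ *
            volume (ball (0 : E n) 1) * ENNReal.ofReal ((2 * ε) ^ n)) := by
          refine mul_le_mul_right (hκ ?_) _
          have := dist_triangle ξ x₀ z
          rw [dist_comm x₀ z] at this
          linarith
      _ = A * (ENNReal.ofReal ((ε / 2) ^ (-(n : ℝ))) * ENNReal.ofReal ((2 * ε) ^ n)) *
            (maximalFn volume (fun y => ‖f y‖ₑ) ξ * volume (ball (0 : E n) 1)) := by ring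
      _ = _ := by
          rw [← ENNReal.ofReal_mul (by positivity), Real.rpow_neg hε2.le, Real.rpow_natCast,
            ← inv_pow, ← mul_pow]
          congr 4
          field_simp
          norm_num
  rw [hdec]
  refine (enorm_add_le _ _).trans ((add_le_add (enorm_add_le _ _) hb2).trans ?_)
  refine (add_le_add_left (add_le_add (enorm_truncated_le_maximalTruncated f z hε) hb1) _).trans
    (le_of_eq ?_)
  ring

/-- Local form of the good-λ inequality for Lebesgue measure: the bad set fills at most half of
each Whitney ball. -/
lemma two_mul_volume_le {C : ℝ≥0} (h11 : ∀ f : E n → ℂ, Integrable f volume → ∀ t : ℝ≥0∞,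
      t * volume {x | t < maximalTruncated K f x} ≤ C * ∫⁻ y, ‖f y‖ₑ)
    {s γ : ℝ≥0} (hs : 0 < s)
    (hγ₁ : A * (ENNReal.ofReal ((n + δ) / δ) + ENNReal.ofReal (4 ^ n)) *
      volume (ball (0 : E n) 1) * γ ≤ (s / 2 : ℝ≥0))
    (hγ₂ : C * 200 ^ n * γ * 4 ≤ s)
    (hf : Integrable f volume) {x₀ z : E n} {r : ℝ} (hr : 0 < r) {t : ℝ≥0∞} (ht0 : t ≠ 0)
    (htt : t ≠ ∞) (hzF : maximalTruncated K f z ≤ t) (hz : dist z x₀ < 41 * r) :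
    2 * volume ({x | (1 + s) * t < maximalTruncated K f x ∧
      maximalFn volume (fun y => ‖f y‖ₑ) x ≤ γ * t} ∩ ball x₀ r) ≤ volume (ball x₀ r) := by
  set S := {x | (1 + s) * t < maximalTruncated K f x ∧
      maximalFn volume (fun y => ‖f y‖ₑ) x ≤ γ * t} ∩ ball x₀ r
  rcases S.eq_empty_or_nonempty with hS | ⟨ξ, ⟨-, hξM⟩, hξ⟩
  · rw [hS]; simp
  set f₁ := (ball x₀ (200 * r)).indicator f
  have hf₁ : Integrable f₁ volume := hf.indicator measurableSet_ball
  have hsub : S ⊆ {x | (s / 2 : ℝ≥0) * t < maximalTruncated K f₁ x} := by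
    rintro x ⟨⟨hxF, -⟩, hx⟩
    by_contra hcon
    have hcon : maximalTruncated K f₁ x ≤ (s / 2 : ℝ≥0) * t := not_lt.1 hcon
    have h1 := hK.maximalTruncated_le_add (tailIntegrable_of_integrable hf)
      (tailIntegrable_of_integrable hf₁) x
    have h2 := hK.maximalTruncated_far_le hf hr hx hξ hz
    have h3 : maximalTruncated K f x ≤ (s / 2 : ℝ≥0) * t + (t + (s / 2 : ℝ≥0) * t) := by
      refine h1.trans (add_le_add hcon (h2.trans (add_le_add hzF ?_)))
      refine (mul_le_mul_right hξM _).trans ?_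
      rw [← mul_assoc]
      exact mul_le_mul_left hγ₁ _
    refine absurd hxF (not_lt.2 (h3.trans (le_of_eq ?_)))
    have h4 : (s : ℝ≥0∞) = (s / 2 : ℝ≥0) + (s / 2 : ℝ≥0) := by
      rw [← ENNReal.coe_add, add_halves]
    rw [h4]
    ring
  have h5 : (s / 2 : ℝ≥0) * t * volume S ≤ C * (γ * t * (200 ^ n * volume (ball x₀ r))) := by
    calc _ ≤ (s / 2 : ℝ≥0) * t * volume {x | (s / 2 : ℝ≥0) * t < maximalTruncated K f₁ x} := by
          gcongr
      _ ≤ C * ∫⁻ y, ‖f₁ y‖ₑ := h11 f₁ hf₁ _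
      _ = C * ∫⁻ y in ball x₀ (200 * r), ‖f y‖ₑ := by
          rw [← lintegral_indicator measurableSet_ball]
          congr 2
          funext y
          simp only [f₁, indicator]
          split_ifs <;> simp
      _ ≤ C * (maximalFn volume (fun y => ‖f y‖ₑ) ξ * volume (ball x₀ (200 * r))) := by
          gcongr
          exact setLIntegral_ball_le_maximalFn (ball_subset_ball (by linarith) hξ)
            measure_ball_lt_top.ne
      _ ≤ _ := by
          rw [volume_ball_mul x₀ x₀ (by norm_num) hr, ENNReal.ofReal_pow (by norm_num)]
          simp only [ENNReal.ofReal_ofNat]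
          gcongr
  have hst0 : ((s / 2 : ℝ≥0) : ℝ≥0∞) * t ≠ 0 :=
    mul_ne_zero (by simpa using hs.ne') ht0
  refine (ENNReal.mul_le_mul_iff_right hst0 (by finiteness)).1 ?_
  calc _ = 2 * ((s / 2 : ℝ≥0) * t * volume S) := by ring
    _ ≤ 2 * (C * (γ * t * (200 ^ n * volume (ball x₀ r)))) := by gcongr
    _ = (2 * (C * 200 ^ n * γ) : ℝ≥0) * t * volume (ball x₀ r) := by push_cast; ring
    _ ≤ _ := by
        gcongr
        rw [le_div_iff₀ two_pos]
        calc _ = C * 200 ^ n * γ * 4 := by ring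
          _ ≤ s := hγ₂

end StandardKernel

end GoodLambda

/-! ### Weighted bounds for the maximal truncated operator -/

section Weighted

variable {n : ℕ} {p : ℝ} {w : E n → ℝ} {K : E n → E n → ℂ} {A : ℝ≥0} {δ : ℝ} {f : E n → ℂ}

/-- The good-λ inequality between the maximal truncated operator and the maximal function for a
Muckenhoupt weight. The constant `C` comes from the weight alone; the relative measure of the bad
set is at most `C / (C + 1) < 1`, which is enough as the ratio `1 + s` of the heights is
arbitrary. -/
theorem exists_goodLambda (hp : 1 ≤ p) (hw : IsMuckenhoupt p w) (hK : StandardKernel K A δ)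
    (hn : 0 < n) (h11 : ∃ C : ℝ≥0, ∀ f : E n → ℂ, Integrable f volume → ∀ t : ℝ≥0∞,
      t * volume {x | t < maximalTruncated K f x} ≤ C * ∫⁻ y, ‖f y‖ₑ) :
    ∃ C : ℝ≥0, ∀ s : ℝ≥0, 0 < s → ∃ γ : ℝ≥0, 0 < γ ∧ ∀ f : E n → ℂ, Integrable f volume →
      ∀ t : ℝ≥0∞, t ≠ 0 → t ≠ ∞ →
        (C + 1) * weightMeasure w {x | (1 + s) * t < maximalTruncated K f x ∧
          maximalFn volume (fun y => ‖f y‖ₑ) x ≤ γ * t} ≤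
        C * weightMeasure w {x | t < maximalTruncated K f x} := by
  obtain ⟨C₁, hC₁⟩ := h11
  obtain ⟨C₂, hC₂⟩ := hw.exists_weightMeasure_ball_le hp
  have hp0 : 0 ≤ p := by linarith
  refine ⟨C₂ * (5 ^ n * 2) ^ p, fun s hs => ?_⟩
  set b : ℝ≥0∞ := A * (ENNReal.ofReal ((n + δ) / δ) + ENNReal.ofReal (4 ^ n)) *
      volume (ball (0 : E n) 1)
  have hb : b ≠ ∞ := ENNReal.mul_ne_top (by finiteness) volume_unitBall_ne_top
  set γ : ℝ≥0 := s / (2 * b.toNNReal + C₁ * 200 ^ n * 4 + 1)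
  have hden : 0 < 2 * b.toNNReal + C₁ * 200 ^ n * 4 + 1 := by positivity
  have hγden : γ * (2 * b.toNNReal + C₁ * 200 ^ n * 4 + 1) = s := div_mul_cancel₀ _ hden.ne'
  have hγ₁ : b * γ ≤ (s / 2 : ℝ≥0) := by
    rw [← ENNReal.coe_toNNReal hb]
    have : b.toNNReal * γ ≤ s / 2 := by
      rw [le_div_iff₀ two_pos]
      calc b.toNNReal * γ * 2 = γ * (2 * b.toNNReal) := by ring
        _ ≤ γ * (2 * b.toNNReal + C₁ * 200 ^ n * 4 + 1) := by
            gcongr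
            rw [add_assoc]
            exact le_self_add
        _ = s := hγden
    exact_mod_cast this
  have hγ₂ : C₁ * 200 ^ n * γ * 4 ≤ s := by
    calc C₁ * 200 ^ n * γ * 4 = γ * (C₁ * 200 ^ n * 4) := by ring
      _ ≤ γ * (2 * b.toNNReal + C₁ * 200 ^ n * 4 + 1) := by
          gcongr
          exact le_add_right le_add_self
      _ = s := hγden
  refine ⟨γ, div_pos hs hden, fun f hf t ht0 htt => ?_⟩
  set U := {x | t < maximalTruncated K f x}
  set S := {x | (1 + s) * t < maximalTruncated K f x ∧
    maximalFn volume (fun y => ‖f y‖ₑ) x ≤ γ * t}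
  have htail := tailIntegrable_of_integrable hf
  have hUo : IsOpen U := hK.isOpen_lt_maximalTruncated htail t
  have hSm : MeasurableSet S :=
    (measurableSet_lt measurable_const (hK.measurable_maximalTruncated htail)).inter
      (measurableSet_le measurable_maximalFn measurable_const)
  have hSU : S ⊆ U := fun x hx => lt_of_le_of_lt
    (by rw [add_mul, one_mul]; exact le_self_add) hx.1
  have hUfin : volume U ≠ ∞ := by
    intro h
    have h1 := hC₁ f hf t
    rw [show {x | t < maximalTruncated K f x} = U from rfl, h, ENNReal.mul_top ht0,
      top_le_iff] at h1
    exact ENNReal.mul_ne_top ENNReal.coe_ne_top hf.2.ne h1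
  have hne : Uᶜ.Nonempty := by
    rw [nonempty_compl]
    intro h
    rw [h] at hUfin
    exact hUfin (volume_univ_eq_top hn)
  obtain ⟨R, hR⟩ := exists_forall_infDist_le hn hUfin
  obtain ⟨u, ρ, hu, hρ, h40, hz, hdisj, hcov⟩ := exists_whitney_balls hUo hne hR
  have hlocal : ∀ c ∈ u, weightMeasure w (ball c (5 * ρ c)) ≤
      (C₂ * (5 ^ n * 2) ^ p : ℝ≥0) * weightMeasure w (ball c (ρ c) \ S) := by
    intro c hc
    have hr := hρ c hc
    obtain ⟨z, hzU, hzd⟩ := hz c hc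
    have h2 := hK.two_mul_volume_le hC₁ hs hγ₁ hγ₂ hf hr ht0 htt (not_lt.1 hzU) hzd
    change 2 * volume (S ∩ ball c (ρ c)) ≤ _ at h2
    set V := volume (ball c (ρ c))
    have hVt : V ≠ ∞ := measure_ball_lt_top.ne
    have hV0 : V ≠ 0 := (measure_ball_pos _ _ hr).ne'
    have hSt : volume (S ∩ ball c (ρ c)) ≠ ∞ := measure_ne_top_of_subset inter_subset_right hVt
    have hsplit : volume (S ∩ ball c (ρ c)) + volume (ball c (ρ c) \ S) = V := by
      rw [inter_comm]
      exact measure_inter_add_sdiff _ hSm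
    have hhalf : V ≤ 2 * volume (ball c (ρ c) \ S) := by
      refine (ENNReal.add_le_add_iff_left (ENNReal.mul_ne_top (by norm_num) hSt)).1
        (show 2 * volume (S ∩ ball c (ρ c)) + V ≤ _ + _ from ?_)
      rw [← mul_add, hsplit]
      exact (add_le_add_left h2 V).trans_eq (two_mul V).symm
    have hDt : volume (ball c (ρ c) \ S) ≠ ∞ := measure_ne_top_of_subset sdiff_subset hVt
    have hD0 : volume (ball c (ρ c) \ S) ≠ 0 := by
      intro h0
      rw [h0, mul_zero] at hhalf
      exact hV0 (le_zero_iff.1 hhalf)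
    have h3 := hC₂ c (5 * ρ c) (by positivity) (ball c (ρ c) \ S)
      (sdiff_subset.trans (ball_subset_ball (by linarith))) (measurableSet_ball.diff hSm)
    refine (ENNReal.mul_le_mul_iff_left (ENNReal.rpow_pos (pos_iff_ne_zero.2 hD0) hDt).ne'
      (ENNReal.rpow_ne_top_of_nonneg hp0 hDt)).1 (h3.trans ?_)
    rw [volume_ball_mul c c (by norm_num) hr]
    calc C₂ * (ENNReal.ofReal (5 ^ n) * V) ^ p * weightMeasure w (ball c (ρ c) \ S)
        ≤ C₂ * (ENNReal.ofReal (5 ^ n) * (2 * volume (ball c (ρ c) \ S))) ^ p *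
            weightMeasure w (ball c (ρ c) \ S) := by gcongr
      _ = _ := by
          rw [← mul_assoc (ENNReal.ofReal _), ENNReal.mul_rpow_of_nonneg _ _ hp0, ENNReal.coe_mul,
            ENNReal.coe_rpow_of_nonneg _ hp0, ENNReal.ofReal_pow (by norm_num)]
          push_cast
          simp only [ENNReal.ofReal_ofNat]
          ring
  have hUD : weightMeasure w U ≤
      (C₂ * (5 ^ n * 2) ^ p : ℝ≥0) * weightMeasure w (U \ S) := by
    calc weightMeasure w U ≤ weightMeasure w (⋃ c ∈ u, ball c (5 * ρ c)) := measure_mono hcov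
      _ ≤ ∑' c : u, weightMeasure w (ball c.1 (5 * ρ c)) := measure_biUnion_le _ hu _
      _ ≤ ∑' c : u, (C₂ * (5 ^ n * 2) ^ p : ℝ≥0) * weightMeasure w (ball c.1 (ρ c) \ S) :=
          ENNReal.tsum_le_tsum fun c => hlocal c c.2
      _ = (C₂ * (5 ^ n * 2) ^ p : ℝ≥0) * weightMeasure w (⋃ c ∈ u, ball c (ρ c) \ S) := by
          rw [ENNReal.tsum_mul_left, measure_biUnion hu
            (fun i hi j hj hij => (hdisj hi hj hij).mono sdiff_subset sdiff_subset)
            fun c _ => measurableSet_ball.diff hSm]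
      _ ≤ _ := by
          gcongr
          refine iUnion₂_subset fun c hc => sdiff_subset_sdiff_left
            ((ball_subset_ball ?_).trans (h40 c hc))
          have := hρ c hc
          linarith
  have hsplit : weightMeasure w S + weightMeasure w (U \ S) = weightMeasure w U := by
    have := measure_inter_add_sdiff (μ := weightMeasure w) U hSm
    rwa [inter_eq_right.2 hSU] at this
  calc _ = (C₂ * (5 ^ n * 2) ^ p : ℝ≥0) * weightMeasure w S + weightMeasure w S := by ring
    _ ≤ (C₂ * (5 ^ n * 2) ^ p : ℝ≥0) * weightMeasure w S +
          (C₂ * (5 ^ n * 2) ^ p : ℝ≥0) * weightMeasure w (U \ S) := by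
        gcongr
        exact (measure_mono hSU).trans hUD
    _ = _ := by rw [← mul_add, hsplit]

/-- Far away from the support of `f` the maximal truncated operator is dominated by the maximal
function. -/
lemma StandardKernel.maximalTruncated_le_of_support (hK : StandardKernel K A δ) {R : ℝ}
    (hR : 0 < R) (hf0 : ∀ y, y ∉ ball 0 R → f y = 0) {x : E n} (hx : x ∉ ball 0 (2 * R)) :
    maximalTruncated K f x ≤ A * ENNReal.ofReal (4 ^ n) * volume (ball (0 : E n) 1) *
      maximalFn volume (fun y => ‖f y‖ₑ) x := by
  set d := dist x 0
  have hd : 2 * R ≤ d := not_lt.1 hx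
  have hd0 : 0 < d := by linarith
  refine maximalTruncated_le fun ε hε => ?_
  have hfar : ∀ y ∈ ball (0 : E n) R, d / 2 ≤ dist x y := by
    intro y hy
    have hy : dist y 0 < R := hy
    have := dist_triangle x y 0
    linarith
  calc ‖truncated K ε f x‖ₑ ≤ ∫⁻ y in (ball x ε)ᶜ, ‖K x y * f y‖ₑ :=
        enorm_integral_le_lintegral_enorm _
    _ ≤ ∫⁻ y in ball 0 (2 * d), A * ENNReal.ofReal ((d / 2) ^ (-(n : ℝ))) * ‖f y‖ₑ := by
        refine (setLIntegral_le_lintegral _ _).trans ?_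
        rw [← lintegral_indicator measurableSet_ball]
        refine lintegral_mono fun y => ?_
        by_cases hy : y ∈ ball (0 : E n) R
        · rw [indicator_of_mem (ball_subset_ball (by linarith) hy), enorm_mul]
          exact mul_le_mul_left (hK.enorm_le (by positivity) (hfar y hy)) _
        · simp [hf0 y hy]
    _ = A * ENNReal.ofReal ((d / 2) ^ (-(n : ℝ))) * ∫⁻ y in ball 0 (2 * d), ‖f y‖ₑ :=
        lintegral_const_mul' _ _ (by finiteness)
    _ ≤ A * ENNReal.ofReal ((d / 2) ^ (-(n : ℝ))) * (maximalFn volume (fun y => ‖f y‖ₑ) x *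
          volume (ball (0 : E n) 1) * ENNReal.ofReal ((2 * d) ^ n)) := by
        gcongr
        exact setLIntegral_ball_le_maximalFn_mul_pow (show dist x 0 < 2 * d by linarith)
    _ = A * (ENNReal.ofReal ((d / 2) ^ (-(n : ℝ))) * ENNReal.ofReal ((2 * d) ^ n)) *
          volume (ball (0 : E n) 1) * maximalFn volume (fun y => ‖f y‖ₑ) x := by ring
    _ = _ := by
        rw [← ENNReal.ofReal_mul (by positivity), Real.rpow_neg (by positivity),
          Real.rpow_natCast, ← inv_pow, ← mul_pow]
        congr 5
        field_simp
        norm_num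

/-- The weighted strong type inequality for the maximal truncated operator. The support is bounded
for the sake of the a priori finiteness in the good-λ argument: far from the support, the operator
is dominated by the maximal function. -/
theorem exists_weighted_strong_type (hp : 1 < p) (hw : IsMuckenhoupt p w)
    (hK : StandardKernel K A δ) (hn : 0 < n)
    (h11 : ∃ C : ℝ≥0, ∀ f : E n → ℂ, Integrable f volume → ∀ t : ℝ≥0∞,
      t * volume {x | t < maximalTruncated K f x} ≤ C * ∫⁻ y, ‖f y‖ₑ) :
    ∃ C : ℝ≥0, ∀ f : E n → ℂ, Integrable f volume → (∃ R, ∀ y, y ∉ ball 0 R → f y = 0) →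
      ∫⁻ y, maximalTruncated K f y ^ p * weightFn w y ≤ C * ∫⁻ y, ‖f y‖ₑ ^ p * weightFn w y := by
  have hp0 : 0 < p := by linarith
  obtain ⟨C₁, hC₁⟩ := exists_goodLambda hp.le hw hK hn h11
  obtain ⟨s, hs, hs'⟩ := exists_lintegral_rpow_le_of_goodLambda hp0 C₁
  obtain ⟨γ, hγ, hγ'⟩ := hC₁ s hs
  obtain ⟨C₂, hC₂0, hC₂⟩ := hs' γ hγ
  obtain ⟨C₃, hC₃⟩ := hw.maximalFn_strong_type hp
  refine ⟨C₂ * (C₃ + 1), fun f hf ⟨R₀, hR₀⟩ => ?_⟩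
  obtain ⟨R, hR, hRR⟩ : ∃ R : ℝ, 0 < R ∧ R₀ ≤ R :=
    ⟨max R₀ 1, lt_max_of_lt_right one_pos, le_max_left _ _⟩
  have hf0 : ∀ y, y ∉ ball 0 R → f y = 0 := fun y hy => hR₀ y fun h =>
    hy (ball_subset_ball hRR h)
  set F := maximalTruncated K f
  set m := maximalFn volume fun y => ‖f y‖ₑ
  have hF : Measurable F := hK.measurable_maximalTruncated (tailIntegrable_of_integrable hf)
  have hm : Measurable m := measurable_maximalFn
  set J := ∫⁻ y, ‖f y‖ₑ ^ p * weightFn w y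
  rcases eq_or_ne J ∞ with hJ | hJ
  · rw [hJ, ENNReal.mul_top (by exact_mod_cast (by positivity : C₂ * (C₃ + 1) ≠ 0))]
    exact le_top
  have hmJ : ∫⁻ y, m y ^ p ∂weightMeasure w ≤ C₃ * J := by
    rw [hw.lintegral_weightMeasure (hm.pow_const _).aemeasurable]
    exact hC₃ _ hf.1.enorm
  have hfin : ∀ N : ℕ, ∫⁻ x, min (F x) N ^ p ∂weightMeasure w ≠ ∞ := by
    intro N
    set b : ℝ≥0∞ := A * ENNReal.ofReal (4 ^ n) * volume (ball (0 : E n) 1)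
    have hb : b ≠ ∞ := ENNReal.mul_ne_top (by finiteness) volume_unitBall_ne_top
    have hle : ∀ x, min (F x) N ^ p ≤
        (ball (0 : E n) (2 * R)).indicator (fun _ => (N : ℝ≥0∞) ^ p) x + b ^ p * m x ^ p := by
      intro x
      by_cases hx : x ∈ ball (0 : E n) (2 * R)
      · rw [indicator_of_mem hx]
        exact le_add_right (ENNReal.rpow_le_rpow (min_le_right _ _) hp0.le)
      · rw [indicator_of_notMem hx, zero_add, ← ENNReal.mul_rpow_of_nonneg _ _ hp0.le]
        exact ENNReal.rpow_le_rpow ((min_le_left _ _).trans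
          (hK.maximalTruncated_le_of_support hR hf0 hx)) hp0.le
    refine ((lintegral_mono hle).trans_lt ?_).ne
    rw [lintegral_add_right _ ((hm.pow_const _).const_mul _),
      lintegral_indicator_const measurableSet_ball, lintegral_const_mul _ (hm.pow_const _)]
    refine ENNReal.add_lt_top.2 ⟨ENNReal.mul_lt_top (by finiteness)
      (hw.weightMeasure_ball_lt_top _ _), ENNReal.mul_lt_top ?_ (hmJ.trans_lt ?_)⟩
    · exact (ENNReal.rpow_ne_top_of_nonneg hp0.le hb).lt_top
    · exact ENNReal.mul_lt_top ENNReal.coe_lt_top hJ.lt_top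
  have h := hC₂ (weightMeasure w) hF hm (hγ' f hf) hfin
  rw [← hw.lintegral_weightMeasure (hF.pow_const _).aemeasurable]
  refine h.trans ?_
  rw [ENNReal.coe_mul, mul_assoc]
  gcongr
  refine hmJ.trans ?_
  gcongr
  simp

/-- The weighted weak type inequality for the maximal truncated operator and `A_1` weights, for
functions with bounded support. -/
theorem exists_weighted_weak_type (hp : p = 1) (hw : IsMuckenhoupt p w)
    (hK : StandardKernel K A δ) (hn : 0 < n)
    (h11 : ∃ C : ℝ≥0, ∀ f : E n → ℂ, Integrable f volume → ∀ t : ℝ≥0∞,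
      t * volume {x | t < maximalTruncated K f x} ≤ C * ∫⁻ y, ‖f y‖ₑ) :
    ∃ C : ℝ≥0, ∀ f : E n → ℂ, Integrable f volume → (∃ R, ∀ y, y ∉ ball 0 R → f y = 0) →
      ∀ t : ℝ≥0∞, t * weightMeasure w {x | t < maximalTruncated K f x} ≤
        C * ∫⁻ y, ‖f y‖ₑ * weightFn w y := by
  obtain ⟨C₁, hC₁⟩ := exists_goodLambda hp.ge hw hK hn h11
  obtain ⟨s, hs, hs'⟩ := exists_mul_measure_le_of_goodLambda C₁
  obtain ⟨γ, hγ, hγ'⟩ := hC₁ s hs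
  obtain ⟨C₂, hC₂0, hC₂⟩ := hs' γ hγ
  obtain ⟨C₃, hC₃⟩ := hw.maximalFn_weak_type hp
  refine ⟨C₂ * (C₃ + 1), fun f hf ⟨R₀, hR₀⟩ => ?_⟩
  obtain ⟨R, hR, hRR⟩ : ∃ R : ℝ, 0 < R ∧ R₀ ≤ R :=
    ⟨max R₀ 1, lt_max_of_lt_right one_pos, le_max_left _ _⟩
  have hf0 : ∀ y, y ∉ ball 0 R → f y = 0 := fun y hy => hR₀ y fun h =>
    hy (ball_subset_ball hRR h)
  set F := maximalTruncated K f
  set m := maximalFn volume fun y => ‖f y‖ₑ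
  set J := ∫⁻ y, ‖f y‖ₑ * weightFn w y
  rcases eq_or_ne J ∞ with hJ | hJ
  · intro t
    rw [hJ, ENNReal.mul_top (by exact_mod_cast (by positivity : C₂ * (C₃ + 1) ≠ 0))]
    exact le_top
  have hmJ : ∀ t : ℝ≥0∞, t * weightMeasure w {x | t < m x} ≤ C₃ * J := hC₃ _ hf.1.enorm
  have hfin : ∀ N : ℕ, ∃ D : ℝ≥0, ∀ t : ℝ≥0∞,
      t * weightMeasure w {x | t < min (F x) N} ≤ D := by
    intro N
    set b : ℝ≥0∞ := A * ENNReal.ofReal (4 ^ n) * volume (ball (0 : E n) 1) + 1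
    have hb : b ≠ ∞ := ENNReal.add_ne_top.2
      ⟨ENNReal.mul_ne_top (by finiteness) volume_unitBall_ne_top, by norm_num⟩
    have hb0 : b ≠ 0 := by simp [b]
    set D := N * weightMeasure w (ball 0 (2 * R)) + b * (C₃ * J)
    have hD : D ≠ ∞ := ENNReal.add_ne_top.2 ⟨ENNReal.mul_ne_top (by finiteness)
      (hw.weightMeasure_ball_lt_top _ _).ne, ENNReal.mul_ne_top hb (by finiteness)⟩
    refine ⟨D.toNNReal, fun t => ?_⟩
    rw [ENNReal.coe_toNNReal hD]
    rcases le_or_gt (N : ℝ≥0∞) t with hN | hN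
    · have : {x | t < min (F x) N} = ∅ := by
        ext x
        simp only [mem_ofPred_eq, mem_empty_iff_false, iff_false, not_lt]
        exact (min_le_right _ _).trans hN
      rw [this]
      simp
    have hsub : {x | t < min (F x) N} ⊆ ball 0 (2 * R) ∪ {x | t / b < m x} := by
      intro x hx
      by_cases hxb : x ∈ ball (0 : E n) (2 * R)
      · exact .inl hxb
      · refine .inr ?_
        rw [mem_ofPred_eq, ENNReal.div_lt_iff (.inl hb0) (.inl hb), mul_comm]
        refine (lt_min_iff.1 hx).1.trans_le
          ((hK.maximalTruncated_le_of_support hR hf0 hxb).trans ?_)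
        exact mul_le_mul_left le_self_add _
    calc t * weightMeasure w {x | t < min (F x) N}
        ≤ t * (weightMeasure w (ball 0 (2 * R)) + weightMeasure w {x | t / b < m x}) := by
          gcongr
          exact (measure_mono hsub).trans (measure_union_le _ _)
      _ = t * weightMeasure w (ball 0 (2 * R)) +
            b * (t / b * weightMeasure w {x | t / b < m x}) := by
          rw [mul_add, ← mul_assoc b, ENNReal.mul_div_cancel hb0 hb]
      _ ≤ D := add_le_add (mul_le_mul_left hN.le _) (mul_le_mul_right (hmJ _) _)
  intro t
  refine (hC₂ (weightMeasure w) (hγ' f hf) hmJ hfin t).trans ?_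
  rw [ENNReal.coe_mul, mul_assoc]
  gcongr
  simp

end Weighted

/-! ### Local estimates and generalized weighted Morrey spaces -/

section Morrey

variable {n : ℕ} {p : ℝ} {w : E n → ℝ} {K : E n → E n → ℂ} {A : ℝ≥0} {δ : ℝ}

/-- The integral over `t > r` of the normalized local norms
`w(B(x,t)) ^ (-1/p) * ‖g‖_{L_{p,w}(B(x,t))}` with respect to `dt / t`. -/
def morreyTail (p : ℝ) (w : E n → ℝ) (g : E n → ℝ≥0∞) (x : E n) (r : ℝ) : ℝ≥0∞ :=
  ∫⁻ t in Ioi r, wLpNorm p w g (ball x t) / weightMeasure w (ball x t) ^ (1 / p) *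
    ENNReal.ofReal (1 / t)

lemma wLpNorm_mono (hp : 0 ≤ p) (g : E n → ℝ≥0∞) {S T : Set (E n)} (h : S ⊆ T) :
    wLpNorm p w g S ≤ wLpNorm p w g T :=
  ENNReal.rpow_le_rpow (lintegral_mono_set h) (by positivity)

lemma morreyTail_anti (g : E n → ℝ≥0∞) (x : E n) {r s : ℝ} (h : r ≤ s) :
    morreyTail p w g x s ≤ morreyTail p w g x r :=
  lintegral_mono_set (Ioi_subset_Ioi h)

/-- The condition on `φ₁, φ₂` bounds the tail of a function in the space `M_{p,φ₁}(w)`: its local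
norms increase with the radius, hence are bounded by the essential infimum over larger radii. -/
lemma morreyTail_le {φ₁ φ₂ : E n → ℝ → ℝ} (hp : 0 ≤ p) {C : ℝ≥0∞} {x : E n} {r : ℝ} (hr : 0 < r)
    (hC : (∫⁻ t in Ioi r,
      essInf (fun s => ENNReal.ofReal (φ₁ x s) * wMass w (ball x s) ^ (1 / p))
          (volume.restrict (Ioi t)) /
        wMass w (ball x t) ^ (1 / p) * ENNReal.ofReal (1 / t)) ≤ C * ENNReal.ofReal (φ₂ x r))
    {g : E n → ℝ≥0∞} {N : ℝ≥0∞} (hN : N ≠ ∞)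
    (h : ∀ s, 0 < s → wLpNorm p w g (ball x s) ≤
      N * (ENNReal.ofReal (φ₁ x s) * wMass w (ball x s) ^ (1 / p))) :
    morreyTail p w g x r ≤ N * (C * ENNReal.ofReal (φ₂ x r)) := by
  refine le_trans ?_ (mul_le_mul_right hC N)
  rw [morreyTail, ← lintegral_const_mul' _ _ hN]
  refine setLIntegral_mono' measurableSet_Ioi fun t ht => ?_
  have ht0 : 0 < t := hr.trans ht
  rw [← mul_assoc, ← mul_div_assoc, ← wMass_eq]
  gcongr
  rcases eq_or_ne N 0 with rfl | hN0
  · rw [zero_mul]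
    simpa using h t ht0
  rw [mul_comm, ← ENNReal.div_le_iff hN0 hN]
  refine le_essInf_of_ae_le _ ?_
  filter_upwards [ae_restrict_mem measurableSet_Ioi] with s hs
  have hs : t < s := hs
  rw [ENNReal.div_le_iff hN0 hN, mul_comm]
  exact (wLpNorm_mono hp g (ball_subset_ball hs.le)).trans (h s (ht0.trans hs))

namespace IsMuckenhoupt

variable (hw : IsMuckenhoupt p w)
include hw

lemma weightMeasure_ball_rpow_ne_zero (x : E n) {r : ℝ} (hr : 0 < r) (s : ℝ) :
    weightMeasure w (ball x r) ^ s ≠ 0 :=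
  (ENNReal.rpow_pos (pos_iff_ne_zero.2 (hw.weightMeasure_ball_ne_zero x hr))
    (hw.weightMeasure_ball_lt_top x r).ne).ne'

lemma weightMeasure_ball_rpow_ne_top (x : E n) {r : ℝ} (hr : 0 < r) (s : ℝ) :
    weightMeasure w (ball x r) ^ s ≠ ∞ :=
  ENNReal.rpow_ne_top_of_ne_zero (hw.weightMeasure_ball_ne_zero x hr)
    (hw.weightMeasure_ball_lt_top x r).ne

/-- Means over balls are bounded by the normalized weighted norms. -/
lemma exists_setLIntegral_ball_le (hp : 1 ≤ p) : ∃ C : ℝ≥0, ∀ g : E n → ℝ≥0∞,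
    AEMeasurable g volume → ∀ (x : E n) (t : ℝ), 0 < t → ∫⁻ y in ball x t, g y ≤
      C * volume (ball x t) *
        (wLpNorm p w g (ball x t) / weightMeasure w (ball x t) ^ (1 / p)) := by
  obtain ⟨C, hC⟩ := hw.exists_rpow_mean_le hp
  have hp0 : 0 < p := by linarith
  refine ⟨C ^ (1 / p), fun g hg x t ht => ?_⟩
  have hv0 := hw.weightMeasure_ball_rpow_ne_zero x ht (1 / p)
  have hvt := hw.weightMeasure_ball_rpow_ne_top x ht (1 / p)
  have h := ENNReal.rpow_le_rpow (hC x t ht g hg) (by positivity : 0 ≤ 1 / p)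
  rw [ENNReal.mul_rpow_of_nonneg _ _ (by positivity),
    ENNReal.mul_rpow_of_nonneg _ _ (by positivity), ENNReal.mul_rpow_of_nonneg _ _ (by positivity), ← ENNReal.rpow_mul, ← ENNReal.rpow_mul,
    mul_one_div_cancel hp0.ne', ENNReal.rpow_one, ENNReal.rpow_one] at h
  rw [← mul_div_assoc, ENNReal.le_div_iff_mul_le (.inl hv0) (.inl hvt), mul_comm,
    ENNReal.coe_rpow_of_nonneg _ (by positivity)]
  exact h

/-- The part of the tail with `2 * r < t < 4 * r` controls the local norm, by doubling. -/
lemma exists_wLpNorm_ball_le (hp : 1 ≤ p) : ∃ C : ℝ≥0, ∀ (g : E n → ℝ≥0∞) (x : E n) (r : ℝ),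
    0 < r → wLpNorm p w g (ball x (2 * r)) ≤
      C * weightMeasure w (ball x r) ^ (1 / p) * morreyTail p w g x r := by
  obtain ⟨D, hD⟩ := hw.ballDoubling_weightMeasure hp
  have hp0 : 0 < p := by linarith
  refine ⟨D ^ (1 / p) * 2, fun g x r hr => ?_⟩
  set v := weightMeasure w (ball x r)
  set L := wLpNorm p w g (ball x (2 * r))
  have hv0 := hw.weightMeasure_ball_rpow_ne_zero x hr (1 / p)
  have hvt := hw.weightMeasure_ball_rpow_ne_top x hr (1 / p)
  have hDv : ∀ t ∈ Ioc (2 * r) (4 * r),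
      weightMeasure w (ball x t) ^ (1 / p) ≤ (D ^ (1 / p) : ℝ≥0) * v ^ (1 / p) := by
    intro t ht
    rw [ENNReal.coe_rpow_of_nonneg _ (by positivity), ← ENNReal.mul_rpow_of_nonneg _ _
      (by positivity)]
    refine ENNReal.rpow_le_rpow ((measure_mono (ball_subset_ball ?_)).trans (hD x r hr))
      (by positivity)
    linarith [ht.2]
  set c : ℝ≥0∞ := (D ^ (1 / p) : ℝ≥0) * v ^ (1 / p)
  have hc0 : c ≠ 0 := fun h => hw.weightMeasure_ball_rpow_ne_zero x
    (by positivity : 0 < 3 * r) (1 / p)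
      (le_zero_iff.1 ((hDv (3 * r) ⟨by linarith, by linarith⟩).trans_eq h))
  have hct : c ≠ ∞ := ENNReal.mul_ne_top ENNReal.coe_ne_top hvt
  have h : L / c * ENNReal.ofReal (1 / (4 * r)) * ENNReal.ofReal (2 * r) ≤
      morreyTail p w g x r := by
    calc _ = ∫⁻ _ in Ioc (2 * r) (4 * r), L / c * ENNReal.ofReal (1 / (4 * r)) := by
          rw [setLIntegral_const, Real.volume_Ioc]
          congr 2
          ring
      _ ≤ ∫⁻ t in Ioc (2 * r) (4 * r), wLpNorm p w g (ball x t) /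
            weightMeasure w (ball x t) ^ (1 / p) * ENNReal.ofReal (1 / t) := by
          refine setLIntegral_mono' measurableSet_Ioc fun t ht => ?_
          have ht0 : 0 < t := by linarith [ht.1]
          gcongr
          · exact wLpNorm_mono hp0.le g (ball_subset_ball ht.1.le)
          · exact hDv t ht
          · exact ht.2
      _ ≤ _ := lintegral_mono_set fun t ht => show r < t by linarith [ht.1]
  have h2 : ENNReal.ofReal (1 / (4 * r)) * ENNReal.ofReal (2 * r) * 2 = 1 := by
    rw [← ENNReal.ofReal_ofNat 2, ← ENNReal.ofReal_mul (by positivity),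
      ← ENNReal.ofReal_mul (by positivity), ← ENNReal.ofReal_one]
    congr 1
    field_simp
    norm_num
  calc L = c * (L / c * (ENNReal.ofReal (1 / (4 * r)) * ENNReal.ofReal (2 * r) * 2)) := by
        rw [h2, mul_one, ENNReal.mul_div_cancel hc0 hct]
    _ = 2 * c * (L / c * ENNReal.ofReal (1 / (4 * r)) * ENNReal.ofReal (2 * r)) := by ring
    _ ≤ 2 * c * morreyTail p w g x r := by gcongr
    _ = _ := by
        simp only [c]
        push_cast
        ring

/-- The integral `morreyTail` controls the integral of `|f|` against `|x - y| ^ (-n)` off a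
ball, as `t ^ (-n)` times the integral of `|f|` over a ball of radius `t` is bounded by the
normalized weighted norm. -/
lemma exists_tailIntegral_le (hp : 1 ≤ p) (hn : 0 < n) : ∃ C : ℝ≥0, ∀ f : E n → ℂ,
    AEStronglyMeasurable f volume → ∀ (x : E n) (r : ℝ), 0 < r →
      tailIntegral f x r ≤ C * morreyTail p w (fun y => ‖f y‖ₑ) x r := by
  obtain ⟨C, hC⟩ := hw.exists_setLIntegral_ball_le hp
  set b := volume (ball (0 : E n) 1)
  have hb : b ≠ ∞ := volume_unitBall_ne_top
  refine ⟨n * (C * b.toNNReal), fun f hf x r hr => ?_⟩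
  refine (lintegral_compl_ball_le hf.enorm x (Nat.cast_pos.2 hn) hr).trans ?_
  push_cast
  rw [ENNReal.coe_toNNReal hb, ENNReal.ofReal_natCast, mul_assoc]
  gcongr
  rw [morreyTail, ← lintegral_const_mul' _ _ (by finiteness)]
  refine setLIntegral_mono' measurableSet_Ioi fun t ht => ?_
  have ht0 : 0 < t := hr.trans ht
  refine (mul_le_mul_right (hC _ hf.enorm x t ht0) _).trans (le_of_eq ?_)
  rw [volume_ball_eq x ht0]
  have h1 : ENNReal.ofReal (t ^ (-(n : ℝ) - 1)) * ENNReal.ofReal (t ^ n) =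
      ENNReal.ofReal (1 / t) := by
    rw [← ENNReal.ofReal_mul (by positivity), ← Real.rpow_natCast, ← Real.rpow_add ht0]
    congr 1
    rw [one_div, ← Real.rpow_neg_one]
    congr 1
    ring
  rw [← h1]
  ring

/-- If all the integrals `morreyTail` are finite then the truncated singular integrals converge
absolutely. -/
lemma tailIntegrable (hp : 1 ≤ p) (hn : 0 < n) {f : E n → ℂ} (hf : AEStronglyMeasurable f volume)
    (h : ∀ x r, 0 < r → morreyTail p w (fun y => ‖f y‖ₑ) x r < ∞) : TailIntegrable f := by
  obtain ⟨C, hC⟩ := hw.exists_tailIntegral_le hp hn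
  exact ⟨hf, fun x r hr => (hC f hf x r hr).trans_lt
    (ENNReal.mul_lt_top ENNReal.coe_lt_top (h x r hr))⟩

lemma integrable_indicator_ball (hp : 1 ≤ p) {f : E n → ℂ} (hf : AEStronglyMeasurable f volume)
    {x : E n} {r : ℝ} (hr : 0 < r) (h : morreyTail p w (fun y => ‖f y‖ₑ) x r < ∞) :
    Integrable ((ball x (2 * r)).indicator f) volume := by
  obtain ⟨C₁, hC₁⟩ := hw.exists_setLIntegral_ball_le hp
  obtain ⟨C₂, hC₂⟩ := hw.exists_wLpNorm_ball_le hp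
  have h2 : 0 < 2 * r := by positivity
  rw [integrable_indicator_iff measurableSet_ball]
  refine ⟨hf.restrict, (hC₁ _ hf.enorm x _ h2).trans_lt ?_⟩
  have hL : wLpNorm p w (fun y => ‖f y‖ₑ) (ball x (2 * r)) < ∞ :=
    (hC₂ _ x r hr).trans_lt (ENNReal.mul_lt_top (ENNReal.mul_lt_top ENNReal.coe_lt_top
      (hw.weightMeasure_ball_rpow_ne_top x hr _).lt_top) h)
  exact ENNReal.mul_lt_top (ENNReal.mul_lt_top ENNReal.coe_lt_top measure_ball_lt_top)
    (ENNReal.div_lt_top hL.ne (hw.weightMeasure_ball_rpow_ne_zero x h2 _))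

end IsMuckenhoupt

lemma lintegral_indicator_enorm_rpow (hp : 0 < p) (f : E n → ℂ) {S : Set (E n)}
    (hS : MeasurableSet S) :
    ∫⁻ y, ‖S.indicator f y‖ₑ ^ p * weightFn w y = ∫⁻ y in S, ‖f y‖ₑ ^ p * weightFn w y := by
  rw [← lintegral_indicator hS]
  refine lintegral_congr fun y => ?_
  by_cases hy : y ∈ S <;> simp [hy, hp]

lemma exists_indicator_ball_eq_zero (f : E n → ℂ) (x : E n) (r : ℝ) :
    ∃ R, ∀ y, y ∉ ball 0 R → (ball x r).indicator f y = 0 := by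
  refine ⟨r + dist x 0, fun y hy => indicator_of_notMem (fun h => hy ?_) _⟩
  exact ball_subset_ball' le_rfl h

namespace StandardKernel

/-- The contribution of the complement of a ball at points of the concentric ball of half the
radius. -/
lemma maximalTruncated_sub_indicator_le (hK : StandardKernel K A δ) (f : E n → ℂ) {x y : E n}
    {r : ℝ} (hr : 0 < r) (hy : y ∈ ball x r) :
    maximalTruncated K (f - (ball x (2 * r)).indicator f) y ≤
      A * ENNReal.ofReal (2 ^ n) * tailIntegral f x (2 * r) := by
  refine maximalTruncated_le fun ε hε => (enorm_integral_le_lintegral_enorm _).trans ?_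
  refine (setLIntegral_le_lintegral _ _).trans ?_
  rw [tailIntegral, ← lintegral_const_mul' _ _ (by finiteness),
    ← lintegral_indicator measurableSet_ball.compl]
  refine lintegral_mono fun z => ?_
  by_cases hz : z ∈ ball x (2 * r)
  · simp [hz]
  have hz' : z ∈ (ball x (2 * r))ᶜ := hz
  rw [indicator_of_mem hz', Pi.sub_apply, indicator_of_notMem hz, sub_zero, enorm_mul]
  have hd := le_dist_of_mem_compl_ball hz'
  have hy : dist y x < r := hy
  have htri := dist_triangle x y z
  rw [dist_comm x y] at htri
  have hd0 : 0 < dist x z := by linarith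
  have h := hK.enorm_le (x := y) (y := z) (half_pos hd0) (by linarith)
  calc ‖K y z‖ₑ * ‖f z‖ₑ ≤ A * ENNReal.ofReal ((dist x z / 2) ^ (-(n : ℝ))) * ‖f z‖ₑ := by gcongr
    _ = _ := by
        rw [div_eq_mul_inv, mul_comm (dist x z), Real.mul_rpow (by norm_num) hd0.le,
          Real.inv_rpow (by norm_num), ← Real.rpow_neg (by norm_num), neg_neg, Real.rpow_natCast,
          ENNReal.ofReal_mul (by positivity)]
        ring

lemma exists_maximalTruncated_sub_indicator_le (hK : StandardKernel K A δ) (hn : 0 < n)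
    (hp : 1 ≤ p) (hw : IsMuckenhoupt p w) : ∃ C : ℝ≥0, ∀ f : E n → ℂ,
    AEStronglyMeasurable f volume → ∀ (x : E n) (r : ℝ), 0 < r → ∀ y ∈ ball x r,
      maximalTruncated K (f - (ball x (2 * r)).indicator f) y ≤
        C * morreyTail p w (fun y => ‖f y‖ₑ) x r := by
  obtain ⟨C, hC⟩ := hw.exists_tailIntegral_le hp hn
  refine ⟨A * 2 ^ n * C, fun f hf x r hr y hy => ?_⟩
  refine (hK.maximalTruncated_sub_indicator_le f hr hy).trans ?_
  push_cast
  rw [ENNReal.ofReal_pow (by norm_num), ENNReal.ofReal_ofNat, mul_assoc _ (C : ℝ≥0∞)]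
  refine mul_le_mul_right ?_ _
  have h : r ≤ 2 * r := by linarith
  exact (hC f hf x _ (by positivity)).trans (mul_le_mul_right (morreyTail_anti _ x h) _)

/-- Local estimate for the maximal truncated operator, `p > 1`. The part of `f` in the ball of twice
the radius is treated by the weighted bound, the rest by the size of the kernel. -/
theorem exists_wLpNorm_maximalTruncated_le (hK : StandardKernel K A δ) (hn : 0 < n)
    (hp : 1 < p) (hw : IsMuckenhoupt p w)
    (h11 : ∃ C : ℝ≥0, ∀ f : E n → ℂ, Integrable f volume → ∀ t : ℝ≥0∞,
      t * volume {x | t < maximalTruncated K f x} ≤ C * ∫⁻ y, ‖f y‖ₑ) :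
    ∃ C : ℝ≥0, ∀ f : E n → ℂ, AEStronglyMeasurable f volume →
      (∀ x r, 0 < r → morreyTail p w (fun y => ‖f y‖ₑ) x r < ∞) → ∀ (x : E n) (r : ℝ), 0 < r →
        wLpNorm p w (maximalTruncated K f) (ball x r) ≤
          C * weightMeasure w (ball x r) ^ (1 / p) * morreyTail p w (fun y => ‖f y‖ₑ) x r := by
  have hp0 : 0 < p := by linarith
  obtain ⟨C₁, hC₁⟩ := exists_weighted_strong_type hp hw hK hn h11
  obtain ⟨C₂, hC₂⟩ := hw.exists_wLpNorm_ball_le hp.le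
  obtain ⟨C₃, hC₃⟩ := hK.exists_maximalTruncated_sub_indicator_le hn hp.le hw
  refine ⟨C₁ ^ (1 / p) * C₂ + C₃, fun f hf hfin x r hr => ?_⟩
  set f₁ := (ball x (2 * r)).indicator f
  set Q := morreyTail p w (fun y => ‖f y‖ₑ) x r
  set v := weightMeasure w (ball x r)
  have hf₁ : Integrable f₁ volume := hw.integrable_indicator_ball hp.le hf hr (hfin x r hr)
  have hT := hw.tailIntegrable hp.le hn hf hfin
  have hT₁ := tailIntegrable_of_integrable hf₁
  have hm₁ : Measurable (maximalTruncated K f₁) := hK.measurable_maximalTruncated hT₁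
  have hnorm : ∀ h : E n → ℝ≥0∞, Measurable h →
      wLpNorm p w h (ball x r) = (∫⁻ y in ball x r, h y ^ p ∂weightMeasure w) ^ (1 / p) := by
    intro h hh
    rw [hw.setLIntegral_weightMeasure (hh.pow_const p).aemeasurable measurableSet_ball]
    rfl
  have hnear : wLpNorm p w (maximalTruncated K f₁) (ball x r) ≤
      (C₁ ^ (1 / p) : ℝ≥0) * (C₂ * v ^ (1 / p) * Q) := by
    calc _ ≤ (C₁ * ∫⁻ y, ‖f₁ y‖ₑ ^ p * weightFn w y) ^ (1 / p) := by
          refine ENNReal.rpow_le_rpow ((setLIntegral_le_lintegral _ _).trans ?_) (by positivity)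
          exact hC₁ f₁ hf₁ (exists_indicator_ball_eq_zero f x (2 * r))
      _ = (C₁ ^ (1 / p) : ℝ≥0) * wLpNorm p w (fun y => ‖f y‖ₑ) (ball x (2 * r)) := by
          rw [lintegral_indicator_enorm_rpow hp0 f measurableSet_ball,
            ENNReal.mul_rpow_of_nonneg _ _ (by positivity),
            ENNReal.coe_rpow_of_nonneg _ (by positivity)]
          rfl
      _ ≤ _ := mul_le_mul_right (hC₂ _ x r hr) _
  calc wLpNorm p w (maximalTruncated K f) (ball x r)
      ≤ wLpNorm p w (maximalTruncated K f₁ + fun _ => C₃ * Q) (ball x r) := by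
        refine ENNReal.rpow_le_rpow (setLIntegral_mono' measurableSet_ball fun y hy => ?_)
          (by positivity)
        gcongr
        exact (hK.maximalTruncated_le_add hT hT₁ y).trans
          (add_le_add_right (hC₃ f hf x r hr y hy) _)
    _ ≤ wLpNorm p w (maximalTruncated K f₁) (ball x r) +
          wLpNorm p w (fun _ => C₃ * Q) (ball x r) := by
        rw [hnorm _ (hm₁.add measurable_const), hnorm _ hm₁, hnorm _ measurable_const]
        exact ENNReal.lintegral_Lp_add_le hm₁.aemeasurable measurable_const.aemeasurable hp.le
    _ = wLpNorm p w (maximalTruncated K f₁) (ball x r) + v ^ (1 / p) * (C₃ * Q) := by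
        rw [hnorm _ measurable_const, setLIntegral_const,
          ENNReal.mul_rpow_of_nonneg _ _ (by positivity), ← ENNReal.rpow_mul,
          mul_one_div_cancel hp0.ne', ENNReal.rpow_one, mul_comm (v ^ (1 / p))]
    _ ≤ (C₁ ^ (1 / p) : ℝ≥0) * (C₂ * v ^ (1 / p) * Q) + v ^ (1 / p) * (C₃ * Q) := by gcongr
    _ = _ := by
        push_cast
        ring

/-- Local weak type estimate for the maximal truncated operator, `p = 1`. -/
theorem exists_wWeakLpNorm_maximalTruncated_le (hK : StandardKernel K A δ) (hn : 0 < n)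
    (hp : p = 1) (hw : IsMuckenhoupt p w)
    (h11 : ∃ C : ℝ≥0, ∀ f : E n → ℂ, Integrable f volume → ∀ t : ℝ≥0∞,
      t * volume {x | t < maximalTruncated K f x} ≤ C * ∫⁻ y, ‖f y‖ₑ) :
    ∃ C : ℝ≥0, ∀ f : E n → ℂ, AEStronglyMeasurable f volume →
      (∀ x r, 0 < r → morreyTail p w (fun y => ‖f y‖ₑ) x r < ∞) → ∀ (x : E n) (r : ℝ), 0 < r →
        wWeakLpNorm p w (maximalTruncated K f) (ball x r) ≤
          C * weightMeasure w (ball x r) ^ (1 / p) * morreyTail p w (fun y => ‖f y‖ₑ) x r := by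
  subst hp
  obtain ⟨C₁, hC₁⟩ := exists_weighted_weak_type rfl hw hK hn h11
  obtain ⟨C₂, hC₂⟩ := hw.exists_wLpNorm_ball_le le_rfl
  obtain ⟨C₃, hC₃⟩ := hK.exists_maximalTruncated_sub_indicator_le hn le_rfl hw
  refine ⟨2 * (C₁ * C₂ + C₃), fun f hf hfin x r hr => ?_⟩
  set f₁ := (ball x (2 * r)).indicator f
  have hf₁ : Integrable f₁ volume := hw.integrable_indicator_ball le_rfl hf hr (hfin x r hr)
  have hT := hw.tailIntegrable le_rfl hn hf hfin
  have hT₁ := tailIntegrable_of_integrable hf₁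
  set Q := morreyTail 1 w (fun y => ‖f y‖ₑ) x r
  set v := weightMeasure w (ball x r)
  have hnear : ∀ s : ℝ≥0∞, s * weightMeasure w {y | s < maximalTruncated K f₁ y} ≤
      C₁ * (C₂ * v * Q) := by
    intro s
    refine (hC₁ f₁ hf₁ (exists_indicator_ball_eq_zero f x (2 * r)) s).trans ?_
    have h := lintegral_indicator_enorm_rpow (w := w) one_pos f
      (measurableSet_ball (x := x) (ε := 2 * r))
    have h2 := hC₂ (fun y => ‖f y‖ₑ) x r hr
    simp only [wLpNorm, div_one, ENNReal.rpow_one] at h h2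
    rw [h]
    exact mul_le_mul_right h2 _
  have hfar : ∀ s : ℝ≥0∞,
      s * weightMeasure w {y | y ∈ ball x r ∧
        s < maximalTruncated K (f - f₁) y} ≤ C₃ * v * Q := by
    intro s
    rcases le_or_gt (C₃ * Q) s with hs | hs
    · have : {y | y ∈ ball x r ∧ s < maximalTruncated K (f - f₁) y} = ∅ := by
        ext y
        simp only [mem_ofPred_eq, mem_empty_iff_false, iff_false, not_and, not_lt]
        exact fun hy => (hC₃ f hf x r hr y hy).trans hs
      rw [this]
      simp
    · calc _ ≤ C₃ * Q * v := mul_le_mul' hs.le (measure_mono fun y hy => hy.1)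
        _ = _ := by ring
  refine iSup_le fun t => iSup_le fun ht => ?_
  rw [div_one, ENNReal.rpow_one, ENNReal.rpow_one, wMass_eq]
  set s : ℝ≥0∞ := ENNReal.ofReal t / 2
  have hst : ENNReal.ofReal t = 2 * s := (ENNReal.mul_div_cancel (by norm_num) (by norm_num)).symm
  have hsub : {y | y ∈ ball x r ∧ ENNReal.ofReal t < maximalTruncated K f y} ⊆
      {y | s < maximalTruncated K f₁ y} ∪
        {y | y ∈ ball x r ∧ s < maximalTruncated K (f - f₁) y} := by
    rintro y ⟨hy, hty⟩
    by_contra hcon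
    simp only [mem_union, mem_ofPred_eq, not_or, not_and, not_lt] at hcon
    refine absurd (hty.trans_le (hK.maximalTruncated_le_add hT hT₁ y)) (not_lt.2 ?_)
    rw [hst, two_mul]
    exact add_le_add hcon.1 (hcon.2 hy)
  calc _ ≤ 2 * s * (weightMeasure w {y | s < maximalTruncated K f₁ y} +
        weightMeasure w {y | y ∈ ball x r ∧ s < maximalTruncated K (f - f₁) y}) := by
        rw [hst] at hsub ⊢
        gcongr
        exact (measure_mono hsub).trans (measure_union_le _ _)
    _ = 2 * (s * weightMeasure w {y | s < maximalTruncated K f₁ y} +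
        s * weightMeasure w {y | y ∈ ball x r ∧ s < maximalTruncated K (f - f₁) y}) := by ring
    _ ≤ 2 * (C₁ * (C₂ * v * Q) + C₃ * v * Q) := by
        exact mul_le_mul_right (add_le_add (hnear s) (hfar s)) _
    _ = _ := by
        push_cast
        ring

end StandardKernel

/-- The extension by zero of a function in `M_{p,φ}(Ω,w)` belongs to `M_{p,φ}(w)`, because
`w(Ω ∩ B) ≤ w(B)` for balls `B`. -/
lemma wLpNorm_indicator_le {φ : E n → ℝ → ℝ} (hφ : ∀ x r, 0 < r → 0 < φ x r)
    (hp : 1 ≤ p) (hw : IsMuckenhoupt p w) {Ω : Set (E n)} (hΩ : MeasurableSet Ω) (f : E n → ℂ)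
    {x : E n} {r : ℝ} (hr : 0 < r) :
    wLpNorm p w (fun y => ‖Ω.indicator f y‖ₑ) (ball x r) ≤
      morreyNorm p φ w Ω (fun y => ‖f y‖ₑ) *
        (ENNReal.ofReal (φ x r) * wMass w (ball x r) ^ (1 / p)) := by
  have hp0 : 0 < p := by linarith
  have hL : wLpNorm p w (fun y => ‖Ω.indicator f y‖ₑ) (ball x r) =
      wLpNorm p w (fun y => ‖f y‖ₑ) (Ω ∩ ball x r) := by
    rw [wLpNorm, wLpNorm, ← lintegral_indicator measurableSet_ball,
      ← lintegral_indicator (hΩ.inter measurableSet_ball)]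
    congr 1
    refine lintegral_congr fun y => ?_
    by_cases h1 : y ∈ Ω <;> by_cases h2 : y ∈ ball x r <;> simp [indicator, h1, h2, hp0]
  rw [hL]
  set m := wMass w (Ω ∩ ball x r)
  have hmle : m ≤ wMass w (ball x r) := lintegral_mono_set inter_subset_right
  have hmt : m ≠ ∞ := (hmle.trans_lt (by
    rw [wMass_eq]; exact hw.weightMeasure_ball_lt_top x r)).ne
  set b := ENNReal.ofReal (φ x r)
  have hb0 : b ≠ 0 := by simpa [b] using hφ x r hr
  have hle : b⁻¹ * m ^ (-1 / p) * wLpNorm p w (fun y => ‖f y‖ₑ) (Ω ∩ ball x r) ≤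
      morreyNorm p φ w Ω (fun y => ‖f y‖ₑ) :=
    le_iSup_of_le x (le_iSup_of_le r (le_iSup_of_le hr le_rfl))
  -- If `w(Ω ∩ B) = 0` then the term of the Morrey norm carries no information, but the local norm
  -- vanishes.
  rcases eq_or_ne m 0 with hm | hm
  · have : wLpNorm p w (fun y => ‖f y‖ₑ) (Ω ∩ ball x r) = 0 := by
      have hae : ∀ᵐ y ∂volume.restrict (Ω ∩ ball x r), ENNReal.ofReal (w y) = 0 := by
        have := (lintegral_eq_zero_iff' hw.aemeasurable_weightFn.restrict).1 hm
        exact this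
      rw [wLpNorm, lintegral_congr_ae (g := 0) (by
        filter_upwards [hae] with y hy
        simp [hy])]
      simp [hp0]
    rw [this]
    exact zero_le
  · have h1 : m ^ (-1 / p) * m ^ (1 / p) = 1 := by
      rw [← ENNReal.rpow_add _ _ hm hmt, ← add_div]
      simp
    calc wLpNorm p w (fun y => ‖f y‖ₑ) (Ω ∩ ball x r)
        = b⁻¹ * b * (m ^ (-1 / p) * m ^ (1 / p)) *
            wLpNorm p w (fun y => ‖f y‖ₑ) (Ω ∩ ball x r) := by
          rw [h1, ENNReal.inv_mul_cancel hb0 ENNReal.ofReal_ne_top, one_mul, one_mul]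
      _ = b⁻¹ * m ^ (-1 / p) * wLpNorm p w (fun y => ‖f y‖ₑ) (Ω ∩ ball x r) *
            (b * m ^ (1 / p)) := by ring
      _ ≤ _ := by gcongr

/-- Local bounds of `K^*` by `morreyTail` give boundedness on Morrey spaces. Here `L` is either the
norm of `L_{p,w}` or that of weak `L_{p,w}`. -/
lemma maximalBounded_of_local {φ₁ φ₂ : E n → ℝ → ℝ} (hφ₁ : ∀ x r, 0 < r → 0 < φ₁ x r)
    (hφ₂ : ∀ x r, 0 < r → 0 < φ₂ x r) (hφ : PairCondition p φ₁ φ₂ w) (hp : 1 ≤ p)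
    (hw : IsMuckenhoupt p w) (hK : StandardKernel K A δ) (hn : 0 < n) {Ω : Set (E n)}
    (hΩ : MeasurableSet Ω) {L : (E n → ℝ≥0∞) → Set (E n) → ℝ≥0∞}
    (hL : ∃ C : ℝ≥0, ∀ f : E n → ℂ, AEStronglyMeasurable f volume →
      (∀ x r, 0 < r → morreyTail p w (fun y => ‖f y‖ₑ) x r < ∞) → ∀ (x : E n) (r : ℝ), 0 < r →
        L (maximalTruncated K f) (ball x r) ≤
          C * weightMeasure w (ball x r) ^ (1 / p) * morreyTail p w (fun y => ‖f y‖ₑ) x r) :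
    MaximalBounded p φ₁ w Ω (fun g => ⨆ (x : E n) (r : ℝ) (_ : 0 < r),
      (ENNReal.ofReal (φ₂ x r))⁻¹ * wMass w (univ ∩ ball x r) ^ (-1 / p) *
        L g (univ ∩ ball x r)) K := by
  obtain ⟨C₁, hC₁⟩ := hφ
  obtain ⟨C₂, hC₂⟩ := hL
  refine ⟨C₂ * C₁, fun f hf => ?_⟩
  set N := morreyNorm p φ₁ w Ω fun y => ‖f y‖ₑ
  set g := Ω.indicator f
  have hg : AEStronglyMeasurable g volume :=
    (aestronglyMeasurable_indicator_iff hΩ).2 hf.aestronglyMeasurable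
  have hQ : ∀ x r, 0 < r → morreyTail p w (fun y => ‖g y‖ₑ) x r ≤
      N * (C₁ * ENNReal.ofReal (φ₂ x r)) := fun x r hr =>
    morreyTail_le (by linarith) hr (hC₁ x r hr) hf.norm_lt_top.ne
      fun s hs => wLpNorm_indicator_le hφ₁ hp hw hΩ f hs
  have hfin : ∀ x r, 0 < r → morreyTail p w (fun y => ‖g y‖ₑ) x r < ∞ := fun x r hr =>
    (hQ x r hr).trans_lt (ENNReal.mul_lt_top hf.norm_lt_top (by finiteness))
  have hT := hw.tailIntegrable hp hn hg hfin
  refine ⟨fun x ε hε => hK.integrableOn hT x hε, (hK.measurable_maximalTruncated hT).aemeasurable,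
    iSup_le fun x => iSup_le fun r => iSup_le fun hr => ?_⟩
  rw [univ_inter, wMass_eq]
  set v := weightMeasure w (ball x r)
  set b := ENNReal.ofReal (φ₂ x r)
  have hb0 : b ≠ 0 := by simpa [b] using hφ₂ x r hr
  have hv : v ^ (-1 / p) * v ^ (1 / p) = 1 := by
    rw [← ENNReal.rpow_add _ _ (hw.weightMeasure_ball_ne_zero x hr)
      (hw.weightMeasure_ball_lt_top x r).ne, ← add_div]
    simp
  calc b⁻¹ * v ^ (-1 / p) * L (maximalTruncated K g) (ball x r)
      ≤ b⁻¹ * v ^ (-1 / p) * (C₂ * v ^ (1 / p) * (N * (C₁ * b))) := by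
        gcongr
        exact (hC₂ g hg hfin x r hr).trans (mul_le_mul_right (hQ x r hr) _)
    _ = (b⁻¹ * b) * (v ^ (-1 / p) * v ^ (1 / p)) * (C₂ * C₁ * N) := by ring
    _ = _ := by
        rw [hv, ENNReal.inv_mul_cancel hb0 ENNReal.ofReal_ne_top, one_mul, one_mul, ENNReal.coe_mul]

/-- In dimension zero the complements of balls are empty, and `K^*` vanishes. -/
lemma maximalBounded_of_dim_zero (hn : n = 0) {φ : E n → ℝ → ℝ} {Ω : Set (E n)}
    {N : (E n → ℝ≥0∞) → ℝ≥0∞} (hN : N 0 = 0) : MaximalBounded p φ w Ω N K := by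
  subst hn
  have hball : ∀ (x : E 0) (ε : ℝ), 0 < ε → (ball x ε)ᶜ = ∅ := fun x ε hε => by
    rw [compl_empty_iff, eq_univ_iff_forall]
    intro y
    rw [Subsingleton.elim y x]
    exact mem_ball_self hε
  have h0 : ∀ f : E 0 → ℂ, maximalTruncated K f = 0 := fun f => funext fun x =>
    le_zero_iff.1 (StandardKernel.maximalTruncated_le fun ε hε => by
      rw [truncated, hball x ε hε]
      simp)
  refine ⟨0, fun f _ => ⟨fun x ε hε => ?_, ?_, ?_⟩⟩
  · rw [hball x ε hε]
    exact integrableOn_empty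
  · rw [h0]
    exact aemeasurable_const
  · rw [h0, hN]
    exact zero_le

lemma morreyNorm_zero (hp : 0 < p) (φ : E n → ℝ → ℝ) (Ω : Set (E n)) :
    morreyNorm p φ w Ω 0 = 0 := by
  simp [morreyNorm, wLpNorm, hp]

lemma weakMorreyNorm_zero (hp : 0 < p) (φ : E n → ℝ → ℝ) (Ω : Set (E n)) :
    weakMorreyNorm p φ w Ω 0 = 0 := by
  simp [weakMorreyNorm, wWeakLpNorm, wMass, hp]

lemma exists_weak_type_one_of_isCalderonZygmund (hn : 0 < n) (hCZ : IsCalderonZygmund K)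
    (hK : StandardKernel K A δ) : ∃ C : ℝ≥0, ∀ f : E n → ℂ, Integrable f volume → ∀ t : ℝ≥0∞,
      t * volume {x | t < maximalTruncated K f x} ≤ C * ∫⁻ y, ‖f y‖ₑ := by
  obtain ⟨T, hT⟩ := hCZ.operator
  exact hK.exists_weak_type_one hn (hK.exists_weak_type_two hn hT)

end Morrey

end

end WeightedMorrey

theorem theorem3p1 {n : ℕ} {p : ℝ} (hp : 1 ≤ p)
    {Ω : Set (WeightedMorrey.E n)} (hΩ : IsOpen Ω)
    {w : WeightedMorrey.E n → ℝ} (hw : WeightedMorrey.IsMuckenhoupt p w)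
    {φ₁ φ₂ : WeightedMorrey.E n → ℝ → ℝ}
    (hφ₁ : ∀ x r, 0 < r → 0 < φ₁ x r) (hφ₂ : ∀ x r, 0 < r → 0 < φ₂ x r)
    (hφ : WeightedMorrey.PairCondition p φ₁ φ₂ w)
    {K : WeightedMorrey.E n → WeightedMorrey.E n → ℂ}
    (hK : WeightedMorrey.IsCalderonZygmund K) :
    (1 < p →
      WeightedMorrey.MaximalBounded p φ₁ w Ω
        (WeightedMorrey.morreyNorm p φ₂ w Set.univ) K ∧
      WeightedMorrey.MaximalBounded p φ₁ w Set.univ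
        (WeightedMorrey.morreyNorm p φ₂ w Set.univ) K) ∧
    (p = 1 →
      WeightedMorrey.MaximalBounded p φ₁ w Ω
        (WeightedMorrey.weakMorreyNorm p φ₂ w Set.univ) K ∧
      WeightedMorrey.MaximalBounded p φ₁ w Set.univ
        (WeightedMorrey.weakMorreyNorm p φ₂ w Set.univ) K) := by
  -- In dimension zero there are no nontrivial truncated integrals.
  rcases n.eq_zero_or_pos with hn | hn
  · exact ⟨fun h => ⟨WeightedMorrey.maximalBounded_of_dim_zero hn
      (WeightedMorrey.morreyNorm_zero (by linarith) _ _),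
      WeightedMorrey.maximalBounded_of_dim_zero hn
      (WeightedMorrey.morreyNorm_zero (by linarith) _ _)⟩,
      fun h => ⟨WeightedMorrey.maximalBounded_of_dim_zero hn
      (WeightedMorrey.weakMorreyNorm_zero (by linarith) _ _),
      WeightedMorrey.maximalBounded_of_dim_zero hn
      (WeightedMorrey.weakMorreyNorm_zero (by linarith) _ _)⟩⟩
  obtain ⟨A, δ, hS⟩ := hK.exists_standardKernel
  have h11 := WeightedMorrey.exists_weak_type_one_of_isCalderonZygmund hn hK hS
  refine ⟨fun h => ?_, fun h => ?_⟩
  · have hL := hS.exists_wLpNorm_maximalTruncated_le hn h hw h11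
    exact ⟨WeightedMorrey.maximalBounded_of_local hφ₁ hφ₂ hφ hp hw hS hn hΩ.measurableSet hL,
      WeightedMorrey.maximalBounded_of_local hφ₁ hφ₂ hφ hp hw hS hn MeasurableSet.univ hL⟩
  · have hL := hS.exists_wWeakLpNorm_maximalTruncated_le hn h hw h11
    exact ⟨WeightedMorrey.maximalBounded_of_local hφ₁ hφ₂ hφ hp hw hS hn hΩ.measurableSet hL,
      WeightedMorrey.maximalBounded_of_local hφ₁ hφ₂ hφ hp hw hS hn MeasurableSet.univ hL⟩
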